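/- Fix $r\in(0,1)$. Let $\|z\|_{\mathrm{hyb}}=\max\{1,|z|\}$ for $z\in\mathbb C^*$, $\|0\|_{\mathrm{hyb}}=0$, and let $A_r$ be the ring of Laurent series $f=\sum_n a_nt^n\in K:=\mathbb C((t))$ with $\|f\|_{\mathrm{hyb}}=\sum_n\|a_n\|_{\mathrm{hyb}}r^n<\infty$. Let $X$ be a non-empty smooth proper $A_r$-scheme (for example a projective degeneration of complex manifolds over the punctured disk, meromorphic at $0$), $L$ a semi-ample line bundle on $X$, and $m\ge1$. For $0<|t|\le r$ let $(X_t,L_t)$ be the complex fibre (base change along $f\mapsto f(t)$) and $(X_K,L_K)$ the base change to $K$, where $K$ carries the $t$-adic absolute value with $|t|=r$. For a scheme $Y$ of finite type over a normed ring $(A,\|\cdot\|)$, $Y^{\mathrm{an}}$ is the Berkovich analytification (locally, multiplicative seminorms on $B$, $Y=\operatorname{Spec}B$, whose restriction to $A$ is bounded by $\|\cdot\|$, with the topology of pointwise convergence). Metrics on a line bundle $M$ over $Y$ are written additively, $\phi=-\log\|\cdot\|_\phi$. A continuous metric has continuous, finite local functions $-\log\|s\|_\phi$ ($s$ a local frame);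 a singular metric has upper semicontinuous local functions with values in $[-\infty,\infty)$, not identically $-\infty$ on $U^{\mathrm{an}}$ for any non-empty Zariski open $U$ on which $M$ is trivialized. A tropical Fubini–Study metric is a metric $d^{-1}\max_{j}(\log|s_j|+a_j)$, where $d\ge1$, $(s_j)_j$ is a finite family of sections of $dM$ without common zeroes and $a_j\in\mathbb R$. A singular metric is psh if it is the pointwise limit of a decreasing net of tropical Fubini–Study metrics and is not identically $-\infty$ on the fibre over any bounded multiplicative seminorm on $A$ with zero kernel. Let $X^{\mathrm{hyb}}$ be the analytification of $X$ over $(A_r,\|\cdot\|_{\mathrm{hyb}})$; metrics on $X^{\mathrm{hyb}}$ are called hybrid metrics. The maps $\beta_t:X_t^{\mathrm{an}}\to X^{\mathrm{hyb}}$, with $|h(\beta_t(z))|=|h(z)|^{\log r/\log|t|}$, and $\beta_0:X_K^{\mathrm{an}}\to X^{\mathrm{hyb}}$, with $|h(\beta_0(x))|=|h(x)|$, associate to a hybrid metric $\phi$ on $L$ the metrics $\phi_t=\frac{\log|t|}{\log r}\,\beta_t^*\phi$ on $L_t$ and $\phi_0=\beta_0^*\phi$ on $L_K$. (1) Let $\chi:\mathbb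 R^N\to\mathbb R$ be convex, with $\chi(x+c\mathbf 1)=\chi(x)+c$ for all $x\in\mathbb R^N$, $c\in\mathbb R$, and $\chi-\max(x_1,\dots,x_N)$ bounded; such a $\chi$ is non-decreasing in each variable and is extended to $[-\infty,\infty)^N$ by decreasing limits. Let $s_1,\dots,s_N$ be sections of $mL$ without common zeroes and $\phi_i=m^{-1}\log|s_i|$. Then $\chi(\phi_{1,t},\dots,\phi_{N,t})$ is a continuous psh metric on $L_t$ for every $0<|t|\le r$; $m^{-1}\max_i\log|s_i|$ is a tropical Fubini–Study metric on $L_K$; and there is a unique hybrid metric $\phi_\chi$ on $L$ with $$\phi_{\chi,t}=\chi(\phi_{1,t},\dots,\phi_{N,t})\quad(0<|t|\le r),\qquad \phi_{\chi,0}=m^{-1}\max_i\log|s_i|.$$ It is continuous and psh. (2) Assume that $X$ is integral (equivalently, connected). Let $(s_\alpha)_{\alpha\in B}$ be a finite family of sections of $mL$, not all zero, possibly with common zeroes. Then there is a unique hybrid metric $\phi$ on $L$ with $$\phi_t=\frac1{2m}\log\sum_{\alpha\in B}|s_{\alpha,t}|^2\quad(0<|t|\le r),\qquad \phi_0=m^{-1}\max_{\alpha\in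 B}\log|s_\alpha|,$$ and it is psh. -/

import Mathlib

open AlgebraicGeometry CategoryTheory Filter Topology

noncomputable section

namespace Hybrid

/-- The hybrid norm on `ℂ`: `max 1 |z|` for `z ≠ 0`, and `0` for `z = 0`. -/
def hybNorm (z : ℂ) : ℝ := if z = 0 then 0 else max 1 ‖z‖

lemma hybNorm_nonneg (z : ℂ) : 0 ≤ hybNorm z := by
  unfold hybNorm; split_ifs <;> positivity

@[simp] lemma hybNorm_zero : hybNorm 0 = 0 := by simp [hybNorm]

lemma norm_le_hybNorm (z : ℂ) : ‖z‖ ≤ hybNorm z := by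
  unfold hybNorm; split_ifs with h
  · simp [h]
  · exact le_max_right _ _

lemma one_le_hybNorm {z : ℂ} (h : z ≠ 0) : 1 ≤ hybNorm z := by
  simp [hybNorm, h]

lemma hybNorm_neg (z : ℂ) : hybNorm (-z) = hybNorm z := by simp [hybNorm]

lemma hybNorm_add (z w : ℂ) : hybNorm (z + w) ≤ hybNorm z + hybNorm w := by
  by_cases hz : z = 0
  · simp [hz]
  by_cases hw : w = 0
  · simp [hw]
  by_cases h : z + w = 0
  · rw [h, hybNorm_zero]; exact add_nonneg (hybNorm_nonneg _) (hybNorm_nonneg _)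
  have h1 := one_le_hybNorm hz
  have h2 := one_le_hybNorm hw
  have h3 := norm_le_hybNorm z
  have h4 := norm_le_hybNorm w
  have h5 := norm_add_le z w
  rw [hybNorm, if_neg h]
  exact max_le (by linarith) (by linarith)

lemma hybNorm_mul (z w : ℂ) : hybNorm (z * w) ≤ hybNorm z * hybNorm w := by
  by_cases hz : z = 0
  · simp [hz]
  by_cases hw : w = 0
  · simp [hw]
  have h1 := one_le_hybNorm hz
  have h2 := one_le_hybNorm hw
  rw [hybNorm, if_neg (mul_ne_zero hz hw), norm_mul]
  refine max_le (by nlinarith) ?_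
  exact mul_le_mul (norm_le_hybNorm z) (norm_le_hybNorm w) (norm_nonneg _) (by linarith)

lemma hybNorm_sum {ι : Type*} (s : Finset ι) (f : ι → ℂ) :
    hybNorm (∑ i ∈ s, f i) ≤ ∑ i ∈ s, hybNorm (f i) :=
  Finset.le_sum_of_subadditive hybNorm hybNorm_zero.le hybNorm_add s f

/-- The admissible radii `r ∈ (0,1)`. -/
structure Radius where
  /-- the underlying real number -/
  val : ℝ
  pos : 0 < val
  lt_one : val < 1

instance : Coe Radius ℝ := ⟨Radius.val⟩

/-- The `n`-th term `‖aₙ‖_hyb rⁿ` of the hybrid norm of a Laurent series `∑ aₙ tⁿ`. -/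
def hybTerm (r : Radius) (f : LaurentSeries ℂ) (n : ℤ) : ℝ :=
  hybNorm (f.coeff n) * (r : ℝ) ^ n

lemma hybTerm_nonneg (r : Radius) (f : LaurentSeries ℂ) (n : ℤ) : 0 ≤ hybTerm r f n :=
  mul_nonneg (hybNorm_nonneg _) (zpow_nonneg r.pos.le _)

/-- The shear `(n, i) ↦ (i, n - i)` of `ℤ × ℤ`, indexing the Cauchy product. -/
def shear : ℤ × ℤ ≃ ℤ × ℤ where
  toFun p := (p.2, p.1 - p.2)
  invFun q := (q.1 + q.2, q.1)
  left_inv p := by simp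
  right_inv q := by simp

lemma coeff_mul_eq_sum (f g : LaurentSeries ℂ) (n : ℤ) :
    ∃ s : Finset ℤ, (f * g).coeff n = ∑ i ∈ s, f.coeff i * g.coeff (n - i) ∧
      ∀ i ∉ s, f.coeff i * g.coeff (n - i) = 0 := by
  classical
  refine ⟨(Finset.antidiagonal f.isPWO_support g.isPWO_support n).image Prod.fst, ?_, ?_⟩
  · rw [HahnSeries.coeff_mul, Finset.sum_image]
    · refine Finset.sum_congr rfl fun ij hij => ?_
      rw [Finset.mem_antidiagonal] at hij
      rw [← hij.2.2, add_sub_cancel_left]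
    · rintro ⟨a, b⟩ ha ⟨c, d⟩ hc (h : a = c)
      simp only [Finset.mem_coe, Finset.mem_antidiagonal] at ha hc
      ext
      · exact h
      · have h1 : a + b = n := ha.2.2
        have h2 : c + d = n := hc.2.2
        change b = d
        omega
  · intro i hi
    by_contra hne
    apply hi
    rw [Finset.mem_image]
    refine ⟨(i, n - i), ?_, rfl⟩
    rw [Finset.mem_antidiagonal]
    exact ⟨left_ne_zero_of_mul hne, right_ne_zero_of_mul hne, by simp⟩

section product
variable {r : Radius} {f g : LaurentSeries ℂ}

lemma summable_shear (hf : Summable (hybTerm r f)) (hg : Summable (hybTerm r g)) :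
    Summable fun p : ℤ × ℤ => hybTerm r f p.2 * hybTerm r g (p.1 - p.2) := by
  have h := hf.mul_of_nonneg hg (hybTerm_nonneg r f) (hybTerm_nonneg r g)
  exact (shear.summable_iff (f := fun q : ℤ × ℤ => hybTerm r f q.1 * hybTerm r g q.2)).2 h

lemma hybTerm_mul_le (hf : Summable (hybTerm r f)) (hg : Summable (hybTerm r g)) (n : ℤ) :
    hybTerm r (f * g) n ≤ ∑' i : ℤ, hybTerm r f i * hybTerm r g (n - i) := by
  obtain ⟨s, hs, -⟩ := coeff_mul_eq_sum f g n
  have hS : Summable fun i : ℤ => hybTerm r f i * hybTerm r g (n - i) :=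
    (summable_shear hf hg).prod_factor n
  refine le_trans ?_ (hS.sum_le_tsum s fun i _ =>
    mul_nonneg (hybTerm_nonneg _ _ _) (hybTerm_nonneg _ _ _))
  rw [hybTerm, hs]
  refine le_trans (mul_le_mul_of_nonneg_right (hybNorm_sum s _) (zpow_nonneg r.pos.le _)) ?_
  rw [Finset.sum_mul]
  refine Finset.sum_le_sum fun i _ => ?_
  have : (r : ℝ) ^ n = (r : ℝ) ^ i * (r : ℝ) ^ (n - i) := by
    rw [← zpow_add₀ r.pos.ne']; simp
  rw [this]
  calc _ ≤ (hybNorm (f.coeff i) * hybNorm (g.coeff (n - i))) * ((r : ℝ) ^ i * (r : ℝ) ^ (n - i)) :=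
        mul_le_mul_of_nonneg_right (hybNorm_mul _ _)
          (mul_nonneg (zpow_nonneg r.pos.le _) (zpow_nonneg r.pos.le _))
    _ = _ := by simp only [hybTerm]; ring

lemma summable_hybTerm_mul (hf : Summable (hybTerm r f)) (hg : Summable (hybTerm r g)) :
    Summable (hybTerm r (f * g)) :=
  Summable.of_nonneg_of_le (hybTerm_nonneg r _) (hybTerm_mul_le hf hg) (summable_shear hf hg).prod

lemma tsum_hybTerm_mul_le (hf : Summable (hybTerm r f)) (hg : Summable (hybTerm r g)) :
    ∑' n, hybTerm r (f * g) n ≤ (∑' n, hybTerm r f n) * ∑' n, hybTerm r g n := by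
  have h := hf.mul_of_nonneg hg (hybTerm_nonneg r f) (hybTerm_nonneg r g)
  have hS := summable_shear hf hg
  calc _ ≤ ∑' n : ℤ, ∑' i : ℤ, hybTerm r f i * hybTerm r g (n - i) :=
        (summable_hybTerm_mul hf hg).tsum_le_tsum (hybTerm_mul_le hf hg) hS.prod
    _ = ∑' p : ℤ × ℤ, hybTerm r f p.2 * hybTerm r g (p.1 - p.2) := hS.tsum_prod.symm
    _ = ∑' q : ℤ × ℤ, hybTerm r f q.1 * hybTerm r g q.2 :=
        shear.tsum_eq (fun q : ℤ × ℤ => hybTerm r f q.1 * hybTerm r g q.2)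
    _ = _ := (hf.tsum_mul_tsum hg h).symm

lemma hybTerm_add_le (n : ℤ) : hybTerm r (f + g) n ≤ hybTerm r f n + hybTerm r g n := by
  simp only [hybTerm, HahnSeries.coeff_add, ← add_mul]
  exact mul_le_mul_of_nonneg_right (hybNorm_add _ _) (zpow_nonneg r.pos.le _)

lemma summable_hybTerm_add (hf : Summable (hybTerm r f)) (hg : Summable (hybTerm r g)) :
    Summable (hybTerm r (f + g)) :=
  Summable.of_nonneg_of_le (hybTerm_nonneg r _) (fun n => hybTerm_add_le n) (hf.add hg)

lemma hybTerm_neg (n : ℤ) : hybTerm r (-f) n = hybTerm r f n := by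
  simp [hybTerm, hybNorm_neg]

end product

lemma summable_hybTerm_zero (r : Radius) : Summable (hybTerm r 0) := by
  have : hybTerm r 0 = fun _ => 0 := by ext n; simp [hybTerm]
  rw [this]; exact summable_zero

lemma summable_hybTerm_one (r : Radius) : Summable (hybTerm r 1) := by
  refine summable_of_ne_finset_zero (s := {0}) fun n hn => ?_
  simp only [Finset.mem_singleton] at hn
  simp [hybTerm, HahnSeries.coeff_one, hn]

/-- The hybrid ring `A_r`: Laurent series `∑ aₙ tⁿ` over `ℂ` with `∑ ‖aₙ‖_hyb rⁿ < ∞`. -/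
def hybridRing (r : Radius) : Subring (LaurentSeries ℂ) where
  carrier := {f | Summable (hybTerm r f)}
  mul_mem' hf hg := summable_hybTerm_mul hf hg
  one_mem' := summable_hybTerm_one r
  add_mem' hf hg := summable_hybTerm_add hf hg
  zero_mem' := summable_hybTerm_zero r
  neg_mem' {f} hf := by
    have : hybTerm r (-f) = hybTerm r f := funext fun n => hybTerm_neg n
    simpa [this] using hf

/-- The norm `‖∑ aₙ tⁿ‖_hyb = ∑ ‖aₙ‖_hyb rⁿ` of the hybrid ring. -/
def hybridRingNorm (r : Radius) : RingNorm (hybridRing r) where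
  toFun f := ∑' n, hybTerm r f n
  map_zero' := by simp [hybTerm]
  add_le' f g := by
    rw [← f.2.tsum_add g.2]
    exact (f + g).2.tsum_le_tsum (fun n => hybTerm_add_le n) (f.2.add g.2)
  neg' f := tsum_congr fun n => hybTerm_neg n
  mul_le' f g := tsum_hybTerm_mul_le f.2 g.2
  eq_zero_of_map_eq_zero' f h := by
    have h0 := (f.2.hasSum_iff.2 h)
    have h1 := (hasSum_zero_iff_of_nonneg (hybTerm_nonneg r f)).1 h0
    ext n
    by_contra hn
    have h2 := congrFun h1 n
    have h3 := one_le_hybNorm hn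
    simp only [hybTerm, Pi.zero_apply, mul_eq_zero] at h2
    rcases h2 with h2 | h2
    · linarith
    · exact (zpow_pos r.pos n).ne' h2

open Classical in
/-- The `t`-adic norm on `ℂ((t))`, normalized by `|t| = r`. -/
def tadicNorm (r : Radius) : RingNorm (LaurentSeries ℂ) where
  toFun f := if f = 0 then 0 else (r : ℝ) ^ f.order
  map_zero' := by simp
  add_le' f g := by
    have hr := r.pos
    by_cases hf : f = 0
    · simp [hf]
    by_cases hg : g = 0
    · simp [hg]
    by_cases hfg : f + g = 0
    · simp only [hfg, hf, hg, if_true, if_false]; positivity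
    simp only [hf, hg, hfg, if_false]
    have h := HahnSeries.min_order_le_order_add hfg
    rcases min_le_iff.1 h with h | h
    · have := zpow_le_zpow_right_of_le_one₀ hr r.lt_one.le h
      have h' : (0 : ℝ) ≤ (r : ℝ) ^ g.order := by positivity
      linarith
    · have := zpow_le_zpow_right_of_le_one₀ hr r.lt_one.le h
      have h' : (0 : ℝ) ≤ (r : ℝ) ^ f.order := by positivity
      linarith
  neg' f := by simp [HahnSeries.order_neg]
  mul_le' f g := by
    by_cases hf : f = 0
    · simp [hf]
    by_cases hg : g = 0
    · simp [hg]
    simp only [hf, hg, mul_eq_zero, or_self, if_false]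
    rw [HahnSeries.order_mul hf hg, zpow_add₀ r.pos.ne']
  eq_zero_of_map_eq_zero' f h := by
    by_contra hf
    simp only [hf, if_false] at h
    exact (zpow_pos r.pos _).ne' h

open Classical in
lemma tadicNorm_le (r : Radius) (f : hybridRing r) :
    tadicNorm r f ≤ hybridRingNorm r f := by
  change (if (f : LaurentSeries ℂ) = 0 then (0 : ℝ) else _) ≤ ∑' n, hybTerm r f n
  split_ifs with h
  · exact tsum_nonneg (hybTerm_nonneg r f)
  · refine le_trans ?_ (f.2.le_tsum (f : LaurentSeries ℂ).order fun n _ => hybTerm_nonneg r f n)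
    have := one_le_hybNorm (HahnSeries.coeff_order_eq_zero.not.2 h)
    exact le_mul_of_one_le_left (zpow_nonneg r.pos.le _) this

/-- The punctured closed disk `0 < |t| ≤ r`. -/
def PuncturedDisk (r : Radius) : Type := {t : ℂ // t ≠ 0 ∧ ‖t‖ ≤ r}

namespace PuncturedDisk
variable {r : Radius} (t : PuncturedDisk r)

/-- `log_r |t| = log |t| / log r`. -/
def logr : ℝ := Real.log ‖t.1‖ / Real.log r

/-- The exponent `log r / log |t|` by which the absolute value of the fibre over `t` is rescaled. -/
def exponent : ℝ := Real.log r / Real.log ‖t.1‖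

lemma norm_pos : 0 < ‖t.1‖ := norm_pos_iff.2 t.2.1

lemma log_radius_neg (r : Radius) : Real.log r < 0 := Real.log_neg r.pos r.lt_one

lemma log_norm_le : Real.log ‖t.1‖ ≤ Real.log r := Real.log_le_log t.norm_pos t.2.2

lemma exponent_pos : 0 < t.exponent :=
  div_pos_of_neg_of_neg (log_radius_neg r) (t.log_norm_le.trans_lt (log_radius_neg r))

lemma exponent_le_one : t.exponent ≤ 1 := by
  have h := t.log_norm_le.trans_lt (log_radius_neg r)
  rw [exponent, div_le_one_of_neg h]
  exact t.log_norm_le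

lemma norm_rpow_exponent : ‖t.1‖ ^ t.exponent = r := by
  rw [Real.rpow_def_of_pos t.norm_pos, exponent,
    mul_div_cancel₀ _ (t.log_norm_le.trans_lt (log_radius_neg r)).ne, Real.exp_log r.pos]

end PuncturedDisk

lemma sum_rpow_le {ι : Type*} {p : ℝ} (hp : 0 < p) (hp1 : p ≤ 1) (x : ι → ℝ) (hx : ∀ i, 0 ≤ x i)
    (s : Finset ι) : (∑ i ∈ s, x i) ^ p ≤ ∑ i ∈ s, x i ^ p := by
  classical
  induction s using Finset.induction_on with
  | empty => simp [Real.zero_rpow hp.ne']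
  | insert a s ha ih =>
    rw [Finset.sum_insert ha, Finset.sum_insert ha]
    exact (Real.rpow_add_le_add_rpow (hx a) (Finset.sum_nonneg fun i _ => hx i) hp.le hp1).trans
      (by linarith)

lemma summable_of_rpow {ι : Type*} {p : ℝ} (hp : 0 < p) (hp1 : p ≤ 1) (x : ι → ℝ)
    (hx : ∀ i, 0 ≤ x i) (h : Summable fun i => x i ^ p) :
    Summable x ∧ (∑' i, x i) ^ p ≤ ∑' i, x i ^ p := by
  have hS : 0 ≤ ∑' i, x i ^ p := tsum_nonneg fun i => Real.rpow_nonneg (hx i) p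
  have key : ∀ s : Finset ι, ∑ i ∈ s, x i ≤ (∑' i, x i ^ p) ^ p⁻¹ := fun s => by
    rw [Real.le_rpow_inv_iff_of_pos (Finset.sum_nonneg fun i _ => hx i) hS hp]
    exact (sum_rpow_le hp hp1 x hx s).trans
      (h.sum_le_tsum s fun i _ => Real.rpow_nonneg (hx i) p)
  have hs : Summable x := summable_of_sum_le hx key
  refine ⟨hs, ?_⟩
  rw [← Real.le_rpow_inv_iff_of_pos (tsum_nonneg hx) hS hp]
  exact hs.tsum_le_of_sum_le key

section eval
variable {r : Radius} (t : PuncturedDisk r)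

lemma rpow_term_le (f : LaurentSeries ℂ) (n : ℤ) :
    ‖f.coeff n * t.1 ^ n‖ ^ t.exponent ≤ hybTerm r f n := by
  rw [norm_mul, norm_zpow, Real.mul_rpow (norm_nonneg _) (zpow_nonneg (norm_nonneg _) _)]
  have h1 : (‖t.1‖ ^ n) ^ t.exponent = (r : ℝ) ^ n := by
    rw [← Real.rpow_intCast, ← Real.rpow_mul t.norm_pos.le, mul_comm,
      Real.rpow_mul t.norm_pos.le, t.norm_rpow_exponent, Real.rpow_intCast]
  rw [h1]
  refine mul_le_mul_of_nonneg_right ?_ (zpow_nonneg r.pos.le _)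
  by_cases h0 : f.coeff n = 0
  · simp [h0, Real.zero_rpow t.exponent_pos.ne']
  rcases le_total ‖f.coeff n‖ 1 with h | h
  · exact (Real.rpow_le_one (norm_nonneg _) h t.exponent_pos.le).trans (one_le_hybNorm h0)
  · exact ((Real.rpow_le_rpow_of_exponent_le h t.exponent_le_one).trans_eq
      (Real.rpow_one _)).trans (norm_le_hybNorm _)

lemma eval_aux (f : hybridRing r) :
    (Summable fun n : ℤ => ‖(f : LaurentSeries ℂ).coeff n * t.1 ^ n‖) ∧
      (∑' n : ℤ, ‖(f : LaurentSeries ℂ).coeff n * t.1 ^ n‖) ^ t.exponent ≤ hybridRingNorm r f := by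
  have h : Summable fun n : ℤ => ‖(f : LaurentSeries ℂ).coeff n * t.1 ^ n‖ ^ t.exponent :=
    Summable.of_nonneg_of_le (fun n => Real.rpow_nonneg (norm_nonneg _) _)
      (rpow_term_le t f) f.2
  have h2 := summable_of_rpow t.exponent_pos t.exponent_le_one _ (fun n => norm_nonneg _) h
  exact ⟨h2.1, h2.2.trans (h.tsum_le_tsum (rpow_term_le t f) f.2)⟩

/-- Evaluation `f ↦ f(t)` of elements of the hybrid ring at a point of the punctured disk. -/
def evalHom : hybridRing r →+* ℂ where
  toFun f := ∑' n : ℤ, (f : LaurentSeries ℂ).coeff n * t.1 ^ n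
  map_one' := by
    rw [tsum_eq_single 0]
    · simp
    · intro n hn; simp [HahnSeries.coeff_one, hn]
  map_zero' := by simp
  map_add' f g := by
    rw [← (eval_aux t f).1.of_norm.tsum_add (eval_aux t g).1.of_norm]
    exact tsum_congr fun n => by simp [add_mul]
  map_mul' f g := by
    have hf := (eval_aux t f).1
    have hg := (eval_aux t g).1
    rw [tsum_mul_tsum_of_summable_norm hf hg, ← shear.tsum_eq]
    have hS := (shear.summable_iff.2 (summable_mul_of_summable_norm hf hg))
    rw [Summable.tsum_prod (by exact hS)]
    refine tsum_congr fun n => ?_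
    obtain ⟨s, hs, hs0⟩ := coeff_mul_eq_sum (f : LaurentSeries ℂ) g n
    have e : ∀ i : ℤ, (f : LaurentSeries ℂ).coeff i * t.1 ^ i *
        ((g : LaurentSeries ℂ).coeff (n - i) * t.1 ^ (n - i)) =
        (f : LaurentSeries ℂ).coeff i * (g : LaurentSeries ℂ).coeff (n - i) * t.1 ^ n := fun i => by
      have : t.1 ^ n = t.1 ^ i * t.1 ^ (n - i) := by rw [← zpow_add₀ t.2.1]; simp
      rw [this]; ring
    simp only [shear, Equiv.coe_fn_mk, e, Subring.coe_mul]
    rw [tsum_eq_sum (s := s) (fun i hi => by rw [hs0 i hi, zero_mul]), hs, Finset.sum_mul]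

lemma norm_evalHom_rpow_le (f : hybridRing r) :
    ‖evalHom t f‖ ^ t.exponent ≤ hybridRingNorm r f :=
  (Real.rpow_le_rpow (norm_nonneg _) (norm_tsum_le_tsum_norm (eval_aux t f).1)
    t.exponent_pos.le).trans (eval_aux t f).2

end eval

/-! ### Berkovich analytification over a normed ring -/

section Berkovich

variable {A : Type} [CommRing A]

/-- The Berkovich spectrum of `(A, ν)`: multiplicative seminorms on `A` bounded by the norm `ν`. -/
structure BerkovichSpectrum (ν : RingNorm A) where
  /-- the multiplicative seminorm -/
  seminorm : MulRingSeminorm A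
  le_norm : ∀ a, seminorm a ≤ ν a

/-- A point of the Berkovich spectrum is Zariski-dense if its kernel is zero. -/
def BerkovichSpectrum.IsZariskiDense {ν : RingNorm A} (x : BerkovichSpectrum ν) : Prop :=
  ∀ a, x.seminorm a = 0 → a = 0

variable {X : Scheme.{0}}

/-- The value in the residue field `κ(x)` of a scalar `a : A`, for an `A`-scheme `X`. -/
def scalarAt (f : X ⟶ Spec (.of A)) (x : X) : A →+* X.residueField x :=
  ((Scheme.ΓSpecIso (.of A)).inv ≫ f.appTop ≫ X.Γevaluation x).hom

/-- The analytification `X^an` of an `A`-scheme `f : X ⟶ Spec A`, for the norm `ν` on `A`: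
a point is a scheme point `x` together with an absolute value on `κ(x)` whose restriction to `A`
is bounded by `ν`. On an affine open `Spec B` of `X` these are the multiplicative seminorms on `B`
whose restriction to `A` belongs to the Berkovich spectrum of `A`. -/
structure Analytification (f : X ⟶ Spec (.of A)) (ν : RingNorm A) where
  /-- the underlying scheme point -/
  pt : X
  /-- the absolute value on the residue field -/
  abv : AbsoluteValue (X.residueField pt) ℝ
  abv_le : ∀ a, abv (scalarAt f pt a) ≤ ν a

variable {f : X ⟶ Spec (.of A)} {ν : RingNorm A}

namespace Analytification

/-- `|s(x)|` for a regular function `s` on an open `U` and a point `x` of `U^an`. -/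
def absAt (x : Analytification f ν) (U : X.Opens) (hx : x.pt ∈ U) (s : Γ(X, U)) : ℝ :=
  x.abv (X.evaluation U x.pt hx s)

/-- The coarsest topology such that all `U^an` are open (for `U` Zariski open) and all functions
`x ↦ |s(x)|` on `U^an` are continuous. -/
instance : TopologicalSpace (Analytification f ν) :=
  TopologicalSpace.generateFrom
    {W | ∃ (U : X.Opens) (s : Γ(X, U)) (V : Set ℝ), IsOpen V ∧
      W = {x | ∃ hx : x.pt ∈ U, x.absAt U hx s ∈ V}}

/-- The structure map `X^an → M(A)`. -/
def toSpectrum (x : Analytification f ν) : BerkovichSpectrum ν where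
  seminorm :=
    { toFun a := x.abv (scalarAt f x.pt a)
      map_zero' := by simp
      map_one' := by simp
      map_mul' a b := by simp
      add_le' a b := by simpa using x.abv.add_le _ _
      neg' a := by simp }
  le_norm := x.abv_le

end Analytification

end Berkovich

/-! ### Line bundles and their sections -/

section LineBundle

/-- Restriction of regular functions. -/
def res {X : Scheme.{0}} {V W : X.Opens} (h : W ≤ V) (s : Γ(X, V)) : Γ(X, W) :=
  X.presheaf.map (homOfLE h).op s

/-- A line bundle on `X`, presented by a trivializing open cover `U i` with local frames `e i` and
transition functions `g i j` on `U i ∩ U j` such that `e j = g i j • e i`. -/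
structure LineBundle (X : Scheme.{0}) where
  /-- index set of the cover -/
  ι : Type
  /-- the cover -/
  U : ι → X.Opens
  cover : ∀ x : X, ∃ i, x ∈ U i
  /-- the transition functions -/
  g : ∀ i j, Γ(X, U i ⊓ U j)
  g_self : ∀ i, g i i = 1
  cocycle : ∀ i j k,
    (res (W := U i ⊓ U j ⊓ U k) inf_le_left (g i j) *
      res (le_inf (inf_le_left.trans inf_le_right) inf_le_right) (g j k) :
        Γ(X, U i ⊓ U j ⊓ U k)) =
      res (le_inf (inf_le_left.trans inf_le_left) inf_le_right) (g i k)

variable {X Y : Scheme.{0}}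

/-- A global section of the `m`-th power `mL`: a family of regular functions `c i` on `U i`
such that `c i • (e i)^m = c j • (e j)^m` on overlaps. -/
@[ext]
structure LineBundle.Section (L : LineBundle X) (m : ℕ) where
  /-- the coefficient in the frame `(e i)^m` -/
  coeff : ∀ i, Γ(X, L.U i)
  compat : ∀ i j, (res (W := L.U i ⊓ L.U j) inf_le_left (coeff i) : Γ(X, L.U i ⊓ L.U j)) =
    L.g i j ^ m * res inf_le_right (coeff j)

namespace LineBundle

instance (L : LineBundle X) (m : ℕ) : Zero (L.Section m) where
  zero := ⟨fun _ => 0, fun i j => by simp [res]⟩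

/-- The section vanishes at the scheme point `x`. -/
def Section.VanishesAt {L : LineBundle X} {m : ℕ} (s : L.Section m) (x : X) : Prop :=
  ∀ (i : L.ι) (hx : x ∈ L.U i), X.evaluation (L.U i) x hx (s.coeff i) = 0

/-- The sections `s k` have no common zeroes. -/
def NoCommonZeros {L : LineBundle X} {m : ℕ} {κ : Type} (s : κ → L.Section m) : Prop :=
  ∀ x : X, ∃ k, ¬ (s k).VanishesAt x

/-- `L` is semi-ample: some positive power of `L` is globally generated. -/
def IsSemiAmple (L : LineBundle X) : Prop :=
  ∃ m : ℕ, 1 ≤ m ∧ ∀ x : X, ∃ s : L.Section m, ¬ s.VanishesAt x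

lemma app_res (p : Y ⟶ X) {V W : X.Opens} (h : W ≤ V) (s : Γ(X, V)) :
    p.app W (res h s) = res (p.preimage_mono h) (p.app V s) :=
  ConcreteCategory.congr_hom (p.naturality (homOfLE h).op) s

/-- Pull-back of a line bundle. -/
def pullback (L : LineBundle X) (p : Y ⟶ X) : LineBundle Y where
  ι := L.ι
  U i := p ⁻¹ᵁ L.U i
  cover y := L.cover (p y)
  g i j := p.app (L.U i ⊓ L.U j) (L.g i j)
  g_self i := by rw [L.g_self, map_one]; rfl
  cocycle i j k := by
    have h := congrArg (p.app (L.U i ⊓ L.U j ⊓ L.U k)) (L.cocycle i j k)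
    rw [map_mul, app_res, app_res, app_res] at h
    exact h

/-- Pull-back of a section. -/
def Section.pullback {L : LineBundle X} {m : ℕ} (s : L.Section m) (p : Y ⟶ X) :
    (L.pullback p).Section m where
  coeff i := p.app (L.U i) (s.coeff i)
  compat i j := by
    have h := congrArg (p.app (L.U i ⊓ L.U j)) (s.compat i j)
    rw [map_mul, app_res, app_res, map_pow] at h
    exact h

end LineBundle

end LineBundle

/-! ### Metrics, in additive notation -/

section Metrics

/-- The logarithm of a non-negative real number, with `log 0 = -∞`. -/
def elog (a : ℝ) : EReal := ENNReal.log (ENNReal.ofReal a)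

variable {A : Type} [CommRing A] {X : Scheme.{0}}

/-- The data underlying a metric `φ` on `L^an`: for each local frame `e i` of `L`, the
function `φ i = - log ‖e i‖` on `(U i)^an`. -/
def Potential (f : X ⟶ Spec (.of A)) (ν : RingNorm A) (L : LineBundle X) : Type :=
  ∀ i : L.ι, {x : Analytification f ν // x.pt ∈ L.U i} → EReal

variable {f : X ⟶ Spec (.of A)} {ν : RingNorm A} {L : LineBundle X}

/-- `log |s|` in the frame `(e i)^m`, for a section `s` of `mL`. -/
def LineBundle.Section.logAbs {m : ℕ} (s : L.Section m) (i : L.ι)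
    (x : {x : Analytification f ν // x.pt ∈ L.U i}) : EReal :=
  elog (x.1.absAt (L.U i) x.2 (s.coeff i))

namespace Potential

/-- `‖e j‖ = |g i j| ‖e i‖` on overlaps, i.e. `φ i = φ j + log |g i j|`. -/
def IsCompatible (φ : Potential f ν L) : Prop :=
  ∀ (i j : L.ι) (x : Analytification f ν) (hi : x.pt ∈ L.U i) (hj : x.pt ∈ L.U j),
    φ i ⟨x, hi⟩ = φ j ⟨x, hj⟩ + elog (x.absAt (L.U i ⊓ L.U j) ⟨hi, hj⟩ (L.g i j))

/-- Continuous metrics: the local functions `- log ‖e i‖` are finite and continuous. -/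
structure IsContinuousMetric (φ : Potential f ν L) : Prop where
  compat : φ.IsCompatible
  ne_top : ∀ i x, φ i x ≠ ⊤
  ne_bot : ∀ i x, φ i x ≠ ⊥
  continuous : ∀ i, Continuous (φ i)

/-- Singular metrics: the local functions `- log ‖e i‖` are upper semicontinuous with values in
`[-∞, +∞)`, and not identically `-∞` on `V^an` for any non-empty Zariski open `V`. -/
structure IsSingularMetric (φ : Potential f ν L) : Prop where
  compat : φ.IsCompatible
  ne_top : ∀ i x, φ i x ≠ ⊤
  usc : ∀ i, UpperSemicontinuous (φ i)
  not_bot : ∀ (i : L.ι) (V : X.Opens), V ≤ L.U i → (V : Set X).Nonempty →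
    ∃ x, x.1.pt ∈ V ∧ φ i x ≠ ⊥

/-- Tropical Fubini-Study metrics `m⁻¹ max_j (log |s j| + a j)`, for a finite family of
sections of `mL` without common zeroes and real constants `a j`. -/
def IsTropicalFS (φ : Potential f ν L) : Prop :=
  ∃ (m n : ℕ) (s : Fin n → L.Section m) (a : Fin n → ℝ),
    1 ≤ m ∧ LineBundle.NoCommonZeros s ∧
      ∀ i x, φ i x = (((m : ℝ)⁻¹ : ℝ) : EReal) * ⨆ j, ((s j).logAbs i x + (a j : EReal))

/-- Plurisubharmonic (semi-positive) metrics: singular metrics that are pointwise limits of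
decreasing nets of tropical Fubini-Study metrics and that are not identically `-∞` on the
fibre over any Zariski-dense point of the Berkovich spectrum of the base. -/
structure IsPSH (φ : Potential f ν L) : Prop where
  singular : φ.IsSingularMetric
  exists_net : ∃ (J : Type) (_ : Preorder J) (_ : Nonempty J) (_ : IsDirectedOrder J)
    (ψ : J → Potential f ν L), (∀ j, (ψ j).IsTropicalFS) ∧
      (∀ j k, j ≤ k → ∀ i x, ψ k i x ≤ ψ j i x) ∧
      ∀ i x, Tendsto (fun j => ψ j i x) atTop (𝓝 (φ i x))
  not_bot : ∀ b : BerkovichSpectrum ν, b.IsZariskiDense →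
    ∃ i x, x.1.toSpectrum = b ∧ φ i x ≠ ⊥

/-- Continuous plurisubharmonic metrics. -/
def IsCPSH (φ : Potential f ν L) : Prop := φ.IsContinuousMetric ∧ φ.IsPSH

end Potential

/-- The extension of `χ : ℝ^N → ℝ` to `[-∞, +∞)^N`. It is used for convex functions `χ` at bounded
distance from the maximum of the coordinates; these are non-decreasing in each coordinate, so that
the infimum below agrees with `χ` on `ℝ^N` and is the limit of `χ` along real points decreasing
to `x`. -/
def extendBot {N : ℕ} (χ : (Fin N → ℝ) → ℝ) (x : Fin N → EReal) : EReal :=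
  ⨅ y : {y : Fin N → ℝ // ∀ k, x k ≤ (y k : EReal)}, (χ y.1 : EReal)

lemma extendBot_coe {N : ℕ} {χ : (Fin N → ℝ) → ℝ} (h : Monotone χ) (x : Fin N → ℝ) :
    extendBot χ (fun k => (x k : EReal)) = χ x :=
  le_antisymm (iInf_le_of_le ⟨x, fun _ => le_rfl⟩ le_rfl)
    (le_iInf fun y => EReal.coe_le_coe_iff.2 (h fun k => EReal.coe_le_coe_iff.1 (y.2 k)))

/-- The metric `χ(φ₁, …, φ_N)` with `φ_k = m⁻¹ log |s k|`. -/
def chiPotential {N m : ℕ} (χ : (Fin N → ℝ) → ℝ) (s : Fin N → L.Section m) :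
    Potential f ν L :=
  fun i x => extendBot χ fun k => (((m : ℝ)⁻¹ : ℝ) : EReal) * (s k).logAbs i x

/-- The metric `m⁻¹ max_k log |s k|`. -/
def maxPotential {κ : Type} {m : ℕ} (s : κ → L.Section m) : Potential f ν L :=
  fun i x => (((m : ℝ)⁻¹ : ℝ) : EReal) * ⨆ k, (s k).logAbs i x

/-- The `L²`-Bergman metric `(2m)⁻¹ log ∑ |s k|²`. -/
def bergmanPotential {κ : Type} [Fintype κ] {m : ℕ} (s : κ → L.Section m) : Potential f ν L :=
  fun i x => (((2 * m : ℝ)⁻¹ : ℝ) : EReal) *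
    elog (∑ k, x.1.absAt (L.U i) x.2 ((s k).coeff i) ^ 2)

end Metrics

/-! ### Base change and rescaling of absolute values -/

section BaseChange

/-- The power `|·|^c` of an absolute value, for `0 < c ≤ 1`. -/
def rpowAbv {F : Type} [Field F] (v : AbsoluteValue F ℝ) (c : ℝ) (h0 : 0 < c) (h1 : c ≤ 1) :
    AbsoluteValue F ℝ where
  toFun a := v a ^ c
  map_mul' a b := by rw [map_mul, Real.mul_rpow (v.nonneg a) (v.nonneg b)]
  nonneg' a := Real.rpow_nonneg (v.nonneg a) c
  eq_zero' a := by rw [Real.rpow_eq_zero (v.nonneg a) h0.ne', map_eq_zero]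
  add_le' a b := (Real.rpow_le_rpow (v.nonneg _) (v.add_le a b) h0.le).trans
    (Real.rpow_add_le_add_rpow (v.nonneg a) (v.nonneg b) h0.le h1)

variable {A B : Type} [CommRing A] [CommRing B] {X : Scheme.{0}}

/-- The base change `X_B = X ×_A B` along a ring homomorphism `ψ : A → B`. -/
abbrev baseChange (f : X ⟶ Spec (.of A)) (ψ : A →+* B) : Scheme.{0} :=
  Limits.pullback f (Spec.map (CommRingCat.ofHom ψ))

/-- The projection `X_B ⟶ X`. -/
abbrev baseChangeProj (f : X ⟶ Spec (.of A)) (ψ : A →+* B) : baseChange f ψ ⟶ X :=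
  Limits.pullback.fst f (Spec.map (CommRingCat.ofHom ψ))

/-- The structure map `X_B ⟶ Spec B`. -/
abbrev baseChangeStr (f : X ⟶ Spec (.of A)) (ψ : A →+* B) : baseChange f ψ ⟶ Spec (.of B) :=
  Limits.pullback.snd f (Spec.map (CommRingCat.ofHom ψ))

lemma residueFieldMap_scalarAt (f : X ⟶ Spec (.of A)) (ψ : A →+* B) (y : baseChange f ψ) (a : A) :
    (baseChangeProj f ψ).residueFieldMap y (scalarAt f (baseChangeProj f ψ y) a) =
      scalarAt (baseChangeStr f ψ) y (ψ a) := by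
  have h : (Scheme.ΓSpecIso (.of A)).inv ≫ f.appTop ≫ X.Γevaluation (baseChangeProj f ψ y) ≫
      (baseChangeProj f ψ).residueFieldMap y =
      CommRingCat.ofHom ψ ≫ (Scheme.ΓSpecIso (.of B)).inv ≫ (baseChangeStr f ψ).appTop ≫
        (baseChange f ψ).Γevaluation y := by
    have hc : f.appTop ≫ (baseChangeProj f ψ).appTop =
        (Spec.map (CommRingCat.ofHom ψ)).appTop ≫ (baseChangeStr f ψ).appTop := by
      rw [← Scheme.Hom.comp_appTop, ← Scheme.Hom.comp_appTop, Limits.pullback.condition]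
    rw [Scheme.Γevaluation_naturality, reassoc_of% hc, Scheme.ΓSpecIso_inv_naturality_assoc]
  exact ConcreteCategory.congr_hom h a

/-- The map `X_B^an → X^an` which pulls back absolute values and raises them to the power `c`;
here `ψ : (A, ν) → (B, μ^c)` is assumed to be bounded by `1`. -/
def Analytification.down {f : X ⟶ Spec (.of A)} {ν : RingNorm A} {μ : RingNorm B} (ψ : A →+* B)
    (c : ℝ) (h0 : 0 < c) (h1 : c ≤ 1) (hb : ∀ a, μ (ψ a) ^ c ≤ ν a)
    (y : Analytification (baseChangeStr f ψ) μ) : Analytification f ν where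
  pt := baseChangeProj f ψ y.pt
  abv := rpowAbv (y.abv.comp ((baseChangeProj f ψ).residueFieldMap y.pt).hom.injective) c h0 h1
  abv_le a := by
    change y.abv ((baseChangeProj f ψ).residueFieldMap y.pt (scalarAt f _ a)) ^ c ≤ ν a
    rw [residueFieldMap_scalarAt]
    exact (Real.rpow_le_rpow (y.abv.nonneg _) (y.abv_le (ψ a)) h0.le).trans (hb a)

end BaseChange

/-! ### Hybrid metrics -/

section HybridMetrics

variable {r : Radius} {X : Scheme.{0}} (f : X ⟶ Spec (.of (hybridRing r)))

/-- The projection to `X` of the complex fibre `X_t`, the base change of `X` along evaluation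
at `t`. -/
abbrev fibreProj (t : PuncturedDisk r) : baseChange f (evalHom t) ⟶ X :=
  baseChangeProj f (evalHom t)

/-- The structure map of the complex fibre `X_t`. -/
abbrev fibreStr (t : PuncturedDisk r) : baseChange f (evalHom t) ⟶ Spec (.of ℂ) :=
  baseChangeStr f (evalHom t)

/-- The projection to `X` of `X_K`, the base change of `X` to `K = ℂ((t))`. -/
abbrev genericProj : baseChange f (hybridRing r).subtype ⟶ X :=
  baseChangeProj f (hybridRing r).subtype

/-- The structure map of `X_K`. -/
abbrev genericStr : baseChange f (hybridRing r).subtype ⟶ Spec (.of (LaurentSeries ℂ)) :=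
  baseChangeStr f (hybridRing r).subtype

variable {f}

/-- The embedding `X_t^an → X^hyb` of the complex fibre at `t` (where `ℂ` carries the usual
absolute value), characterized by `|h(β_t(z))| = |h(z)|^(log r / log |t|)`. -/
def fibreEmb (t : PuncturedDisk r) (z : Analytification (fibreStr f t) (normRingNorm ℂ)) :
    Analytification f (hybridRingNorm r) :=
  z.down (evalHom t) t.exponent t.exponent_pos t.exponent_le_one (norm_evalHom_rpow_le t)

/-- The embedding of the non-archimedean fibre `X_K^an → X^hyb`. -/
def genericEmb (x : Analytification (genericStr f) (tadicNorm r)) :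
    Analytification f (hybridRingNorm r) :=
  x.down (hybridRing r).subtype 1 one_pos le_rfl fun a => by
    rw [Real.rpow_one]; exact tadicNorm_le r a

variable {L : LineBundle X}

/-- The metric `φ_t = (log |t| / log r) φ|_{X_t}` on `L_t` induced by a hybrid metric `φ`. -/
def Potential.atFibre (φ : Potential f (hybridRingNorm r) L) (t : PuncturedDisk r) :
    Potential (fibreStr f t) (normRingNorm ℂ) (L.pullback (fibreProj f t)) :=
  fun i z => (t.logr : EReal) * φ i ⟨fibreEmb t z.1, z.2⟩

/-- The metric `φ_0` on `L_K` induced by a hybrid metric `φ`. -/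
def Potential.atGeneric (φ : Potential f (hybridRingNorm r) L) :
    Potential (genericStr f) (tadicNorm r) (L.pullback (genericProj f)) :=
  fun i x => φ i ⟨genericEmb x.1, x.2⟩

/-- `φ` is the hybrid metric with `φ_t = χ(φ_{1,t}, …, φ_{N,t})` for all `t ≠ 0`, where
`φ_k = m⁻¹ log |s k|`, and `φ_0 = m⁻¹ max_k log |s k|`. -/
def IsHybridChi {N m : ℕ} (χ : (Fin N → ℝ) → ℝ) (s : Fin N → L.Section m)
    (φ : Potential f (hybridRingNorm r) L) : Prop :=
  (∀ t : PuncturedDisk r,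
    φ.atFibre t = chiPotential χ fun k => (s k).pullback (fibreProj f t)) ∧
  φ.atGeneric = maxPotential fun k => (s k).pullback (genericProj f)

/-- `φ` is the hybrid metric with `φ_t = (2m)⁻¹ log ∑ |s_{k,t}|²` for all `t ≠ 0`, and
`φ_0 = m⁻¹ max_k log |s k|`. -/
def IsHybridBergman {κ : Type} [Fintype κ] {m : ℕ} (s : κ → L.Section m)
    (φ : Potential f (hybridRingNorm r) L) : Prop :=
  (∀ t : PuncturedDisk r,
    φ.atFibre t = bergmanPotential fun k => (s k).pullback (fibreProj f t)) ∧
  φ.atGeneric = maxPotential fun k => (s k).pullback (genericProj f)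

end HybridMetrics

end Hybrid

end

open Hybrid

/-!
# Hybrid metrics from convex functions

The hybrid metrics are written down directly. Let `A` be a normed ring with a homomorphism
`ι : ℂ → A` such that the norm of `A` is at most `‖·‖_hyb` on constants. At every point `x` of
`X^an` the absolute value restricts to `|·|^p` on `ℂ`, with `p = exponentAt ι x ∈ [0, 1]`
(`eq_norm_rpow_of_le_hybNorm`). For a convex function `χ` as in the theorem let
`χ_p(x) = p χ(x / p)` for `p > 0`, and let `χ_0` be the maximum of the coordinates (`rescale`).
The metric `combinedPotential` has the value `χ_p(φ₁, …, φ_N)` at a point of exponent `p`. At a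
point of the fibre `X_t` the exponent is `log r / log |t|`, at a point of `X_K` it is `0`, and so
this metric has the restrictions that are asked for (`combinedPotential_atFibre`,
`combinedPotential_atGeneric`). Over `A = ℂ`, where `p = 1`, it is `χ(φ₁, …, φ_N)`.

*Continuity and positivity.* By convex duality `χ` is a uniform limit, on all of `ℝ^N`, of finite
maxima of affine functions `∑ (n k / d) x k + c n` with `∑ n k = d`. Uniformity rests on the
continuity of the Legendre transform up to the boundary of the simplex
(`IsConvexCombiner.continuousOn_legendre`, `IsConvexCombiner.exists_max_affine_approx`). For `χ_p`
one replaces `c n` by `p c n`, and this is what happens to `log |ι (exp (c n))|` at a point of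
exponent `p`. Hence the combined metric is a uniform limit of metrics
`D⁻¹ max log |ι (exp c) ∏ (s k) ^ n k|` (`combinedPotential_approx`). So it is continuous, and after
adding constants that tend to zero, and taking maxima with `ψ - n` for a tropical Fubini-Study
metric `ψ` (which exists by semi-ampleness), it is a decreasing limit of tropical Fubini-Study
metrics (`combinedPotential_exists_net`). The Bergman metric is the case
`χ(x) = (2m)⁻¹ log ∑ exp (2m x k)`.

*Uniqueness.* The fibres cover `X^hyb` (`fibre_cases`). If `p > 0`, then `v^(1/p)` is an absolute
value on the residue field extending the usual one of `ℂ`, so the residue field is `ℂ` by the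
Gelfand-Mazur theorem (`surjective_of_archimedean`), `t` becomes a complex number, and density of
Laurent polynomials shows that `A_r` acts by evaluation at it (`exists_fibreEmb_eq`). If `p = 0`,
then `A_r` carries the `t`-adic absolute value (`seminorm_eq_tadicNorm`), and as `A_r` is dense in
`ℂ((t))`, the action extends to a homomorphism from `ℂ((t))` to the completed residue field
(`exists_genericEmb_eq`).

*Enough points.* A psh metric must not be `-∞` everywhere on a Zariski open subset, or over a
Zariski-dense point of the base. The only such point is the `t`-adic absolute value
(`BerkovichSpectrum.IsZariskiDense.eq_tadicNorm`). As `X → Spec A_r` is open, a non-empty open subset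
of `X` has points over the generic point of `A_r`, with values in an algebraically closed field to
which the `t`-adic absolute value extends (`exists_tadic_point_mem`).
-/

namespace Hybrid

/-! ### Convex functions at bounded distance from the maximum of the coordinates -/

/-- The functions `χ` by which metrics are combined: convex on `ℝ^N`, equivariant under translation
along the diagonal, and within `C` of the maximum of the coordinates. -/
structure IsConvexCombiner {N : ℕ} (χ : (Fin N → ℝ) → ℝ) (C : ℝ) : Prop where
  convex : ConvexOn ℝ Set.univ χ
  add_const : ∀ (x : Fin N → ℝ) (c : ℝ), χ (fun k => x k + c) = χ x + c
  bound : ∀ x : Fin N → ℝ, |χ x - ⨆ k, x k| ≤ C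

/-- The Legendre transform of `χ`; its values are meaningful on the standard simplex, where
the supremum is that of a bounded family. -/
noncomputable def legendre {N : ℕ} (χ : (Fin N → ℝ) → ℝ) (l : Fin N → ℝ) : ℝ :=
  ⨆ y : Fin N → ℝ, (∑ k, l k * y k - χ y)

/-- The family `χ_p(x) = p χ(x/p)`, completed at `p = 0` by its limit, the maximum of the
coordinates. -/
noncomputable def rescale {N : ℕ} (χ : (Fin N → ℝ) → ℝ) (p : ℝ) (x : Fin N → ℝ) : ℝ :=
  if p = 0 then ⨆ k, x k else p * χ (fun k => p⁻¹ * x k)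

lemma le_iSup_coord {N : ℕ} (x : Fin N → ℝ) (k : Fin N) : x k ≤ ⨆ k, x k :=
  le_ciSup (Finite.bddAbove_range x) k

lemma sum_mul_le_iSup {N : ℕ} {l : Fin N → ℝ} (h0 : ∀ k, 0 ≤ l k) (x : Fin N → ℝ) :
    ∑ k, l k * x k ≤ (∑ k, l k) * ⨆ k, x k := by
  rw [Finset.sum_mul]
  exact Finset.sum_le_sum fun k _ => mul_le_mul_of_nonneg_left (le_iSup_coord x k) (h0 k)

namespace IsConvexCombiner

variable {N : ℕ} {χ : (Fin N → ℝ) → ℝ} {C : ℝ}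

lemma nonempty (h : IsConvexCombiner χ C) : Nonempty (Fin N) := by
  by_contra hN
  rw [not_nonempty_iff] at hN
  have := h.add_const 0 1
  rw [Subsingleton.elim (fun k => (0 : Fin N → ℝ) k + 1) 0] at this
  linarith

lemma nonneg (h : IsConvexCombiner χ C) : 0 ≤ C := (abs_nonneg _).trans (h.bound 0)

lemma le_add (h : IsConvexCombiner χ C) (x : Fin N → ℝ) : χ x ≤ (⨆ k, x k) + C := by
  linarith [(abs_le.1 (h.bound x)).2]

lemma iSup_le (h : IsConvexCombiner χ C) (x : Fin N → ℝ) : (⨆ k, x k) ≤ χ x + C := by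
  linarith [(abs_le.1 (h.bound x)).1]

lemma continuous (h : IsConvexCombiner χ C) : Continuous χ := by
  rw [← continuousOn_univ]
  exact h.convex.continuousOn isOpen_univ

/-- `χ` is the supremum of the affine functions below it, and equivariance and boundedness force
their slopes into the standard simplex. -/
lemma exists_affine_minorant (h : IsConvexCombiner χ C) (x : Fin N → ℝ) {ε : ℝ} (hε : 0 < ε) :
    ∃ (l : Fin N → ℝ) (c : ℝ), l ∈ stdSimplex ℝ (Fin N) ∧
      (∀ y, ∑ k, l k * y k + c ≤ χ y) ∧ ∑ k, l k * x k + c = χ x - ε := by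
  have := h.nonempty
  obtain ⟨L, c, h1, h2⟩ := h.convex.exists_affine_le_of_lt (𝕜 := ℝ) (x := x) (a := χ x - ε)
    (Set.mem_univ x) (by linarith) isClosed_univ
    (h.continuous.lowerSemicontinuous.lowerSemicontinuousOn _)
  have hL : ∀ y : Fin N → ℝ, L y = ∑ k, L (Pi.single k 1) * y k := fun y => by
    have e := LinearMap.pi_apply_eq_sum_univ L.toLinearMap y
    refine e.trans (Finset.sum_congr rfl fun k _ => ?_)
    have : (fun j => if k = j then (1 : ℝ) else 0) = Pi.single k 1 := by
      ext j; simp [Pi.single_apply, eq_comm]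
    rw [smul_eq_mul, mul_comm, this]
    rfl
  have hle : ∀ y, L y + c ≤ χ y := fun y => h1 ⟨y, Set.mem_univ y⟩
  refine ⟨fun k => L (Pi.single k 1), c, ⟨fun k => ?_, ?_⟩, fun y => ?_, ?_⟩
  · by_contra! hk
    -- along `-e_k` the affine function would grow linearly, while `χ` stays bounded above
    obtain ⟨T, hT0, hT⟩ : ∃ T : ℝ, 0 ≤ T ∧ C < T * -L (Pi.single k 1) + c := by
      refine ⟨max 0 ((C - c + 1) / -L (Pi.single k 1)), le_max_left _ _, ?_⟩
      have := (div_le_iff₀ (by linarith)).1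
        (le_max_right 0 ((C - c + 1) / -L (Pi.single k 1)))
      linarith
    have h3 := hle (-T • Pi.single k 1)
    have h4 := h.le_add (-T • Pi.single k 1)
    have h5 : (⨆ j, (-T • Pi.single k 1 : Fin N → ℝ) j) ≤ 0 := ciSup_le fun j => by
      by_cases hj : j = k
      · subst hj; simp [hT0]
      · simp [hj]
    rw [map_smul, smul_eq_mul] at h3
    linarith
  · have h3 : ∀ T : ℝ, L (fun _ => T) = T * ∑ k, L (Pi.single k 1) := fun T => by
      rw [hL, ← Finset.sum_mul, mul_comm]
    have h4 : ∀ T : ℝ, T * ∑ k, L (Pi.single k 1) + c ≤ χ 0 + T := fun T => by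
      have := hle (fun _ => T)
      have e := h.add_const 0 T
      simp only [Pi.zero_apply, zero_add] at e
      rwa [e, h3] at this
    by_contra hne
    have hne' : ∑ k, L (Pi.single k 1) - 1 ≠ 0 := sub_ne_zero.2 hne
    have := h4 ((χ 0 - c + 1) / (∑ k, L (Pi.single k 1) - 1))
    have e : (χ 0 - c + 1) / (∑ k, L (Pi.single k 1) - 1) * (∑ k, L (Pi.single k 1) - 1)
      = χ 0 - c + 1 := div_mul_cancel₀ _ hne'
    linarith
  · rw [← hL]; exact hle y
  · rw [← hL]; exact h2

lemma legendre_term_le (h : IsConvexCombiner χ C) {l : Fin N → ℝ} (hl : l ∈ stdSimplex ℝ (Fin N))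
    (y : Fin N → ℝ) : ∑ k, l k * y k - χ y ≤ C := by
  have h1 := sum_mul_le_iSup hl.1 y
  rw [hl.2, one_mul] at h1
  linarith [h.iSup_le y]

lemma bddAbove_legendre (h : IsConvexCombiner χ C) {l : Fin N → ℝ}
    (hl : l ∈ stdSimplex ℝ (Fin N)) :
    BddAbove (Set.range fun y : Fin N → ℝ => ∑ k, l k * y k - χ y) :=
  ⟨C, by rintro _ ⟨y, rfl⟩; exact h.legendre_term_le hl y⟩

lemma le_legendre (h : IsConvexCombiner χ C) {l : Fin N → ℝ} (hl : l ∈ stdSimplex ℝ (Fin N))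
    (y : Fin N → ℝ) : ∑ k, l k * y k - χ y ≤ legendre χ l :=
  le_ciSup (h.bddAbove_legendre hl) y

lemma neg_le_legendre (h : IsConvexCombiner χ C) {l : Fin N → ℝ} (hl : l ∈ stdSimplex ℝ (Fin N)) :
    -C ≤ legendre χ l := by
  have h1 := h.le_legendre hl 0
  have h2 := h.le_add 0
  have : (⨆ k, (0 : Fin N → ℝ) k) = 0 := by have := h.nonempty; simp
  simp only [Pi.zero_apply, mul_zero, Finset.sum_const_zero] at h1
  linarith

/-- The Legendre transform is continuous up to the boundary of the simplex. It is lower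
semicontinuous as a supremum of affine functions. For upper semicontinuity at `l`, a point `l'`
near `l` dominates `(1 - δ) l` coordinatewise, hence is a convex combination of `l` and of a point
of the simplex, with a small weight on the latter. -/
lemma continuousOn_legendre (h : IsConvexCombiner χ C) :
    ContinuousOn (legendre χ) (stdSimplex ℝ (Fin N)) := by
  have := h.nonempty
  rw [continuousOn_iff_lower_upperSemicontinuousOn]
  refine ⟨?_, ?_⟩
  · refine lowerSemicontinuousOn_ciSup (fun l hl => h.bddAbove_legendre hl) fun y => ?_
    refine Continuous.continuousOn ?_ |>.lowerSemicontinuousOn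
    fun_prop
  · intro l hl b hb
    obtain ⟨δ, hδ0, hδ1, hδ⟩ : ∃ δ : ℝ, 0 < δ ∧ δ < 1 ∧ legendre χ l + δ * (2 * C) < b := by
      have hC := h.nonneg
      refine ⟨min (1 / 2) ((b - legendre χ l) / (2 * C + 1) / 2), ?_, ?_, ?_⟩
      · have : 0 < (b - legendre χ l) / (2 * C + 1) / 2 := by
          have : 0 < b - legendre χ l := by linarith
          positivity
        exact lt_min (by norm_num) this
      · exact (min_le_left _ _).trans_lt (by norm_num)
      · have h1 := min_le_right (1 / 2) ((b - legendre χ l) / (2 * C + 1) / 2)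
        have h2 : (b - legendre χ l) / (2 * C + 1) / 2 * (2 * C) < b - legendre χ l := by
          rw [div_div, div_mul_eq_mul_div, div_lt_iff₀ (by positivity)]
          nlinarith
        have h3 := mul_le_mul_of_nonneg_right h1 (by positivity : 0 ≤ 2 * C)
        linarith
    have hev : ∀ᶠ l' in 𝓝[stdSimplex ℝ (Fin N)] l, ∀ k, (1 - δ) * l k ≤ l' k := by
      rw [Filter.eventually_all]
      intro k
      rcases (hl.1 k).eq_or_lt with hk | hk
      · filter_upwards [self_mem_nhdsWithin] with l' hl'
        rw [← hk, mul_zero]; exact hl'.1 k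
      · refine nhdsWithin_le_nhds ?_
        have : (1 - δ) * l k < l k := by nlinarith
        filter_upwards [(continuous_apply k).continuousAt.eventually (lt_mem_nhds this)] with l' hl'
        exact hl'.le
    filter_upwards [hev, self_mem_nhdsWithin] with l' hl' hS
    refine lt_of_le_of_lt (ciSup_le fun y => ?_) hδ
    have h1 := sum_mul_le_iSup (l := fun k => l' k - (1 - δ) * l k)
      (fun k => sub_nonneg.2 (hl' k)) y
    have h2 : ∑ k, (l' k - (1 - δ) * l k) = δ := by
      rw [Finset.sum_sub_distrib, ← Finset.mul_sum, hl.2, hS.2]; ring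
    have h3 : ∑ k, (l' k - (1 - δ) * l k) * y k =
        ∑ k, l' k * y k - (1 - δ) * ∑ k, l k * y k := by
      rw [Finset.mul_sum, ← Finset.sum_sub_distrib]
      exact Finset.sum_congr rfl fun k _ => by ring
    rw [h2, h3] at h1
    have h4 := mul_le_mul_of_nonneg_left (h.iSup_le y) hδ0.le
    have h5 := mul_le_mul_of_nonneg_left (h.le_legendre hl y) (by linarith : 0 ≤ 1 - δ)
    have h6 := mul_le_mul_of_nonneg_left (h.neg_le_legendre hl) hδ0.le
    nlinarith

end IsConvexCombiner

/-- Rounding a point `l` of the simplex to the grid of mesh `1/d`, without decreasing its pairing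
with `x`: the coordinates are rounded down and the rest is put on the largest coordinate of `x`. -/
lemma exists_grid_point {N : ℕ} {l : Fin N → ℝ} (hl : l ∈ stdSimplex ℝ (Fin N)) {d : ℕ}
    (hd : 1 ≤ d) (x : Fin N → ℝ) {k₀ : Fin N} (hk₀ : ∀ k, x k ≤ x k₀) :
    ∃ n : Fin N → ℕ, ∑ k, n k = d ∧ (∀ k, |(n k : ℝ) / d - l k| ≤ N / d) ∧
      ∑ k, l k * x k ≤ ∑ k, (n k : ℝ) / d * x k := by
  have hd' : (0 : ℝ) < d := by exact_mod_cast hd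
  have hfl : ∀ k, ((⌊d * l k⌋₊ : ℕ) : ℝ) ≤ d * l k := fun k =>
    Nat.floor_le (mul_nonneg hd'.le (hl.1 k))
  have hfl' : ∀ k, d * l k - 1 ≤ ((⌊d * l k⌋₊ : ℕ) : ℝ) := fun k => (Nat.sub_one_lt_floor _).le
  have hs : ∑ k, (⌊d * l k⌋₊ : ℕ) ≤ d := by
    have : (∑ k, ((⌊d * l k⌋₊ : ℕ) : ℝ)) ≤ d := by
      refine (Finset.sum_le_sum fun k _ => hfl k).trans ?_
      rw [← Finset.mul_sum, hl.2, mul_one]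
    exact_mod_cast this
  have hs' : (d : ℝ) - ∑ k, ((⌊d * l k⌋₊ : ℕ) : ℝ) ≤ N := by
    have : ∑ k, (d * l k - 1) ≤ ∑ k, ((⌊d * l k⌋₊ : ℕ) : ℝ) := Finset.sum_le_sum fun k _ => hfl' k
    rw [Finset.sum_sub_distrib, ← Finset.mul_sum, hl.2] at this
    simp at this
    linarith
  have hN : (1 : ℝ) ≤ N := by exact_mod_cast (Fin.pos k₀)
  set D : ℕ := d - ∑ k, (⌊d * l k⌋₊ : ℕ) with hD
  have hDc : (D : ℝ) = d - ∑ k, ((⌊d * l k⌋₊ : ℕ) : ℝ) := by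
    rw [hD, Nat.cast_sub hs, Nat.cast_sum]
  have hD0 : (0 : ℝ) ≤ D := Nat.cast_nonneg _
  refine ⟨fun k => ⌊d * l k⌋₊ + if k = k₀ then D else 0, ?_, fun k => ?_, ?_⟩
  · rw [Finset.sum_add_distrib, Finset.sum_ite_eq' Finset.univ k₀]
    simp only [Finset.mem_univ, if_true]
    omega
  · have e : ∀ a : ℝ, a / d - l k = (a - d * l k) / d := fun a => by field_simp
    rw [e, abs_div, abs_of_pos hd', div_le_div_iff_of_pos_right hd', abs_le]
    have h1 := hfl k
    have h2 := hfl' k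
    push_cast
    split_ifs <;> constructor <;> linarith
  · have e : ∀ k, ((⌊d * l k⌋₊ + if k = k₀ then D else 0 : ℕ) : ℝ) / d * x k =
        (d : ℝ)⁻¹ * (((⌊d * l k⌋₊ : ℕ) : ℝ) * x k) +
          if k = k₀ then (d : ℝ)⁻¹ * (D * x k₀) else 0 := fun k => by
      split_ifs with hk
      · subst hk; push_cast; field_simp
      · push_cast; field_simp; ring
    simp only [e]
    rw [Finset.sum_add_distrib, Finset.sum_ite_eq' Finset.univ k₀]
    simp only [Finset.mem_univ, if_true]
    rw [← Finset.mul_sum, ← mul_add, hDc, ← div_eq_inv_mul, le_div_iff₀ hd']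
    have h1 : ∑ k, (d * l k - ((⌊d * l k⌋₊ : ℕ) : ℝ)) * (x k₀ - x k) ≥ 0 :=
      Finset.sum_nonneg fun k _ => mul_nonneg (sub_nonneg.2 (hfl k)) (sub_nonneg.2 (hk₀ k))
    have h2 : ∑ k, (d * l k - ((⌊d * l k⌋₊ : ℕ) : ℝ)) * (x k₀ - x k) =
        (d - ∑ k, ((⌊d * l k⌋₊ : ℕ) : ℝ)) * x k₀ - d * ∑ k, l k * x k +
          ∑ k, ((⌊d * l k⌋₊ : ℕ) : ℝ) * x k := by
      have : (d : ℝ) = ∑ k, d * l k := by rw [← Finset.mul_sum, hl.2, mul_one]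
      conv_rhs => rw [show (d : ℝ) - ∑ k, ((⌊d * l k⌋₊ : ℕ) : ℝ) =
        ∑ k, (d * l k - ((⌊d * l k⌋₊ : ℕ) : ℝ)) by rw [Finset.sum_sub_distrib, ← this]]
      rw [Finset.sum_mul, Finset.mul_sum, ← Finset.sum_sub_distrib, ← Finset.sum_add_distrib]
      exact Finset.sum_congr rfl fun k _ => by ring
    linarith

/-- `χ` is a uniform limit, on all of `ℝ^N`, of finite maxima of affine functions with slopes in
the rational points of the simplex; the constants are the values of the Legendre transform. -/
theorem IsConvexCombiner.exists_max_affine_approx {N : ℕ} {χ : (Fin N → ℝ) → ℝ} {C : ℝ}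
    (h : IsConvexCombiner χ C) {ε : ℝ} (hε : 0 < ε) :
    ∃ d : ℕ, 1 ≤ d ∧ ∃ c : (Fin N → ℕ) → ℝ,
      (∀ n : Fin N → ℕ, ∑ k, n k = d → ∀ x, ∑ k, (n k : ℝ) / d * x k + c n ≤ χ x) ∧
      ∀ x, ∃ n : Fin N → ℕ, ∑ k, n k = d ∧ χ x ≤ ∑ k, (n k : ℝ) / d * x k + c n + ε := by
  have := h.nonempty
  have hu := (isCompact_stdSimplex ℝ (Fin N)).uniformContinuousOn_of_continuous
    h.continuousOn_legendre
  rw [Metric.uniformContinuousOn_iff] at hu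
  obtain ⟨η, hη, hu⟩ := hu (ε / 2) (half_pos hε)
  obtain ⟨d, hd⟩ := exists_nat_gt ((N : ℝ) / η + 1)
  have hNη : 0 ≤ (N : ℝ) / η := by positivity
  have hd1 : (1 : ℝ) ≤ d := by linarith
  have hd1' : 1 ≤ d := by exact_mod_cast hd1
  have hd0 : (0 : ℝ) < d := by linarith
  have hmem : ∀ n : Fin N → ℕ, ∑ k, n k = d →
      (fun k => (n k : ℝ) / d) ∈ stdSimplex ℝ (Fin N) := fun n hn => by
    refine ⟨fun k => by positivity, ?_⟩
    rw [← Finset.sum_div, ← Nat.cast_sum, hn, div_self hd0.ne']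
  refine ⟨d, hd1', fun n => -legendre χ fun k => (n k : ℝ) / d, fun n hn x => ?_, fun x => ?_⟩
  · linarith [h.le_legendre (hmem n hn) x]
  · obtain ⟨l, c, hl, h1, h2⟩ := h.exists_affine_minorant x (half_pos hε)
    obtain ⟨k₀, hk₀⟩ := Finite.exists_max x
    obtain ⟨n, hn, hn1, hn2⟩ := exists_grid_point hl hd1' x hk₀
    refine ⟨n, hn, ?_⟩
    have h3 : dist (fun k => (n k : ℝ) / d) l < η := by
      rw [dist_pi_lt_iff hη]
      intro k
      rw [Real.dist_eq]
      refine (hn1 k).trans_lt ?_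
      rw [div_lt_iff₀ hd0, ← div_lt_iff₀' hη]
      linarith
    have h4 := hu _ (hmem n hn) _ hl h3
    rw [Real.dist_eq] at h4
    have h5 : legendre χ l ≤ -c := ciSup_le fun y => by linarith [h1 y]
    linarith [(abs_lt.1 h4).2]

lemma sum_single_mul {N : ℕ} (k₀ : Fin N) (d : ℕ) (x : Fin N → ℝ) :
    ∑ k, ((Pi.single k₀ d : Fin N → ℕ) k : ℝ) / d * x k = (d : ℝ) / d * x k₀ := by
  rw [Finset.sum_eq_single k₀]
  · simp
  · intro k _ hk; simp [hk]
  · simp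

/-- The approximation of `χ_p` by maxima of affine functions, with error `p ε`: the slopes do not
depend on `p`, and the constants are scaled by `p`. -/
theorem IsConvexCombiner.exists_max_affine_approx_rescale {N : ℕ} {χ : (Fin N → ℝ) → ℝ} {C : ℝ}
    (h : IsConvexCombiner χ C) {ε : ℝ} (hε : 0 < ε) :
    ∃ d : ℕ, 1 ≤ d ∧ ∃ c : (Fin N → ℕ) → ℝ, ∀ p : ℝ, 0 ≤ p →
      (∀ n : Fin N → ℕ, ∑ k, n k = d →
        ∀ x, ∑ k, (n k : ℝ) / d * x k + p * c n ≤ rescale χ p x) ∧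
      ∀ x, ∃ n : Fin N → ℕ, ∑ k, n k = d ∧
        rescale χ p x ≤ ∑ k, (n k : ℝ) / d * x k + p * c n + p * ε := by
  have := h.nonempty
  obtain ⟨d, hd, c, h1, h2⟩ := h.exists_max_affine_approx hε
  have hd0 : (0 : ℝ) < d := by exact_mod_cast hd
  refine ⟨d, hd, c, fun p hp => ?_⟩
  rcases hp.eq_or_lt with rfl | hp
  · simp only [rescale, if_true, zero_mul, add_zero]
    refine ⟨fun n hn x => ?_, fun x => ?_⟩
    · refine (sum_mul_le_iSup (fun k => by positivity) x).trans_eq ?_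
      rw [← Finset.sum_div, ← Nat.cast_sum, hn, div_self hd0.ne', one_mul]
    · obtain ⟨k₀, hk₀⟩ := Finite.exists_max x
      refine ⟨Pi.single k₀ d, by simp, ?_⟩
      rw [sum_single_mul, div_self hd0.ne', one_mul]
      exact ciSup_le hk₀
  · simp only [rescale, hp.ne', if_false]
    have e : ∀ (n : Fin N → ℕ) (x : Fin N → ℝ),
        p * ∑ k, (n k : ℝ) / d * (p⁻¹ * x k) = ∑ k, (n k : ℝ) / d * x k := fun n x => by
      rw [Finset.mul_sum]
      exact Finset.sum_congr rfl fun k _ => by field_simp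
    refine ⟨fun n hn x => ?_, fun x => ?_⟩
    · rw [← e, ← mul_add]
      exact mul_le_mul_of_nonneg_left (h1 n hn _) hp.le
    · obtain ⟨n, hn, h3⟩ := h2 fun k => p⁻¹ * x k
      refine ⟨n, hn, ?_⟩
      rw [← e, ← mul_add, ← mul_add]
      exact mul_le_mul_of_nonneg_left h3 hp.le

lemma IsConvexCombiner.rescale_add_const {N : ℕ} {χ : (Fin N → ℝ) → ℝ} {C : ℝ}
    (h : IsConvexCombiner χ C) (p : ℝ) (x : Fin N → ℝ) (c : ℝ) :
    rescale χ p (fun k => x k + c) = rescale χ p x + c := by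
  have := h.nonempty
  simp only [rescale]
  split_ifs with hp
  · exact (ciSup_add (Finite.bddAbove_range x) c).symm
  · simp only [mul_add]
    rw [h.add_const, mul_add, mul_inv_cancel_left₀ hp]

/-! ### Extended real numbers and logarithms -/

/-- Multiplication by a positive real number, as an order isomorphism of the extended reals. -/
noncomputable def mulOrderIso (c : ℝ) (hc : 0 < c) : EReal ≃o EReal where
  toFun x := (c : EReal) * x
  invFun x := ((c⁻¹ : ℝ) : EReal) * x
  left_inv x := by
    beta_reduce
    rw [← mul_assoc, ← EReal.coe_mul, inv_mul_cancel₀ hc.ne', EReal.coe_one, one_mul]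
  right_inv x := by
    beta_reduce
    rw [← mul_assoc, ← EReal.coe_mul, mul_inv_cancel₀ hc.ne', EReal.coe_one, one_mul]
  map_rel_iff' {a b} := by
    have h0 : (0 : EReal) ≤ c := by exact_mod_cast hc.le
    have h1 : (0 : EReal) ≤ (c⁻¹ : ℝ) := by exact_mod_cast (inv_pos.2 hc).le
    refine ⟨fun h => ?_, fun h => mul_le_mul_of_nonneg_left h h0⟩
    have := mul_le_mul_of_nonneg_left h h1
    simpa only [Equiv.coe_fn_mk, ← mul_assoc, ← EReal.coe_mul, inv_mul_cancel₀ hc.ne',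
      EReal.coe_one, one_mul] using this

/-- Addition of a real number, as an order isomorphism of the extended reals. -/
noncomputable def addOrderIso (c : ℝ) : EReal ≃o EReal where
  toFun x := x + (c : EReal)
  invFun x := x + ((-c : ℝ) : EReal)
  left_inv x := by
    beta_reduce
    rw [add_assoc, ← EReal.coe_add, add_neg_cancel, EReal.coe_zero, add_zero]
  right_inv x := by
    beta_reduce
    rw [add_assoc, ← EReal.coe_add, neg_add_cancel, EReal.coe_zero, add_zero]
  map_rel_iff' {a b} := by
    refine ⟨fun h => ?_, fun h => add_le_add_left h _⟩
    have := add_le_add_left h ((-c : ℝ) : EReal)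
    simpa only [Equiv.coe_fn_mk, add_assoc, ← EReal.coe_add, add_neg_cancel, EReal.coe_zero,
      add_zero] using this

lemma coe_mul_iSup {ι : Sort*} {c : ℝ} (hc : 0 < c) (g : ι → EReal) :
    (c : EReal) * ⨆ i, g i = ⨆ i, (c : EReal) * g i :=
  (mulOrderIso c hc).map_iSup g

lemma coe_mul_le_coe_mul {c : ℝ} (hc : 0 < c) {x y : EReal} :
    (c : EReal) * x ≤ c * y ↔ x ≤ y := (mulOrderIso c hc).le_iff_le

lemma coe_mul_injective {c : ℝ} (hc : 0 < c) :
    Function.Injective fun x : EReal => (c : EReal) * x :=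
  (mulOrderIso c hc).injective

lemma continuous_coe_mul {c : ℝ} (hc : 0 < c) : Continuous fun x : EReal => (c : EReal) * x :=
  (mulOrderIso c hc).continuous

lemma continuous_add_coe (c : ℝ) : Continuous fun x : EReal => x + (c : EReal) :=
  (addOrderIso c).continuous

lemma iSup_add_coe {ι : Sort*} (g : ι → EReal) (c : ℝ) :
    (⨆ i, g i) + (c : EReal) = ⨆ i, (g i + c) :=
  (addOrderIso c).map_iSup g

lemma coe_mul_add {c : ℝ} (hc : 0 < c) (x : EReal) (b : ℝ) :
    (c : EReal) * (x + b) = c * x + ((c * b : ℝ) : EReal) := by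
  induction x with
  | bot => rw [EReal.bot_add, EReal.coe_mul_bot_of_pos hc, EReal.bot_add]
  | coe x => norm_cast; ring
  | top => rw [EReal.top_add_coe, EReal.coe_mul_top_of_pos hc, EReal.top_add_coe]

lemma coe_mul_ne_top {c : ℝ} (hc : 0 < c) {x : EReal} (hx : x ≠ ⊤) : (c : EReal) * x ≠ ⊤ :=
  fun h => hx (coe_mul_injective hc (h.trans (EReal.coe_mul_top_of_pos hc).symm))

lemma coe_mul_ne_bot {c : ℝ} (hc : 0 < c) {x : EReal} (hx : x ≠ ⊥) : (c : EReal) * x ≠ ⊥ :=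
  fun h => hx (coe_mul_injective hc (h.trans (EReal.coe_mul_bot_of_pos hc).symm))

lemma continuous_finite_iSup {J T : Type*} [Finite J] [TopologicalSpace T] {g : J → T → EReal}
    (h : ∀ j, Continuous (g j)) : Continuous fun x => ⨆ j, g j x := by
  have := Fintype.ofFinite J
  simp_rw [← Finset.sup_univ_eq_iSup]
  exact Continuous.finset_sup_apply fun j _ => h j

@[simp] lemma elog_zero : elog 0 = ⊥ := by simp [elog]

lemma elog_of_pos {a : ℝ} (ha : 0 < a) : elog a = (Real.log a : EReal) :=
  ENNReal.log_ofReal_of_pos ha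

@[simp] lemma elog_exp (c : ℝ) : elog (Real.exp c) = (c : EReal) := by
  rw [elog_of_pos (Real.exp_pos c), Real.log_exp]

lemma elog_ne_top (a : ℝ) : elog a ≠ ⊤ := fun h =>
  ENNReal.ofReal_ne_top (ENNReal.log_eq_top_iff.1 h)

lemma elog_eq_bot {a : ℝ} (ha : 0 ≤ a) : elog a = ⊥ ↔ a = 0 := by
  rw [elog, ENNReal.log_eq_bot_iff, ENNReal.ofReal_eq_zero]
  exact ⟨fun h => le_antisymm h ha, fun h => h.le⟩

lemma elog_mul {a b : ℝ} (ha : 0 ≤ a) : elog (a * b) = elog a + elog b := by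
  rw [elog, ENNReal.ofReal_mul ha, ENNReal.log_mul_add]; rfl

lemma elog_mono {a b : ℝ} (h : a ≤ b) : elog a ≤ elog b :=
  ENNReal.log_monotone (ENNReal.ofReal_le_ofReal h)

lemma elog_rpow {a p : ℝ} (ha : 0 ≤ a) (hp : 0 ≤ p) : elog (a ^ p) = p * elog a := by
  rw [elog, ← ENNReal.ofReal_rpow_of_nonneg ha hp, ENNReal.log_rpow]; rfl

lemma elog_pow {a : ℝ} (ha : 0 ≤ a) (n : ℕ) : elog (a ^ n) = ((n : ℝ) : EReal) * elog a := by
  rw [← Real.rpow_natCast, elog_rpow ha n.cast_nonneg]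

lemma continuous_elog : Continuous elog := by
  unfold elog
  exact ENNReal.continuous_log.comp ENNReal.continuous_ofReal

lemma elog_le_coe {a b : ℝ} (ha : 0 ≤ a) : elog a ≤ b ↔ a ≤ Real.exp b := by
  rcases ha.eq_or_lt with rfl | ha
  · simp [(Real.exp_pos b).le]
  · rw [elog_of_pos ha, EReal.coe_le_coe_iff, Real.log_le_iff_le_exp ha]

/-! ### The extension to `[-∞, ∞)^N` -/

section extendBot

variable {N : ℕ}

lemma extendBot_le {F : (Fin N → ℝ) → ℝ} {x : Fin N → EReal} {y : Fin N → ℝ}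
    (h : ∀ k, x k ≤ y k) : extendBot F x ≤ F y :=
  iInf_le (fun y : {y : Fin N → ℝ // ∀ k, x k ≤ (y k : EReal)} => ((F y.1 : ℝ) : EReal)) ⟨y, h⟩

lemma le_extendBot {F : (Fin N → ℝ) → ℝ} {x : Fin N → EReal} {b : EReal}
    (h : ∀ y : Fin N → ℝ, (∀ k, x k ≤ y k) → b ≤ F y) : b ≤ extendBot F x :=
  le_iInf fun y => h y.1 y.2

lemma exists_real_ge {x : Fin N → EReal} (hx : ∀ k, x k ≠ ⊤) :
    ∃ y : Fin N → ℝ, ∀ k, x k ≤ y k := by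
  refine ⟨fun k => (x k).toReal, fun k => EReal.le_coe_toReal (hx k)⟩

lemma extendBot_ne_top (F : (Fin N → ℝ) → ℝ) {x : Fin N → EReal} (hx : ∀ k, x k ≠ ⊤) :
    extendBot F x ≠ ⊤ := by
  obtain ⟨y, hy⟩ := exists_real_ge hx
  exact ne_top_of_le_ne_top (EReal.coe_ne_top _) (extendBot_le hy)

lemma extendBot_add_const_le {F : (Fin N → ℝ) → ℝ}
    (hF : ∀ (x : Fin N → ℝ) (c : ℝ), F (fun k => x k + c) = F x + c) (x : Fin N → EReal) (c : ℝ) :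
    extendBot F (fun k => x k + c) ≤ extendBot F x + c := by
  have h : extendBot F (fun k => x k + c) + ((-c : ℝ) : EReal) ≤ extendBot F x := by
    refine le_extendBot fun y hy => ?_
    have h1 : extendBot F (fun k => x k + c) ≤ F (fun k => y k + c) :=
      extendBot_le fun k => by rw [EReal.coe_add]; exact add_le_add_left (hy k) _
    refine (add_le_add_left h1 _).trans_eq ?_
    rw [hF, ← EReal.coe_add]; congr 1; ring
  have := add_le_add_left h (c : EReal)
  rwa [add_assoc, ← EReal.coe_add, neg_add_cancel, EReal.coe_zero, add_zero] at this

lemma extendBot_add_const {F : (Fin N → ℝ) → ℝ}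
    (hF : ∀ (x : Fin N → ℝ) (c : ℝ), F (fun k => x k + c) = F x + c) (x : Fin N → EReal) (c : ℝ) :
    extendBot F (fun k => x k + c) = extendBot F x + c := by
  refine le_antisymm (extendBot_add_const_le hF x c) ?_
  have h := extendBot_add_const_le hF (fun k => x k + c) (-c)
  simp only [add_assoc, ← EReal.coe_add, add_neg_cancel, EReal.coe_zero, add_zero] at h
  have := add_le_add_left h (c : EReal)
  rwa [add_assoc, ← EReal.coe_add, neg_add_cancel, EReal.coe_zero, add_zero] at this

lemma extendBot_rescale_mul (χ : (Fin N → ℝ) → ℝ) {p : ℝ} (hp : 0 < p) (x : Fin N → EReal) :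
    extendBot (rescale χ p) (fun k => (p : EReal) * x k) = p * extendBot χ x := by
  have e : ∀ y : Fin N → ℝ, rescale χ p y = p * χ (fun k => p⁻¹ * y k) := fun y => by
    simp [rescale, hp.ne']
  refine le_antisymm ?_ (le_extendBot fun y hy => ?_)
  · have : ((p⁻¹ : ℝ) : EReal) * extendBot (rescale χ p) (fun k => (p : EReal) * x k) ≤
        extendBot χ x := by
      refine le_extendBot fun y hy => ?_
      have h1 : extendBot (rescale χ p) (fun k => (p : EReal) * x k) ≤
          rescale χ p (fun k => p * y k) := extendBot_le fun k => by
        rw [EReal.coe_mul]; exact (coe_mul_le_coe_mul hp).2 (hy k)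
      refine ((coe_mul_le_coe_mul (inv_pos.2 hp)).2 h1).trans_eq ?_
      rw [e, ← EReal.coe_mul, inv_mul_cancel_left₀ hp.ne']
      congr 3; ext k; rw [inv_mul_cancel_left₀ hp.ne']
    have := (coe_mul_le_coe_mul hp).2 this
    rwa [← mul_assoc, ← EReal.coe_mul, mul_inv_cancel₀ hp.ne', EReal.coe_one, one_mul] at this
  · have h1 : extendBot χ x ≤ χ (fun k => p⁻¹ * y k) := extendBot_le fun k => by
      rw [← coe_mul_le_coe_mul hp, ← EReal.coe_mul, mul_inv_cancel_left₀ hp.ne']; exact hy k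
    refine ((coe_mul_le_coe_mul hp).2 h1).trans_eq ?_
    rw [e, EReal.coe_mul]

lemma rescale_one (χ : (Fin N → ℝ) → ℝ) : rescale χ 1 = χ := by
  ext x; simp [rescale]

/-- The value at `a ∈ [0, ∞)^N` of a tropical monomial `log (c aⁿ)`, normalized by its degree
`D`, in terms of the affine function `b + ∑ (n k / d) y k` of `y = m⁻¹ log a`. -/
lemma monomial_eq_affine {d m : ℕ} (hd : 1 ≤ d) (hm : 1 ≤ m) (n : Fin N → ℕ) (b : ℝ)
    (y : Fin N → ℝ) :
    (((d * m : ℕ) : ℝ)⁻¹ : ℝ) * elog (Real.exp ((d * m : ℕ) * b) * ∏ k, Real.exp (m * y k) ^ n k) =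
      ((∑ k, (n k : ℝ) / d * y k + b : ℝ) : EReal) := by
  have hd' : (d : ℝ) ≠ 0 := by positivity
  have hm' : (m : ℝ) ≠ 0 := by positivity
  have e : Real.exp ((d * m : ℕ) * b) * ∏ k, Real.exp (m * y k) ^ n k =
      Real.exp ((d * m : ℕ) * (∑ k, (n k : ℝ) / d * y k + b)) := by
    simp_rw [← Real.exp_nat_mul]
    rw [← Real.exp_sum, ← Real.exp_add, mul_add, Finset.mul_sum, add_comm]
    congr 2
    refine Finset.sum_congr rfl fun k _ => ?_
    push_cast; field_simp
  rw [e, elog_exp, ← EReal.coe_mul, inv_mul_cancel_left₀]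
  push_cast; positivity

/-- An affine minorant of `F` yields a tropical monomial below the extension of `F`. -/
lemma monomial_le_extendBot {F : (Fin N → ℝ) → ℝ} {d m : ℕ} (hd : 1 ≤ d) (hm : 1 ≤ m)
    {n : Fin N → ℕ} {b : ℝ} (h : ∀ y : Fin N → ℝ, ∑ k, (n k : ℝ) / d * y k + b ≤ F y)
    {a : Fin N → ℝ} (ha : ∀ k, 0 ≤ a k) :
    (((d * m : ℕ) : ℝ)⁻¹ : ℝ) * elog (Real.exp ((d * m : ℕ) * b) * ∏ k, a k ^ n k) ≤
      extendBot F fun k => ((m : ℝ)⁻¹ : ℝ) * elog (a k) := by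
  have hm' : (0 : ℝ) < m := by positivity
  have hD : (0 : ℝ) < ((d * m : ℕ) : ℝ)⁻¹ := by positivity
  refine le_extendBot fun y hy => ?_
  refine le_trans ?_ (EReal.coe_le_coe_iff.2 (h y))
  rw [← monomial_eq_affine hd hm n b y, coe_mul_le_coe_mul hD]
  refine elog_mono (mul_le_mul_of_nonneg_left ?_ (Real.exp_pos _).le)
  refine Finset.prod_le_prod (fun k _ => pow_nonneg (ha k) _) fun k _ =>
    pow_le_pow_left₀ (ha k) ?_ _
  rw [← elog_le_coe (ha k), EReal.coe_mul, ← coe_mul_le_coe_mul (inv_pos.2 hm'), ← mul_assoc,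
    ← EReal.coe_mul, inv_mul_cancel₀ hm'.ne', EReal.coe_one, one_mul]
  exact hy k

/-- An upper bound for the extension of `F` in terms of a function `G` of `a ∈ [0, ∞)^N` that is
continuous along `a + δ`, `δ ↓ 0`: it is enough to know it at points with positive coordinates. -/
lemma extendBot_le_of_continuous {F : (Fin N → ℝ) → ℝ} {m : ℕ} (hm : 1 ≤ m)
    {G : (Fin N → ℝ) → EReal} {a : Fin N → ℝ} (ha : ∀ k, 0 ≤ a k)
    (hG : Continuous fun δ : ℝ => G fun k => a k + δ)
    (h : ∀ a' : Fin N → ℝ, (∀ k, 0 < a' k) →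
      (F (fun k => (m : ℝ)⁻¹ * Real.log (a' k)) : EReal) ≤ G a') :
    extendBot F (fun k => ((m : ℝ)⁻¹ : ℝ) * elog (a k)) ≤ G a := by
  have hm' : (0 : ℝ) < m := by positivity
  have ht := (hG.tendsto 0).mono_left (nhdsWithin_le_nhds (s := Set.Ioi 0))
  simp only [add_zero] at ht
  refine ge_of_tendsto ht ?_
  filter_upwards [self_mem_nhdsWithin] with δ hδ
  have hpos : ∀ k, 0 < a k + δ := fun k => add_pos_of_nonneg_of_pos (ha k) hδ
  refine (extendBot_le fun k => ?_).trans (h _ hpos)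
  rw [EReal.coe_mul, ← elog_of_pos (hpos k), coe_mul_le_coe_mul (inv_pos.2 hm')]
  exact elog_mono (by have := Set.mem_Ioi.1 hδ; linarith)

/-- If `F` is below a finite maximum of affine functions, up to `ε`, then the extension of `F` is
below the corresponding maximum of tropical monomials, up to `ε`. -/
lemma extendBot_le_monomial {F : (Fin N → ℝ) → ℝ} {J : Type*} [Finite J] {d m : ℕ} (hd : 1 ≤ d)
    (hm : 1 ≤ m) {n : J → Fin N → ℕ} {b : J → ℝ} {ε : ℝ}
    (h : ∀ y : Fin N → ℝ, ∃ j, F y ≤ ∑ k, (n j k : ℝ) / d * y k + b j + ε)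
    {a : Fin N → ℝ} (ha : ∀ k, 0 ≤ a k) :
    extendBot F (fun k => ((m : ℝ)⁻¹ : ℝ) * elog (a k)) ≤
      (⨆ j, (((d * m : ℕ) : ℝ)⁻¹ : ℝ) *
        elog (Real.exp ((d * m : ℕ) * b j) * ∏ k, a k ^ n j k)) + (ε : EReal) := by
  have hm' : (0 : ℝ) < m := by positivity
  have hD : (0 : ℝ) < ((d * m : ℕ) : ℝ)⁻¹ := by positivity
  refine extendBot_le_of_continuous hm (G := fun a => (⨆ j, (((d * m : ℕ) : ℝ)⁻¹ : ℝ) *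
        elog (Real.exp ((d * m : ℕ) * b j) * ∏ k, a k ^ n j k)) + (ε : EReal)) ha ?_ ?_
  · refine (continuous_add_coe ε).comp (continuous_finite_iSup fun j => ?_)
    refine (continuous_coe_mul hD).comp (continuous_elog.comp ?_)
    fun_prop
  · intro a' ha'
    obtain ⟨j, hj⟩ := h fun k => (m : ℝ)⁻¹ * Real.log (a' k)
    refine (EReal.coe_le_coe_iff.2 hj).trans ?_
    rw [EReal.coe_add]
    refine add_le_add_left ?_ _
    rw [← monomial_eq_affine hd hm]
    have e : ∀ k, Real.exp (m * ((m : ℝ)⁻¹ * Real.log (a' k))) = a' k := fun k => by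
      rw [mul_inv_cancel_left₀ hm'.ne', Real.exp_log (ha' k)]
    simp only [e]
    exact le_iSup (fun j => (((d * m : ℕ) : ℝ)⁻¹ : ℝ) *
      elog (Real.exp ((d * m : ℕ) * b j) * ∏ k, a' k ^ n j k)) j

lemma extendBot_rescale_zero [Nonempty (Fin N)] (χ : (Fin N → ℝ) → ℝ)
    (x : Fin N → EReal) :
    extendBot (rescale χ 0) x = ⨆ k, x k := by
  have e : ∀ y : Fin N → ℝ, rescale χ 0 y = ⨆ k, y k := fun y => by simp [rescale]
  refine le_antisymm ?_ (le_extendBot fun y hy => iSup_le fun k => (hy k).trans ?_)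
  · refine EReal.le_of_forall_lt_iff_le.1 fun z hz => ?_
    have hz' : ∀ k, x k ≤ (z : EReal) := fun k => (le_iSup x k).trans hz.le
    refine (extendBot_le hz').trans ?_
    rw [e, ciSup_const]
  · rw [e]; exact EReal.coe_le_coe_iff.2 (le_iSup_coord y k)

lemma IsConvexCombiner.le_extendBot_rescale {χ : (Fin N → ℝ) → ℝ} {C : ℝ}
    (h : IsConvexCombiner χ C) {p : ℝ} (hp : 0 ≤ p) (x : Fin N → EReal) (k : Fin N) :
    x k + ((-(p * C) : ℝ) : EReal) ≤ extendBot (rescale χ p) x := by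
  refine le_extendBot fun y hy => ?_
  refine (add_le_add_left (hy k) _).trans ?_
  rw [← EReal.coe_add, EReal.coe_le_coe_iff]
  rcases hp.eq_or_lt with rfl | hp
  · simpa [rescale] using le_iSup_coord y k
  · have h1 := (le_iSup_coord (fun k => p⁻¹ * y k) k).trans (h.iSup_le _)
    have h2 := mul_le_mul_of_nonneg_left h1 hp.le
    rw [mul_inv_cancel_left₀ hp.ne'] at h2
    simp only [rescale, hp.ne', if_false]
    linarith

end extendBot

/-! ### The logarithm of a sum of exponentials -/

/-- The function `c⁻¹ log ∑ exp (c x k)`. -/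
noncomputable def logSumExp {N : ℕ} (c : ℝ) (x : Fin N → ℝ) : ℝ :=
  c⁻¹ * Real.log (∑ k, Real.exp (c * x k))

section logSumExp

variable {N : ℕ} [Nonempty (Fin N)] {c : ℝ}

lemma sum_exp_pos (x : Fin N → ℝ) : 0 < ∑ k, Real.exp (x k) :=
  Finset.sum_pos (fun _ _ => Real.exp_pos _) Finset.univ_nonempty

lemma logSumExp_le_iff (hc : 0 < c) {x : Fin N → ℝ} {b : ℝ} :
    logSumExp c x ≤ b ↔ ∑ k, Real.exp (c * x k) ≤ Real.exp (c * b) := by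
  rw [logSumExp, inv_mul_le_iff₀ hc, Real.log_le_iff_le_exp (sum_exp_pos _)]

lemma sum_exp_logSumExp (hc : 0 < c) (x : Fin N → ℝ) :
    ∑ k, Real.exp (c * x k - c * logSumExp c x) = 1 := by
  simp_rw [Real.exp_sub]
  rw [← Finset.sum_div, logSumExp, mul_inv_cancel_left₀ hc.ne', Real.exp_log (sum_exp_pos _),
    div_self (sum_exp_pos _).ne']

lemma isConvexCombiner_logSumExp (hc : 0 < c) :
    IsConvexCombiner (logSumExp c : (Fin N → ℝ) → ℝ) (c⁻¹ * Real.log N) where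
  convex := by
    refine ⟨convex_univ, fun x _ y _ a b ha hb hab => ?_⟩
    rw [logSumExp_le_iff hc, ← div_le_one (Real.exp_pos _), Finset.sum_div]
    -- after normalizing both sums to `1`, this is the convexity of the exponential
    calc _ ≤ ∑ k, (a * Real.exp (c * x k - c * logSumExp c x) +
          b * Real.exp (c * y k - c * logSumExp c y)) := Finset.sum_le_sum fun k _ => by
          have := convexOn_exp.2 (Set.mem_univ (c * x k - c * logSumExp c x))
            (Set.mem_univ (c * y k - c * logSumExp c y)) ha hb hab
          simp only [smul_eq_mul] at this
          rw [← Real.exp_sub]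
          refine le_trans (le_of_eq ?_) this
          simp only [Pi.add_apply, Pi.smul_apply, smul_eq_mul]
          congr 1; ring
      _ = 1 := by
          rw [Finset.sum_add_distrib, ← Finset.mul_sum, ← Finset.mul_sum, sum_exp_logSumExp hc,
            sum_exp_logSumExp hc]
          linarith
  add_const x t := by
    simp only [logSumExp, mul_add, Real.exp_add]
    rw [← Finset.sum_mul, Real.log_mul (sum_exp_pos _).ne' (Real.exp_pos _).ne', Real.log_exp,
      mul_add, inv_mul_cancel_left₀ hc.ne']
  bound x := by
    have hN : (0 : ℝ) < N := by exact_mod_cast Fin.pos_iff_nonempty.2 inferInstance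
    rw [abs_le]
    constructor
    · obtain ⟨k, hk⟩ := Finite.exists_max x
      have h1 : (⨆ k, x k) ≤ x k := ciSup_le hk
      have h2 : 0 ≤ c⁻¹ * Real.log N := by
        have : 0 ≤ Real.log N := Real.log_natCast_nonneg N
        positivity
      have h3 : x k ≤ logSumExp c x := by
        rw [logSumExp, le_inv_mul_iff₀ hc, Real.le_log_iff_exp_le (sum_exp_pos _)]
        exact Finset.single_le_sum (f := fun k => Real.exp (c * x k))
          (fun k _ => (Real.exp_pos _).le) (Finset.mem_univ k)
      linarith
    · rw [sub_le_iff_le_add, logSumExp_le_iff hc, mul_add, Real.exp_add,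
        mul_inv_cancel_left₀ hc.ne', Real.exp_log hN]
      refine (Finset.sum_le_card_nsmul Finset.univ _ (Real.exp (c * ⨆ k, x k))
        fun k _ => Real.exp_le_exp.2 (mul_le_mul_of_nonneg_left (le_iSup_coord x k) hc.le)).trans ?_
      simp

/-- At `x = m⁻¹ log a`, the extension of `c⁻¹ log ∑ exp (c x k)` with `c = 2m` is
`(2m)⁻¹ log ∑ a k ^ 2`. -/
lemma extendBot_logSumExp {m : ℕ} (hm : 1 ≤ m) {a : Fin N → ℝ} (ha : ∀ k, 0 ≤ a k) :
    extendBot (logSumExp (2 * m)) (fun k => ((m : ℝ)⁻¹ : ℝ) * elog (a k)) =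
      ((2 * m : ℝ)⁻¹ : ℝ) * elog (∑ k, a k ^ 2) := by
  have hm' : (0 : ℝ) < m := by positivity
  have hD : (0 : ℝ) < (2 * m : ℝ)⁻¹ := by positivity
  have hexp : ∀ t : ℝ, Real.exp (2 * m * t) = Real.exp (m * t) ^ 2 := fun t => by
    rw [← Real.exp_nat_mul]; congr 1; push_cast; ring
  have hlse : ∀ y : Fin N → ℝ, (logSumExp (2 * m) y : EReal) =
      ((2 * m : ℝ)⁻¹ : ℝ) * elog (∑ k, Real.exp (m * y k) ^ 2) := fun y => by
    simp_rw [← hexp]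
    rw [elog_of_pos (sum_exp_pos _), ← EReal.coe_mul, logSumExp]
  refine le_antisymm ?_ (le_extendBot fun y hy => ?_)
  · refine extendBot_le_of_continuous hm
      (G := fun a => ((2 * m : ℝ)⁻¹ : ℝ) * elog (∑ k, a k ^ 2)) ha ?_ fun a' ha' => ?_
    · refine (continuous_coe_mul hD).comp (continuous_elog.comp ?_)
      fun_prop
    · rw [hlse]
      refine le_of_eq ?_
      congr 2
      refine Finset.sum_congr rfl fun k _ => ?_
      rw [mul_inv_cancel_left₀ hm'.ne', Real.exp_log (ha' k)]
  · rw [hlse, coe_mul_le_coe_mul hD]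
    refine elog_mono (Finset.sum_le_sum fun k _ => pow_le_pow_left₀ (ha k) ?_ 2)
    rw [← elog_le_coe (ha k), EReal.coe_mul, ← coe_mul_le_coe_mul (inv_pos.2 hm'), ← mul_assoc,
      ← EReal.coe_mul, inv_mul_cancel₀ hm'.ne', EReal.coe_one, one_mul]
    exact hy k

end logSumExp

/-! ### Multiplicative functions on `ℂ` bounded by the hybrid norm -/

/-- A multiplicative function on `ℂ` bounded by the hybrid norm is a power `|·|^p`, `0 ≤ p ≤ 1`. -/
theorem eq_norm_rpow_of_le_hybNorm (u : ℂ →*₀ ℝ) (h0 : ∀ z, 0 ≤ u z)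
    (h : ∀ z, u z ≤ hybNorm z) :
    0 ≤ Real.log (u (Real.exp 1 : ℝ)) ∧ Real.log (u (Real.exp 1 : ℝ)) ≤ 1 ∧
      ∀ z ≠ 0, u z = ‖z‖ ^ Real.log (u (Real.exp 1 : ℝ)) := by
  have hpos : ∀ z ≠ 0, 0 < u z := fun z hz => (h0 z).lt_of_ne' ((map_ne_zero u).2 hz)
  have hexp : ∀ s : ℝ, ((Real.exp s : ℝ) : ℂ) ≠ 0 := fun s => by
    exact_mod_cast (Real.exp_pos s).ne'
  have hle : ∀ s : ℝ, Real.log (u (Real.exp s : ℝ)) ≤ max 0 s := fun s => by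
    rw [Real.log_le_iff_le_exp (hpos _ (hexp s))]
    refine (h _).trans ?_
    rw [hybNorm, if_neg (hexp s), Complex.norm_real, Real.norm_of_nonneg (Real.exp_pos s).le]
    refine max_le ?_ (Real.exp_le_exp.2 (le_max_right _ _))
    rw [← Real.exp_zero]
    exact Real.exp_le_exp.2 (le_max_left _ _)
  let g : ℝ →+ ℝ :=
    { toFun s := Real.log (u (Real.exp s : ℝ))
      map_zero' := by simp
      map_add' s t := by
        rw [Real.exp_add, Complex.ofReal_mul, map_mul,
          Real.log_mul (hpos _ (hexp s)).ne' (hpos _ (hexp t)).ne'] }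
  have hg : Continuous g := by
    refine AddMonoidHomClass.continuous_of_bound g 1 fun s => ?_
    rw [Real.norm_eq_abs, Real.norm_eq_abs, one_mul, abs_le]
    have h1 : g (-s) ≤ max 0 (-s) := hle (-s)
    have h2 : g s ≤ max 0 s := hle s
    rw [map_neg] at h1
    have h3 : max 0 (-s) ≤ |s| := max_le (abs_nonneg s) (neg_le_abs s)
    have h4 : max 0 s ≤ |s| := max_le (abs_nonneg s) (le_abs_self s)
    constructor <;> linarith
  have hlin : ∀ s : ℝ, Real.log (u (Real.exp s : ℝ)) = s * Real.log (u (Real.exp 1 : ℝ)) :=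
    fun s => by
      have := map_real_smul g hg s 1
      rw [smul_eq_mul, smul_eq_mul, mul_one] at this
      exact this
  refine ⟨?_, by simpa using hle 1, fun z hz => ?_⟩
  · have := hle (-1)
    rw [hlin] at this
    simp only [neg_mul, one_mul, max_eq_left (by norm_num : (-1 : ℝ) ≤ 0)] at this
    linarith
  · have hz' : 0 < ‖z‖ := norm_pos_iff.2 hz
    have hunit : ∀ w : ℂ, ‖w‖ = 1 → u w ≤ 1 := fun w hw => by
      refine (h w).trans ?_
      rw [hybNorm, if_neg (norm_ne_zero_iff.1 (by rw [hw]; norm_num)), hw, max_self]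
    have hw1 : ‖z / ‖z‖‖ = 1 := by simp [hz]
    have hw2 : ‖(z / ‖z‖)⁻¹‖ = 1 := by rw [norm_inv, hw1, inv_one]
    have hu : u (z / ‖z‖) = 1 := by
      refine le_antisymm (hunit _ hw1) ?_
      have h5 := hunit _ hw2
      rw [map_inv₀] at h5
      exact (inv_le_one₀ (hpos _ (norm_ne_zero_iff.1 (by rw [hw1]; norm_num)))).1 h5
    have hz1 : z = ((Real.exp (Real.log ‖z‖) : ℝ) : ℂ) * (z / ‖z‖) := by
      rw [Real.exp_log hz', mul_div_cancel₀]
      exact_mod_cast hz'.ne'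
    conv_lhs => rw [hz1]
    rw [map_mul, hu, mul_one, Real.rpow_def_of_pos hz', ← hlin, Real.exp_log (hpos _ (hexp _))]

/-! ### Absolute values of regular functions and of sections -/

section Sections

variable {A : Type} [CommRing A] {X : Scheme.{0}} {f : X ⟶ Spec (.of A)} {ν : RingNorm A}

lemma evaluation_res {V W : X.Opens} (h : W ≤ V) (x : X) (hx : x ∈ W) (s : Γ(X, V)) :
    X.evaluation W x hx (res h s) = X.evaluation V x (h hx) s := by
  simp only [Scheme.evaluation, CommRingCat.comp_apply, res]
  rw [X.presheaf.germ_res_apply]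

/-- The constant function with value `a : A` on an open `U`. -/
noncomputable def scalarSection (f : X ⟶ Spec (.of A)) (U : X.Opens) : A →+* Γ(X, U) :=
  ((Scheme.ΓSpecIso (.of A)).inv ≫ f.appTop ≫ X.presheaf.map (homOfLE le_top).op).hom

lemma evaluation_scalarSection (U : X.Opens) (x : X) (hx : x ∈ U) (a : A) :
    X.evaluation U x hx (scalarSection f U a) = scalarAt f x a :=
  evaluation_res le_top x hx _

lemma res_scalarSection {V W : X.Opens} (h : W ≤ V) (a : A) :
    res h (scalarSection f V a) = scalarSection f W a := by
  simp only [res, scalarSection, CommRingCat.hom_comp, RingHom.comp_apply]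
  rw [← CommRingCat.comp_apply, ← Functor.map_comp]
  rfl

lemma res_mul {V W : X.Opens} (h : W ≤ V) (a b : Γ(X, V)) : res h (a * b) = res h a * res h b :=
  map_mul _ _ _

lemma res_pow {V W : X.Opens} (h : W ≤ V) (a : Γ(X, V)) (n : ℕ) : res h (a ^ n) = res h a ^ n :=
  map_pow _ _ _

lemma res_prod {V W : X.Opens} (h : W ≤ V) {κ : Type*} (S : Finset κ) (a : κ → Γ(X, V)) :
    res h (∏ k ∈ S, a k) = ∏ k ∈ S, res h (a k) :=
  map_prod (X.presheaf.map (homOfLE h).op).hom _ _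

lemma res_one {V W : X.Opens} (h : W ≤ V) : res h (1 : Γ(X, V)) = 1 :=
  map_one (X.presheaf.map (homOfLE h).op).hom

namespace Analytification

variable (x : Analytification f ν) {U : X.Opens} (hx : x.pt ∈ U)

lemma absAt_nonneg (s : Γ(X, U)) : 0 ≤ x.absAt U hx s := x.abv.nonneg _

lemma absAt_mul (s t : Γ(X, U)) : x.absAt U hx (s * t) = x.absAt U hx s * x.absAt U hx t := by
  simp [absAt]

lemma absAt_one : x.absAt U hx 1 = 1 := by simp [absAt]

lemma absAt_pow (s : Γ(X, U)) (n : ℕ) : x.absAt U hx (s ^ n) = x.absAt U hx s ^ n := by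
  simp [absAt]

lemma absAt_prod {κ : Type*} (S : Finset κ) (a : κ → Γ(X, U)) :
    x.absAt U hx (∏ k ∈ S, a k) = ∏ k ∈ S, x.absAt U hx (a k) := by
  simp [absAt]

lemma absAt_res {W : X.Opens} (h : W ≤ U) (hW : x.pt ∈ W) (s : Γ(X, U)) :
    x.absAt W hW (res h s) = x.absAt U (h hW) s := by
  simp only [absAt, evaluation_res]

lemma absAt_scalarSection (a : A) :
    x.absAt U hx (scalarSection f U a) = x.abv (scalarAt f x.pt a) := by
  simp only [absAt, evaluation_scalarSection]

lemma absAt_eq_zero (s : Γ(X, U)) : x.absAt U hx s = 0 ↔ X.evaluation U x.pt hx s = 0 :=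
  x.abv.eq_zero

end Analytification

lemma continuous_absAt (U : X.Opens) (s : Γ(X, U)) :
    Continuous fun x : {x : Analytification f ν // x.pt ∈ U} => x.1.absAt U x.2 s := by
  rw [continuous_def]
  intro V hV
  have : IsOpen {x : Analytification f ν | ∃ hx : x.pt ∈ U, x.absAt U hx s ∈ V} :=
    TopologicalSpace.isOpen_generateFrom_of_mem ⟨U, s, V, hV, rfl⟩
  convert this.preimage continuous_subtype_val using 1
  ext x
  exact ⟨fun h => ⟨x.2, h⟩, fun ⟨_, h⟩ => h⟩

namespace LineBundle

variable {L : LineBundle X}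

lemma g_mul_g (L : LineBundle X) (i j : L.ι) :
    (res (W := L.U i ⊓ L.U j ⊓ L.U i) inf_le_left (L.g i j) *
      res (le_inf (inf_le_left.trans inf_le_right) inf_le_right) (L.g j i) :
        Γ(X, L.U i ⊓ L.U j ⊓ L.U i)) = 1 := by
  rw [L.cocycle, L.g_self, res_one]

lemma absAt_g_pos (x : Analytification f ν) (i j : L.ι) (hx : x.pt ∈ L.U i ⊓ L.U j) :
    0 < x.absAt _ hx (L.g i j) := by
  have hx' : x.pt ∈ L.U i ⊓ L.U j ⊓ L.U i := ⟨hx, hx.1⟩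
  have h := congrArg (x.absAt _ hx') (L.g_mul_g i j)
  rw [x.absAt_mul, x.absAt_res, x.absAt_one] at h
  exact (x.absAt_nonneg _ _).lt_of_ne' (left_ne_zero_of_mul (h.trans_ne one_ne_zero))

namespace Section

variable {m : ℕ} (s : L.Section m)

lemma absAt_compat (x : Analytification f ν) (i j : L.ι) (hij : x.pt ∈ L.U i ⊓ L.U j) :
    x.absAt _ hij.1 (s.coeff i) =
      x.absAt (L.U i ⊓ L.U j) hij (L.g i j) ^ m * x.absAt _ hij.2 (s.coeff j) := by
  have h := congrArg (x.absAt _ hij) (s.compat i j)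
  rwa [x.absAt_mul, x.absAt_res, x.absAt_res, x.absAt_pow] at h

lemma evaluation_compat (x : X) (i j : L.ι) (hi : x ∈ L.U i) (hj : x ∈ L.U j) :
    X.evaluation _ x hi (s.coeff i) =
      X.evaluation (L.U i ⊓ L.U j) x ⟨hi, hj⟩ (L.g i j) ^ m * X.evaluation _ x hj (s.coeff j) := by
  have hij : x ∈ L.U i ⊓ L.U j := ⟨hi, hj⟩
  have h := congrArg (X.evaluation _ x hij) (s.compat i j)
  rwa [map_mul, evaluation_res, evaluation_res, map_pow] at h

lemma not_vanishesAt_iff {x : X} {i : L.ι} (hi : x ∈ L.U i) :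
    ¬ s.VanishesAt x ↔ X.evaluation _ x hi (s.coeff i) ≠ 0 := by
  refine not_congr ⟨fun h => h i hi, fun h j hj => ?_⟩
  rw [s.evaluation_compat x j i hj hi, h, mul_zero]

lemma logAbs_ne_top (i : L.ι) (x : {x : Analytification f ν // x.pt ∈ L.U i}) :
    s.logAbs i x ≠ ⊤ := elog_ne_top _

lemma logAbs_ne_bot_iff (i : L.ι) (x : {x : Analytification f ν // x.pt ∈ L.U i}) :
    s.logAbs i x ≠ ⊥ ↔ ¬ s.VanishesAt x.1.pt := by
  rw [s.not_vanishesAt_iff x.2, LineBundle.Section.logAbs, Ne,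
    elog_eq_bot (x.1.absAt_nonneg _ _), x.1.absAt_eq_zero]

lemma continuous_logAbs (i : L.ι) :
    Continuous (s.logAbs i : {x : Analytification f ν // x.pt ∈ L.U i} → EReal) :=
  continuous_elog.comp (continuous_absAt _ _)

lemma isOpen_not_vanishesAt : IsOpen {x : X | ¬ s.VanishesAt x} := by
  have : {x : X | ¬ s.VanishesAt x} = ⋃ i, (X.basicOpen (s.coeff i) : Set X) := by
    ext x
    simp only [Set.mem_ofPred_eq, Set.mem_iUnion, VanishesAt, not_forall]
    constructor
    · rintro ⟨i, hx, h⟩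
      exact ⟨i, (X.evaluation_ne_zero_iff_mem_basicOpen x hx _).1 h⟩
    · rintro ⟨i, h⟩
      have hx := X.basicOpen_le _ h
      exact ⟨i, hx, (X.evaluation_ne_zero_iff_mem_basicOpen x hx _).2 h⟩
  rw [this]
  exact isOpen_iUnion fun i => (X.basicOpen (s.coeff i)).2

/-- The section `a ∏ (s k) ^ n k` of `D L`, for sections `s k` of `m L` and `D = m ∑ n k`. -/
noncomputable def monomial (f : X ⟶ Spec (.of A)) {N : ℕ} (s : Fin N → L.Section m) (a : A)
    (n : Fin N → ℕ) (D : ℕ) (hD : D = m * ∑ k, n k) : L.Section D where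
  coeff i := scalarSection f (L.U i) a * ∏ k, (s k).coeff i ^ n k
  compat i j := by
    simp only [res_mul, res_prod, res_pow, (s _).compat i j, res_scalarSection, mul_pow,
      Finset.prod_mul_distrib, ← pow_mul, Finset.prod_pow_eq_pow_sum, hD, Finset.mul_sum]
    ring

lemma absAt_monomial {N : ℕ} (s : Fin N → L.Section m) (a : A)
    (n : Fin N → ℕ) (D : ℕ) (hD : D = m * ∑ k, n k) (x : Analytification f ν) (i : L.ι)
    (hx : x.pt ∈ L.U i) : x.absAt _ hx ((monomial f s a n D hD).coeff i) =
      x.abv (scalarAt f x.pt a) * ∏ k, x.absAt _ hx ((s k).coeff i) ^ n k := by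
  simp only [monomial, x.absAt_mul, x.absAt_prod, x.absAt_pow, x.absAt_scalarSection]

/-- The power `s ^ e`, as a section of `D L` for `D = m e`. -/
noncomputable def power (e D : ℕ) (hD : D = m * e) : L.Section D where
  coeff i := s.coeff i ^ e
  compat i j := by rw [res_pow, res_pow, s.compat i j, mul_pow, ← pow_mul, hD]

lemma logAbs_power (e D : ℕ) (hD : D = m * e) (i : L.ι)
    (x : {x : Analytification f ν // x.pt ∈ L.U i}) :
    (s.power e D hD).logAbs i x = ((e : ℝ) : EReal) * s.logAbs i x := by
  simp only [logAbs, power, x.1.absAt_pow]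
  exact elog_pow (x.1.absAt_nonneg _ _) e

lemma not_vanishesAt_power {e D : ℕ} (hD : D = m * e) {x : X} (h : ¬ s.VanishesAt x) :
    ¬ (s.power e D hD).VanishesAt x := by
  obtain ⟨i, hi⟩ := L.cover x
  rw [not_vanishesAt_iff _ hi] at h ⊢
  simp only [power, map_pow]
  exact pow_ne_zero _ h

lemma not_vanishesAt_pullback {Y : Scheme.{0}} (p : Y ⟶ X) {y : Y} :
    ¬ (s.pullback p).VanishesAt y ↔ ¬ s.VanishesAt (p y) := by
  obtain ⟨i, hi⟩ := L.cover (p y)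
  rw [not_vanishesAt_iff s hi, not_vanishesAt_iff (s.pullback p) (i := i) hi]
  have := Scheme.evaluation_naturality_apply p y hi (s.coeff i)
  change Y.evaluation (p ⁻¹ᵁ L.U i) y hi (p.app (L.U i) (s.coeff i)) ≠ 0 ↔ _
  rw [← this, (map_ne_zero (p.residueFieldMap y).hom)]

end Section

lemma NoCommonZeros.pullback {κ : Type} {m : ℕ} {s : κ → L.Section m} (h : NoCommonZeros s)
    {Y : Scheme.{0}} (p : Y ⟶ X) : NoCommonZeros fun k => (s k).pullback p := fun y => by
  obtain ⟨k, hk⟩ := h (p y)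
  exact ⟨k, ((s k).not_vanishesAt_pullback p).2 hk⟩

/-- On a quasi-compact scheme, finitely many sections of some power of a semi-ample line bundle
have no common zeroes. -/
lemma IsSemiAmple.exists_noCommonZeros [CompactSpace X] (h : L.IsSemiAmple) :
    ∃ (d M : ℕ) (τ : Fin M → L.Section d), 1 ≤ d ∧ NoCommonZeros τ := by
  obtain ⟨d, hd, h⟩ := h
  obtain ⟨t, ht⟩ := isCompact_univ.elim_finite_subcover
    (fun s : L.Section d => {x : X | ¬ s.VanishesAt x}) (fun s => s.isOpen_not_vanishesAt)
    (fun x _ => by obtain ⟨s, hs⟩ := h x; exact Set.mem_iUnion.2 ⟨s, hs⟩)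
  refine ⟨d, t.card, fun k => (t.equivFin.symm k).1, hd, fun x => ?_⟩
  obtain ⟨s, hs⟩ := Set.mem_iUnion.1 (ht (Set.mem_univ x))
  obtain ⟨hst, hs⟩ := Set.mem_iUnion.1 hs
  refine ⟨t.equivFin ⟨s, hst⟩, ?_⟩
  simpa using hs

end LineBundle

end Sections

/-! ### Convex combinations of metrics over a base containing `ℂ` -/

lemma EReal_le_of_forall_pos_le_add {a b : EReal} (h : ∀ ε : ℝ, 0 < ε → a ≤ b + (ε : EReal)) :
    a ≤ b := by
  induction b with
  | bot => simpa using h 1 one_pos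
  | top => exact le_top
  | coe b =>
    refine EReal.le_of_forall_lt_iff_le.1 fun z hz => ?_
    have hz' : b < z := EReal.coe_lt_coe_iff.1 hz
    have := h (z - b) (by linarith)
    rwa [← EReal.coe_add, add_sub_cancel] at this

/-- A uniform limit of continuous extended-real-valued functions is continuous. -/
lemma continuous_of_uniform_approx {T : Type*} [TopologicalSpace T] {g : T → EReal}
    (h : ∀ ε : ℝ, 0 < ε → ∃ u : T → EReal, Continuous u ∧
      ∀ x, u x ≤ g x ∧ g x ≤ u x + (ε : EReal)) : Continuous g := by
  choose! u hu using h
  rw [continuous_iff_lower_upperSemicontinuous]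
  constructor
  · have : g = fun x => ⨆ ε : Set.Ioi (0 : ℝ), u ε x := by
      ext x
      refine le_antisymm ?_ (iSup_le fun ε => ((hu ε ε.2).2 x).1)
      refine EReal_le_of_forall_pos_le_add fun ε hε => (((hu ε hε).2 x).2).trans ?_
      exact add_le_add_left (le_iSup (fun ε : Set.Ioi (0 : ℝ) => u ε x) ⟨ε, hε⟩) _
    rw [this]
    exact lowerSemicontinuous_iSup fun ε => (hu ε ε.2).1.lowerSemicontinuous
  · have : g = fun x => ⨅ ε : Set.Ioi (0 : ℝ), (u ε x + ((ε : ℝ) : EReal)) := by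
      ext x
      refine le_antisymm (le_iInf fun ε => ((hu ε ε.2).2 x).2) ?_
      refine EReal_le_of_forall_pos_le_add fun ε hε => ?_
      refine (iInf_le (fun ε : Set.Ioi (0 : ℝ) => u ε x + ((ε : ℝ) : EReal)) ⟨ε, hε⟩).trans ?_
      exact add_le_add_left ((hu ε hε).2 x).1 _
    rw [this]
    exact upperSemicontinuous_iInf fun ε =>
      ((continuous_add_coe _).comp (hu ε ε.2).1).upperSemicontinuous

section Combined

variable {A : Type} [CommRing A] {X : Scheme.{0}} {f : X ⟶ Spec (.of A)} {ν : RingNorm A}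
  {L : LineBundle X}

/-- The exponent `p` such that the absolute value of a point restricts to `|·|^p` on `ℂ`, for a
base ring containing `ℂ` through `ι`. -/
noncomputable def exponentAt (ι : ℂ →+* A) (x : Analytification f ν) : ℝ :=
  Real.log (x.abv (scalarAt f x.pt (ι (Real.exp 1 : ℝ))))

/-- The absolute value of a point, restricted to `ℂ`. -/
noncomputable def abvOnComplex (ι : ℂ →+* A) (x : Analytification f ν) : ℂ →*₀ ℝ where
  toFun z := x.abv (scalarAt f x.pt (ι z))
  map_zero' := by simp
  map_one' := by simp
  map_mul' := by simp

section exponent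

variable {ι : ℂ →+* A} (hι : ∀ z, ν (ι z) ≤ hybNorm z) (x : Analytification f ν)
include hι

lemma exponentAt_spec : 0 ≤ exponentAt ι x ∧ exponentAt ι x ≤ 1 ∧
    ∀ z ≠ 0, x.abv (scalarAt f x.pt (ι z)) = ‖z‖ ^ exponentAt ι x :=
  eq_norm_rpow_of_le_hybNorm (abvOnComplex ι x) (fun _ => x.abv.nonneg _)
    fun z => (x.abv_le _).trans (hι z)

lemma abv_exp (c : ℝ) :
    x.abv (scalarAt f x.pt (ι (Real.exp c : ℝ))) = Real.exp (exponentAt ι x * c) := by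
  have h0 : ((Real.exp c : ℝ) : ℂ) ≠ 0 := by exact_mod_cast (Real.exp_pos c).ne'
  rw [(exponentAt_spec hι x).2.2 _ h0, Complex.norm_real, Real.norm_of_nonneg (Real.exp_pos c).le,
    ← Real.exp_mul, mul_comm]

end exponent

/-- The metric with value `χ_p(φ₁, …, φ_N)` at a point of exponent `p`, where
`φ_k = m⁻¹ log |s k|`. -/
noncomputable def combinedPotential (ι : ℂ →+* A) {N m : ℕ} (χ : (Fin N → ℝ) → ℝ)
    (s : Fin N → L.Section m) : Potential f ν L :=
  fun i x => extendBot (rescale χ (exponentAt ι x.1)) fun k =>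
    (((m : ℝ)⁻¹ : ℝ) : EReal) * (s k).logAbs i x

variable {ι : ℂ →+* A} (hι : ∀ z, ν (ι z) ≤ hybNorm z) {N m : ℕ} (hm : 1 ≤ m)
  {χ : (Fin N → ℝ) → ℝ} {C : ℝ} (hχ : IsConvexCombiner χ C) (s : Fin N → L.Section m)

include hι hm hχ

/-- The combined metric is uniformly approximated by finite maxima of normalized `log |σ|`, with
`σ` among the monomials in the `s k`. The constants of the affine functions approximating `χ` are
absorbed into coefficients `exp c ∈ ℂ`, so that they scale with the exponent as they should. -/
lemma combinedPotential_approx {ε : ℝ} (hε : 0 < ε) :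
    ∃ (D : ℕ) (J : Type) (_ : Finite J) (σ : J → L.Section D), 1 ≤ D ∧
      ∀ i x, (⨆ j, (((D : ℝ)⁻¹ : ℝ) : EReal) * (σ j).logAbs i x) ≤
          (combinedPotential ι χ s : Potential f ν L) i x ∧
        (combinedPotential ι χ s : Potential f ν L) i x ≤
          (⨆ j, (((D : ℝ)⁻¹ : ℝ) : EReal) * (σ j).logAbs i x) + (ε : EReal) := by
  obtain ⟨d, hd, c, h⟩ := hχ.exists_max_affine_approx_rescale hε
  have hfin : Finite {n : Fin N → ℕ // ∑ k, n k = d} := by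
    have : {n : Fin N → ℕ | ∑ k, n k = d} ⊆ Set.Iic fun _ => d := fun n hn k => by
      change n k ≤ d
      rw [← show ∑ k, n k = d from hn]
      exact Finset.single_le_sum (f := n) (fun _ _ => Nat.zero_le _) (Finset.mem_univ k)
    exact ((Set.finite_Iic _).subset this).to_subtype
  refine ⟨d * m, {n : Fin N → ℕ // ∑ k, n k = d}, hfin,
    fun n => LineBundle.Section.monomial f s (ι (Real.exp ((d * m : ℕ) * c n.1) : ℝ)) n.1 (d * m)
      (by rw [n.2, mul_comm]), Nat.mul_pos hd hm, fun i x => ?_⟩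
  obtain ⟨hp0, hp1, -⟩ := exponentAt_spec hι x.1
  have ha : ∀ k, 0 ≤ x.1.absAt (L.U i) x.2 ((s k).coeff i) := fun k => x.1.absAt_nonneg _ _
  obtain ⟨h1, h2⟩ := h _ hp0
  simp only [LineBundle.Section.logAbs, combinedPotential, LineBundle.Section.absAt_monomial,
    abv_exp hι]
  have e : ∀ n : Fin N → ℕ, exponentAt ι x.1 * ((d * m : ℕ) * c n) =
    (d * m : ℕ) * (exponentAt ι x.1 * c n) := fun n => by ring
  simp only [e]
  refine ⟨iSup_le fun n => monomial_le_extendBot hd hm (h1 n.1 n.2) ha, ?_⟩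
  refine extendBot_le_monomial hd hm (J := {n : Fin N → ℕ // ∑ k, n k = d}) (n := fun n => n.1)
    (b := fun n => exponentAt ι x.1 * c n.1) (fun y => ?_) ha
  obtain ⟨n, hn, hy⟩ := h2 y
  exact ⟨⟨n, hn⟩, hy.trans (add_le_add_right (mul_le_of_le_one_left hε.le hp1) _)⟩

lemma continuous_combinedPotential (i : L.ι) :
    Continuous ((combinedPotential ι χ s : Potential f ν L) i) := by
  refine continuous_of_uniform_approx fun ε hε => ?_
  obtain ⟨D, J, _, σ, hD, h⟩ := combinedPotential_approx (f := f) hι hm hχ s hε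
  exact ⟨_, continuous_finite_iSup fun j =>
    (continuous_coe_mul (by positivity)).comp ((σ j).continuous_logAbs i), h i⟩

omit hι hχ in
lemma combinedPotential_ne_top (i : L.ι) (x) :
    (combinedPotential ι χ s : Potential f ν L) i x ≠ ⊤ :=
  extendBot_ne_top _ fun k => coe_mul_ne_top (by positivity) ((s k).logAbs_ne_top i x)

lemma combinedPotential_ne_bot (i : L.ι) (x : {x : Analytification f ν // x.pt ∈ L.U i})
    (h : ∃ k, ¬ (s k).VanishesAt x.1.pt) :
    (combinedPotential ι χ s : Potential f ν L) i x ≠ ⊥ := by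
  obtain ⟨k, hk⟩ := h
  have h1 := hχ.le_extendBot_rescale (exponentAt_spec hι x.1).1
    (fun k => (((m : ℝ)⁻¹ : ℝ) : EReal) * (s k).logAbs i x) k
  refine ne_bot_of_le_ne_bot ?_ h1
  rw [Ne, EReal.add_eq_bot_iff, not_or]
  exact ⟨coe_mul_ne_bot (by positivity) (((s k).logAbs_ne_bot_iff i x).2 hk), EReal.coe_ne_bot _⟩

omit hι in
lemma isCompatible_combinedPotential :
    (combinedPotential ι χ s : Potential f ν L).IsCompatible := by
  intro i j x hi hj
  have hij : x.pt ∈ L.U i ⊓ L.U j := ⟨hi, hj⟩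
  have hm' : (0 : ℝ) < m := by positivity
  change _ = _ + elog (x.absAt (L.U i ⊓ L.U j) hij (L.g i j))
  rw [elog_of_pos (LineBundle.absAt_g_pos x i j hij)]
  simp only [combinedPotential]
  rw [← extendBot_add_const (fun y c => hχ.rescale_add_const _ y c)]
  congr 1
  ext k
  simp only [LineBundle.Section.logAbs]
  rw [(s k).absAt_compat x i j hij, elog_mul (pow_nonneg (x.absAt_nonneg _ _) _), add_comm,
    elog_pow (x.absAt_nonneg _ _), elog_of_pos (LineBundle.absAt_g_pos x i j hij), ← EReal.coe_mul,
    coe_mul_add (inv_pos.2 hm'), inv_mul_cancel_left₀ hm'.ne']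

omit hι hm hχ in
/-- Maxima over finite index types are tropical Fubini-Study metrics. -/
lemma isTropicalFS_of_finite {J : Type} [Finite J] {D : ℕ} (hD : 1 ≤ D) (σ : J → L.Section D)
    (a : J → ℝ) (hσ : LineBundle.NoCommonZeros σ) {φ : Potential f ν L}
    (h : ∀ i x, φ i x = (((D : ℝ)⁻¹ : ℝ) : EReal) * ⨆ j, ((σ j).logAbs i x + (a j : EReal))) :
    φ.IsTropicalFS := by
  obtain ⟨n, ⟨e⟩⟩ := Finite.exists_equiv_fin J
  refine ⟨D, n, σ ∘ e.symm, a ∘ e.symm, hD, fun x => ?_, fun i x => ?_⟩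
  · obtain ⟨k, hk⟩ := hσ x
    exact ⟨e k, by simpa using hk⟩
  · rw [h]
    congr 1
    exact (e.symm.iSup_comp (g := fun j => (σ j).logAbs i x + (a j : EReal))).symm

omit hι hm hχ in
/-- The maximum of a tropical Fubini-Study metric and of a normalized maximum of `log |σ j|`, where
the `σ j` may have common zeroes, is a tropical Fubini-Study metric, also after adding real
constants. -/
lemma isTropicalFS_max {J J' : Type} [Finite J] [Finite J'] {D E : ℕ} (hD : 1 ≤ D) (hE : 1 ≤ E)
    (σ : J → L.Section D) (τ : J' → L.Section E) (a b : ℝ) (hτ : LineBundle.NoCommonZeros τ) :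
    Potential.IsTropicalFS (f := f) (ν := ν) (L := L) fun i x =>
      max ((⨆ j, (((D : ℝ)⁻¹ : ℝ) : EReal) * (σ j).logAbs i x) + (a : EReal))
        ((⨆ j, (((E : ℝ)⁻¹ : ℝ) : EReal) * (τ j).logAbs i x) + (b : EReal)) := by
  have hDE : (0 : ℝ) < (((D * E : ℕ) : ℝ)⁻¹ : ℝ) := by
    have := Nat.mul_pos hD hE
    positivity
  have key : ∀ {P : ℕ} (e : ℕ) (hP : 1 ≤ P) (h : D * E = P * e) (y : EReal) (a : ℝ),
      (((P : ℝ)⁻¹ : ℝ) : EReal) * y + (a : EReal) = (((D * E : ℕ) : ℝ)⁻¹ : ℝ) *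
        (((e : ℝ) : EReal) * y + (((D * E : ℕ) * a : ℝ) : EReal)) := by
    intro P e hP h y a
    have hP' : (P : ℝ) ≠ 0 := by positivity
    have he : (e : ℝ) ≠ 0 := by
      rintro he
      rw [Nat.cast_eq_zero.1 he, mul_zero] at h
      exact (Nat.mul_pos hD hE).ne' h
    rw [coe_mul_add hDE, inv_mul_cancel_left₀ (inv_pos.1 hDE).ne', ← mul_assoc, ← EReal.coe_mul]
    congr 3
    rw [h]; push_cast; field_simp
  refine isTropicalFS_of_finite (J := J ⊕ J') (Nat.mul_pos hD hE)
    (Sum.elim (fun j => (σ j).power E (D * E) rfl) fun j => (τ j).power D (D * E) (mul_comm D E))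
    (Sum.elim (fun _ => (D * E : ℕ) * a) fun _ => (D * E : ℕ) * b) ?_ fun i x => ?_
  · intro x
    obtain ⟨j, hj⟩ := hτ x
    exact ⟨Sum.inr j, (τ j).not_vanishesAt_power (mul_comm D E) hj⟩
  · rw [coe_mul_iSup hDE, iSup_sum, iSup_add_coe, iSup_add_coe]
    simp only [Sum.elim_inl, Sum.elim_inr, LineBundle.Section.logAbs_power]
    simp only [key E hD rfl, key D hE (mul_comm D E)]

/-- The combined metric is the limit of a decreasing sequence of tropical Fubini-Study metrics:
with `u_ε` the approximants of `combinedPotential_approx` and `ψ` the tropical Fubini-Study metric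
of sections `τ` without common zeroes, the sequence `max (u_{2^-(n+1)} + 2^-n) (ψ - n)` is
decreasing. -/
lemma combinedPotential_exists_net {J' : Type} [Finite J'] {E : ℕ} (hE : 1 ≤ E)
    (τ : J' → L.Section E) (hτ : LineBundle.NoCommonZeros τ) :
    ∃ (J : Type) (_ : Preorder J) (_ : Nonempty J) (_ : IsDirectedOrder J)
    (ψ : J → Potential f ν L), (∀ j, (ψ j).IsTropicalFS) ∧
      (∀ j k, j ≤ k → ∀ i x, ψ k i x ≤ ψ j i x) ∧
      ∀ i x, Tendsto (fun j => ψ j i x) atTop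
        (𝓝 ((combinedPotential ι χ s : Potential f ν L) i x)) := by
  choose D J hJ σ hD hσ using fun n : ℕ =>
    combinedPotential_approx (f := f) hι hm hχ s (ε := (1 / 2) ^ (n + 1)) (by positivity)
  set φ : Potential f ν L := combinedPotential ι χ s with hφ
  set u : ℕ → Potential f ν L := fun n i x =>
    (⨆ j, (((D n : ℝ)⁻¹ : ℝ) : EReal) * (σ n j).logAbs i x) with hu
  set ψ : Potential f ν L := fun i x => (⨆ j, (((E : ℝ)⁻¹ : ℝ) : EReal) * (τ j).logAbs i x) with hψ
  have hlow : ∀ n i x, φ i x ≤ u n i x + (((1 / 2) ^ n : ℝ) : EReal) := fun n i x => by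
    refine ((hσ n i x).2).trans (add_le_add_right ?_ _)
    rw [EReal.coe_le_coe_iff]
    exact pow_le_pow_of_le_one (by norm_num) (by norm_num) (Nat.le_succ n)
  refine ⟨ℕ, inferInstance, inferInstance, inferInstance, fun n i x =>
    max (u n i x + (((1 / 2) ^ n : ℝ) : EReal)) (ψ i x + ((-n : ℝ) : EReal)), fun n => ?_, ?_, ?_⟩
  · have := hJ n
    exact isTropicalFS_max (hD n) hE (σ n) τ _ _ hτ
  · intro j k hjk i x
    refine (antitone_nat_of_succ_le fun n => ?_ : Antitone fun n : ℕ =>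
      max (u n i x + (((1 / 2) ^ n : ℝ) : EReal)) (ψ i x + ((-n : ℝ) : EReal))) hjk
    refine max_le_max ?_ (add_le_add_right ?_ _)
    · calc u (n + 1) i x + (((1 / 2) ^ (n + 1) : ℝ) : EReal)
          ≤ φ i x + (((1 / 2) ^ (n + 1) : ℝ) : EReal) := add_le_add_left (hσ (n + 1) i x).1 _
        _ ≤ u n i x + (((1 / 2) ^ (n + 1) : ℝ) : EReal) + (((1 / 2) ^ (n + 1) : ℝ) : EReal) :=
          add_le_add_left (hσ n i x).2 _
        _ = u n i x + (((1 / 2) ^ n : ℝ) : EReal) := by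
          rw [add_assoc, ← EReal.coe_add]
          congr 2
          rw [pow_succ]; ring
    · rw [EReal.coe_le_coe_iff]; push_cast; linarith
  · intro i x
    have h1 : Tendsto (fun n : ℕ => u n i x + (((1 / 2) ^ n : ℝ) : EReal)) atTop
        (𝓝 (φ i x)) := by
      have h0 : Tendsto (fun n : ℕ => φ i x + (((1 / 2) ^ n : ℝ) : EReal)) atTop
          (𝓝 (φ i x)) := by
        have ht : Tendsto (fun n : ℕ => (((1 / 2) ^ n : ℝ) : EReal)) atTop (𝓝 ((0 : ℝ) : EReal)) :=
          EReal.tendsto_coe.2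
            (tendsto_pow_atTop_nhds_zero_of_lt_one (by norm_num) (by norm_num))
        have := (EReal.continuousAt_add (p := (φ i x, ((0 : ℝ) : EReal)))
          (Or.inr (EReal.coe_ne_bot _)) (Or.inr (EReal.coe_ne_top _))).tendsto.comp
          (tendsto_const_nhds.prodMk_nhds ht)
        simpa [Function.comp_def] using this
      exact tendsto_of_tendsto_of_tendsto_of_le_of_le tendsto_const_nhds h0
        (fun n => hlow n i x) fun n => add_le_add_left (hσ n i x).1 _
    have h2 : Tendsto (fun n : ℕ => ψ i x + ((-n : ℝ) : EReal)) atTop (𝓝 ⊥) := by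
      have ht : Tendsto (fun n : ℕ => ((-n : ℝ) : EReal)) atTop (𝓝 ⊥) :=
        EReal.tendsto_coe_atBot.comp
          (tendsto_neg_atTop_atBot.comp tendsto_natCast_atTop_atTop)
      have hψ' : ψ i x ≠ ⊤ := by
        rw [hψ]
        rcases isEmpty_or_nonempty J' with hJ' | hJ'
        · simp
        · obtain ⟨j, hj⟩ := exists_eq_ciSup_of_finite
            (f := fun j => (((E : ℝ)⁻¹ : ℝ) : EReal) * (τ j).logAbs i x)
          change (⨆ j, (((E : ℝ)⁻¹ : ℝ) : EReal) * (τ j).logAbs i x) ≠ ⊤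
          rw [← hj]
          exact coe_mul_ne_top (by positivity) ((τ j).logAbs_ne_top i x)
      have := (EReal.continuousAt_add (p := (ψ i x, (⊥ : EReal)))
          (Or.inl hψ') (Or.inr bot_ne_top)).tendsto.comp
          (tendsto_const_nhds.prodMk_nhds ht)
      simpa [Function.comp_def] using this
    simpa using h1.max h2

lemma isContinuousMetric_combinedPotential (hs : LineBundle.NoCommonZeros s) :
    (combinedPotential ι χ s : Potential f ν L).IsContinuousMetric where
  compat := isCompatible_combinedPotential hm hχ s
  ne_top := combinedPotential_ne_top hm s
  ne_bot i x := combinedPotential_ne_bot hι hm hχ s i x (hs _)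
  continuous := continuous_combinedPotential hι hm hχ s

/-- The combined metric is psh as soon as there are enough points of the analytification outside
the common zeroes of the `s k`. -/
lemma isPSH_combinedPotential {J' : Type} [Finite J'] {E : ℕ} (hE : 1 ≤ E)
    (τ : J' → L.Section E) (hτ : LineBundle.NoCommonZeros τ)
    (hV : ∀ V : X.Opens, (V : Set X).Nonempty →
      ∃ x : Analytification f ν, x.pt ∈ V ∧ ∃ k, ¬ (s k).VanishesAt x.pt)
    (hb : ∀ b : BerkovichSpectrum ν, b.IsZariskiDense →
      ∃ x : Analytification f ν, x.toSpectrum = b ∧ ∃ k, ¬ (s k).VanishesAt x.pt) :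
    (combinedPotential ι χ s : Potential f ν L).IsPSH where
  singular :=
    { compat := isCompatible_combinedPotential hm hχ s
      ne_top := combinedPotential_ne_top hm s
      usc := fun i => (continuous_combinedPotential hι hm hχ s i).upperSemicontinuous
      not_bot := fun i V hVU hne => by
        obtain ⟨x, hx, h⟩ := hV V hne
        exact ⟨⟨x, hVU hx⟩, hx, combinedPotential_ne_bot hι hm hχ s i _ h⟩ }
  exists_net := combinedPotential_exists_net hι hm hχ s hE τ hτ
  not_bot b hb' := by
    obtain ⟨x, hx, h⟩ := hb b hb'
    obtain ⟨i, hi⟩ := L.cover x.pt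
    exact ⟨i, ⟨x, hi⟩, hx, combinedPotential_ne_bot hι hm hχ s i _ h⟩

end Combined

/-! ### Points of analytifications over fields with an absolute value -/

section FieldPoints

variable {A B : Type} [CommRing A] [CommRing B] {X : Scheme.{0}} {f : X ⟶ Spec (.of A)}

lemma fromSpecResidueField_comp (f : X ⟶ Spec (.of A)) (x : X) :
    X.fromSpecResidueField x ≫ f = Spec.map (CommRingCat.ofHom (scalarAt f x)) := by
  have hf : f = X.toSpecΓ ≫ Spec.map f.appTop ≫ Spec.map (Scheme.ΓSpecIso (.of A)).inv := by
    rw [← Scheme.toSpecΓ_naturality_assoc, toSpecΓ_SpecMap_ΓSpecIso_inv, Category.comp_id]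
  conv_lhs => rw [hf]
  rw [Scheme.fromSpecResidueField, Category.assoc, Scheme.fromSpecStalk_toSpecΓ_assoc,
    ← Spec.map_comp, ← Spec.map_comp, ← Spec.map_comp]
  rfl

/-- A point of `X` with values in a field `F` with an absolute value `w` gives a point of the
analytification of `X`. -/
lemma exists_point_of_field {F : Type} [Field F] (w : AbsoluteValue F ℝ) {ν : RingNorm A}
    (g : Spec (.of F) ⟶ X) (θ : A →+* F) (hg : g ≫ f = Spec.map (CommRingCat.ofHom θ))
    (hθ : ∀ a, w (θ a) ≤ ν a) :
    ∃ z : Analytification f ν, z.pt = g (IsLocalRing.closedPoint F) ∧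
      ∀ a, z.abv (scalarAt f z.pt a) = w (θ a) := by
  obtain ⟨y, hy, h, hh⟩ : ∃ y, y = g (IsLocalRing.closedPoint F) ∧
      ∃ h : X.residueField y ⟶ .of F, Spec.map h ≫ X.fromSpecResidueField y = g :=
    ⟨_, rfl, _, Scheme.descResidueField_stalkClosedPointTo_fromSpecResidueField F X g⟩
  have key : (CommRingCat.ofHom (scalarAt f y) ≫ h) = CommRingCat.ofHom θ := by
    rw [← Spec.map_inj, ← hg, Spec.map_comp, ← fromSpecResidueField_comp, ← Category.assoc, hh]
  have key' : ∀ a, h.hom (scalarAt f y a) = θ a := fun a => ConcreteCategory.congr_hom key a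
  refine ⟨⟨y, w.comp h.hom.injective, fun a => ?_⟩, hy, fun a => ?_⟩
  · change w (h.hom (scalarAt f y a)) ≤ _
    rw [key']; exact hθ a
  · change w (h.hom (scalarAt f y a)) = _
    rw [key']

/-- A point `x` of `X^an` comes from a point of `(X_B)^an` if the homomorphism `A → κ(x)` extends to
a bounded homomorphism from `B` to an extension of the valued field `κ(x)` (up to rescaling). -/
lemma exists_down_eq {ν : RingNorm A} {μ : RingNorm B} {ψ : A →+* B} {c : ℝ} (h0 : 0 < c)
    (h1 : c ≤ 1) (hb : ∀ a, μ (ψ a) ^ c ≤ ν a) (x : Analytification f ν) {F : Type} [Field F]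
    (w : AbsoluteValue F ℝ) (j : X.residueField x.pt →+* F) (θ : B →+* F)
    (hθ : ∀ a, θ (ψ a) = j (scalarAt f x.pt a)) (hw : ∀ a, w (j a) ^ c = x.abv a)
    (hμ : ∀ b, w (θ b) ≤ μ b) :
    ∃ z : Analytification (baseChangeStr f ψ) μ, z.down ψ c h0 h1 hb = x := by
  obtain ⟨x, v, hv⟩ := x
  dsimp only at j hθ hw
  have comm : (Spec.map (CommRingCat.ofHom j) ≫ X.fromSpecResidueField x) ≫ f =
      Spec.map (CommRingCat.ofHom θ) ≫ Spec.map (CommRingCat.ofHom ψ) := by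
    rw [Category.assoc, fromSpecResidueField_comp, ← Spec.map_comp, ← Spec.map_comp]
    congr 1
    ext a
    exact (hθ a).symm
  let g : Spec (.of F) ⟶ baseChange f ψ := Limits.pullback.lift _ _ comm
  have hg1 : g ≫ baseChangeProj f ψ = Spec.map (CommRingCat.ofHom j) ≫ X.fromSpecResidueField x :=
    Limits.pullback.lift_fst _ _ _
  have hg2 : g ≫ baseChangeStr f ψ = Spec.map (CommRingCat.ofHom θ) :=
    Limits.pullback.lift_snd _ _ _
  obtain ⟨y, h, hh⟩ : ∃ (y : baseChange f ψ) (h : (baseChange f ψ).residueField y ⟶ .of F),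
      Spec.map h ≫ (baseChange f ψ).fromSpecResidueField y = g :=
    ⟨_, _, Scheme.descResidueField_stalkClosedPointTo_fromSpecResidueField F _ g⟩
  have key : (CommRingCat.ofHom (scalarAt (baseChangeStr f ψ) y) ≫ h) = CommRingCat.ofHom θ := by
    rw [← Spec.map_inj, ← hg2, Spec.map_comp, ← fromSpecResidueField_comp, ← Category.assoc, hh]
  have key' : ∀ a, h.hom (scalarAt (baseChangeStr f ψ) y a) = θ a :=
    fun a => ConcreteCategory.congr_hom key a
  have hsig : (⟨baseChangeProj f ψ y, (baseChangeProj f ψ).residueFieldMap y ≫ h⟩ :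
      Σ x, X.residueField x ⟶ .of F) = ⟨x, CommRingCat.ofHom j⟩ := by
    apply (Scheme.SpecToEquivOfField F X).symm.injective
    simp only [Scheme.SpecToEquivOfField_symm_apply]
    rw [Spec.map_comp, Category.assoc, Scheme.Hom.SpecMap_residueFieldMap_fromSpecResidueField,
      ← Category.assoc, hh]
    exact hg1
  refine ⟨⟨y, w.comp h.hom.injective, fun b => ?_⟩, ?_⟩
  · change w (h.hom (scalarAt _ y b)) ≤ _
    rw [key']; exact hμ b
  · obtain ⟨rfl, h2⟩ := Sigma.mk.inj hsig
    have h3 := eq_of_heq h2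
    have h4 : ∀ a, h.hom (((baseChangeProj f ψ).residueFieldMap y).hom a) = j a :=
      fun a => ConcreteCategory.congr_hom h3 a
    simp only [Analytification.down]
    congr 1
    ext a
    change w (h.hom (((baseChangeProj f ψ).residueFieldMap y).hom a)) ^ c = v a
    rw [h4, hw]

end FieldPoints

/-! ### Absolute values extending a power of the usual absolute value of `ℂ` -/

section ArchimedeanAbs

/-- Subexponential factors in an inequality between powers can be removed. -/
lemma le_of_pow_le_mul_pow {a b C : ℝ} (hb : 0 ≤ b)
    (h : ∀ n : ℕ, a ^ n ≤ C * (n + 1) * b ^ n) : a ≤ b := by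
  by_contra! hab
  rcases hb.eq_or_lt with rfl | hb
  · have := h 1
    simp only [pow_one, mul_zero] at this
    linarith
  · have hc : 1 < a / b := (one_lt_div hb).2 hab
    have h2 := tendsto_pow_const_div_const_pow_of_one_lt 1 hc
    have h3 := tendsto_pow_const_div_const_pow_of_one_lt 0 hc
    have h4 := (h2.add h3).const_mul C
    simp only [pow_one, pow_zero, add_zero, mul_zero, ← add_div, mul_div_assoc'] at h4
    obtain ⟨n, hn⟩ := (h4.eventually (gt_mem_nhds one_pos)).exists
    rw [div_lt_one (by positivity), div_pow, lt_div_iff₀ (by positivity)] at hn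
    exact hn.not_ge (h n)

/-- If an absolute value `v` restricts to `|·|^p` on `ℂ`, then `v^(1/p)` is an absolute value. The
triangle inequality follows by estimating the terms of the binomial expansion of `(x + y)^n`, since
the number of terms is subexponential. -/
noncomputable def rootAbv {F : Type*} [CommRing F] [Nontrivial F] (v : AbsoluteValue F ℝ)
    (γ : ℂ →+* F) {p : ℝ} (hp : 0 < p) (hγ : ∀ z ≠ 0, v (γ z) = ‖z‖ ^ p) : AbsoluteValue F ℝ where
  toFun a := v a ^ p⁻¹
  map_mul' a b := by rw [map_mul, Real.mul_rpow (v.nonneg a) (v.nonneg b)]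
  nonneg' a := Real.rpow_nonneg (v.nonneg a) _
  eq_zero' a := by
    rw [Real.rpow_eq_zero (v.nonneg a) (inv_pos.2 hp).ne']; exact v.eq_zero
  add_le' x y := by
    have hx := Real.rpow_nonneg (v.nonneg x) p⁻¹
    have hy := Real.rpow_nonneg (v.nonneg y) p⁻¹
    have hxy := Real.rpow_nonneg (v.nonneg (x + y)) p⁻¹
    rw [← Real.rpow_le_rpow_iff hxy (add_nonneg hx hy) hp]
    refine le_of_pow_le_mul_pow (C := 1) (by positivity) fun n => ?_
    have hcomm : ∀ {a : ℝ}, 0 ≤ a → (a ^ p) ^ n = (a ^ n) ^ p := fun ha => by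
      rw [← Real.rpow_natCast, ← Real.rpow_mul ha, mul_comm, Real.rpow_mul ha, Real.rpow_natCast]
    rw [hcomm hxy, hcomm (add_nonneg hx hy), one_mul]
    set S := v x ^ p⁻¹ + v y ^ p⁻¹ with hS
    have hroot : ∀ z : F, (v z ^ p⁻¹) ^ p = v z := fun z => Real.rpow_inv_rpow (v.nonneg z) hp.ne'
    have e1 : ((v (x + y) ^ p⁻¹) ^ n) ^ p = v ((x + y) ^ n) := by
      rw [map_pow, ← hcomm hxy, hroot]
    rw [e1, add_pow]
    refine (v.sum_le _ _).trans ?_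
    refine (Finset.sum_le_card_nsmul _ _ ((S ^ n) ^ p) fun k hk => ?_).trans_eq ?_
    · have hkn : k ≤ n := Nat.lt_succ_iff.1 (Finset.mem_range.1 hk)
      have e2 : v ((n.choose k : ℕ) : F) = ((n.choose k : ℕ) : ℝ) ^ p := by
        have h0 : ((n.choose k : ℕ) : ℂ) ≠ 0 := by exact_mod_cast (Nat.choose_pos hkn).ne'
        have := hγ _ h0
        rwa [map_natCast, Complex.norm_natCast] at this
      have e3 : v (x ^ k * y ^ (n - k) * (n.choose k : ℕ)) =
          ((v x ^ p⁻¹) ^ k * (v y ^ p⁻¹) ^ (n - k) * (n.choose k : ℕ)) ^ p := by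
        rw [Real.mul_rpow (by positivity) (by positivity),
          Real.mul_rpow (by positivity) (by positivity), map_mul, map_mul, map_pow, map_pow, e2]
        congr 2
        · rw [← Real.rpow_natCast, ← Real.rpow_natCast, ← Real.rpow_mul hx, mul_comm (k : ℝ),
            Real.rpow_mul hx, hroot]
        · rw [← Real.rpow_natCast, ← Real.rpow_natCast, ← Real.rpow_mul hy,
            mul_comm ((n - k : ℕ) : ℝ), Real.rpow_mul hy, hroot]
      rw [e3]
      refine Real.rpow_le_rpow (by positivity) ?_ hp.le
      rw [hS, add_pow]
      exact Finset.single_le_sum (f := fun k => (v x ^ p⁻¹) ^ k * (v y ^ p⁻¹) ^ (n - k) *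
        ((n.choose k : ℕ) : ℝ)) (fun k _ => by positivity) hk
    · simp

/-- By the Gelfand-Mazur theorem, a ring with an absolute value extending a positive power of the
usual absolute value of `ℂ` is equal to `ℂ`. -/
lemma surjective_of_archimedean {F : Type*} [CommRing F] [Nontrivial F] (v : AbsoluteValue F ℝ)
    (γ : ℂ →+* F) {p : ℝ} (hp : 0 < p) (hγ : ∀ z ≠ 0, v (γ z) = ‖z‖ ^ p) :
    Function.Surjective γ := by
  set w := rootAbv v γ hp hγ with hw
  have hwγ : ∀ z, w (γ z) = ‖z‖ := fun z => by
    change v (γ z) ^ p⁻¹ = _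
    by_cases hz : z = 0
    · simp [hz, Real.zero_rpow (inv_pos.2 hp).ne']
    · rw [hγ z hz, Real.rpow_rpow_inv (norm_nonneg z) hp.ne']
  let δ : ℂ →+* WithAbs w := (WithAbs.equiv w).symm.toRingHom.comp γ
  let _ : Algebra ℂ (WithAbs w) := δ.toAlgebra
  let _ : NormedAlgebra ℂ (WithAbs w) :=
    { δ.toAlgebra with
      norm_smul_le := fun z x => by
        rw [Algebra.smul_def]
        change w (γ z * x.ofAbs) ≤ _
        rw [map_mul]
        exact (congrArg (· * w x.ofAbs) (hwγ z)).le }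
  have : NormMulClass (WithAbs w) := ⟨fun x y => map_mul w _ _⟩
  have : NormOneClass (WithAbs w) := ⟨map_one w⟩
  intro x
  obtain ⟨z, hz⟩ := NormedAlgebra.Complex.exists_norm_sub_smul_one_eq_zero (WithAbs.toAbs w x)
  refine ⟨z, ?_⟩
  have h1 : w (x - γ z) = 0 := hz
  exact (sub_eq_zero.1 (w.eq_zero.1 h1)).symm

end ArchimedeanAbs

/-! ### The hybrid ring and its Berkovich spectrum -/

section HybridRing

variable {r : Radius}

lemma summable_hybTerm_single (r : Radius) (n : ℤ) (z : ℂ) :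
    Summable (hybTerm r (HahnSeries.single n z)) := by
  refine summable_of_ne_finset_zero (s := {n}) fun k hk => ?_
  simp [hybTerm, HahnSeries.coeff_single_of_ne (by simpa using hk)]

/-- The Laurent monomial `z tⁿ`, as an element of the hybrid ring. -/
noncomputable def laurentMonomial (r : Radius) (n : ℤ) (z : ℂ) : hybridRing r :=
  ⟨HahnSeries.single n z, summable_hybTerm_single r n z⟩

/-- The constants `ℂ → A_r`. -/
noncomputable def constHom (r : Radius) : ℂ →+* hybridRing r :=
  RingHom.codRestrict (HahnSeries.C : ℂ →+* LaurentSeries ℂ) (hybridRing r)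
    fun z => summable_hybTerm_single r 0 z

lemma constHom_eq (z : ℂ) : constHom r z = laurentMonomial r 0 z := rfl

lemma laurentMonomial_mul (n k : ℤ) (z w : ℂ) :
    laurentMonomial r n z * laurentMonomial r k w = laurentMonomial r (n + k) (z * w) :=
  Subtype.ext HahnSeries.single_mul_single

lemma hybridRingNorm_laurentMonomial (n : ℤ) (z : ℂ) :
    hybridRingNorm r (laurentMonomial r n z) = hybNorm z * (r : ℝ) ^ n := by
  change ∑' k, hybTerm r (HahnSeries.single n z) k = _
  rw [tsum_eq_single n]
  · simp [hybTerm]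
  · intro k hk
    simp [hybTerm, HahnSeries.coeff_single_of_ne hk]

lemma hybridRingNorm_constHom (z : ℂ) : hybridRingNorm r (constHom r z) = hybNorm z := by
  rw [constHom_eq, hybridRingNorm_laurentMonomial, zpow_zero, mul_one]

open Classical in
lemma coeff_sum_laurentMonomial (s : Finset ℤ) (f : LaurentSeries ℂ) (k : ℤ) :
    ((∑ n ∈ s, laurentMonomial r n (f.coeff n) : hybridRing r) : LaurentSeries ℂ).coeff k =
      if k ∈ s then f.coeff k else 0 := by
  rw [AddSubmonoidClass.coe_finsetSum, HahnSeries.coeff_sum]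
  change ∑ n ∈ s, (HahnSeries.single n (f.coeff n)).coeff k = _
  split_ifs with h
  · rw [Finset.sum_eq_single_of_mem k h fun n _ hn => HahnSeries.coeff_single_of_ne hn.symm]
    exact HahnSeries.coeff_single_same _ _
  · exact Finset.sum_eq_zero fun n hn =>
      HahnSeries.coeff_single_of_ne fun e => h (e ▸ hn)

/-- Laurent polynomials are dense in the hybrid ring. -/
lemma exists_truncation (f : hybridRing r) {ε : ℝ} (hε : 0 < ε) :
    ∃ s : Finset ℤ, hybridRingNorm r
      (f - ∑ n ∈ s, laurentMonomial r n ((f : LaurentSeries ℂ).coeff n)) < ε := by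
  classical
  obtain ⟨s, hs⟩ := ((f.2.hasSum).eventually (lt_mem_nhds
    (show (∑' n, hybTerm r f n) - ε < ∑' n, hybTerm r f n by linarith))).exists
  refine ⟨s, ?_⟩
  have e : ∀ k, hybTerm r ((f - ∑ n ∈ s, laurentMonomial r n ((f : LaurentSeries ℂ).coeff n) :
      hybridRing r) : LaurentSeries ℂ) k = hybTerm r f k - if k ∈ s then hybTerm r f k else 0 := by
    intro k
    have h1 : (((f - ∑ n ∈ s, laurentMonomial r n ((f : LaurentSeries ℂ).coeff n) :
        hybridRing r) : LaurentSeries ℂ)).coeff k =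
        (f : LaurentSeries ℂ).coeff k - if k ∈ s then (f : LaurentSeries ℂ).coeff k else 0 := by
      rw [AddSubgroupClass.coe_sub, HahnSeries.coeff_sub, coeff_sum_laurentMonomial]
    rw [hybTerm, h1]
    split_ifs <;> simp [hybTerm]
  change ∑' k, hybTerm r ((f - ∑ n ∈ s, laurentMonomial r n ((f : LaurentSeries ℂ).coeff n) :
      hybridRing r) : LaurentSeries ℂ) k < ε
  simp only [e]
  have hs' : HasSum (fun k => if k ∈ s then hybTerm r f k else 0) (∑ k ∈ s, hybTerm r f k) := by
    have := hasSum_sum_of_ne_finset_zero (s := s) (L := .unconditional ℤ)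
      (f := fun k => if k ∈ s then hybTerm r f k else 0)
      (fun k hk => by simp [hk])
    rwa [Finset.sum_congr rfl fun k hk => if_pos hk] at this
  rw [(f.2.hasSum.sub hs').tsum_eq]
  linarith

/-- Bounded homomorphisms from the hybrid ring to a field with an absolute value are determined by
their values on the constants and on `t`. -/
lemma hybridRing_hom_ext {F : Type*} [Field F] (v : AbsoluteValue F ℝ) {α β : hybridRing r →+* F}
    (hα : ∀ f, v (α f) ≤ hybridRingNorm r f) (hβ : ∀ f, v (β f) ≤ hybridRingNorm r f)
    (hc : ∀ z, α (constHom r z) = β (constHom r z))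
    (ht : α (laurentMonomial r 1 1) = β (laurentMonomial r 1 1)) : α = β := by
  have hnat : ∀ n : ℕ, laurentMonomial r n 1 = laurentMonomial r 1 1 ^ n := fun n => by
    induction n with
    | zero => rfl
    | succ n ih => rw [pow_succ, ← ih, laurentMonomial_mul]; simp
  have hpow : ∀ n : ℕ, α (laurentMonomial r n 1) = β (laurentMonomial r n 1) := fun n => by
    rw [hnat, map_pow, map_pow, ht]
  have hneg : ∀ n : ℕ, α (laurentMonomial r (-n) 1) = β (laurentMonomial r (-n) 1) := fun n => by
    have h1 : laurentMonomial r (-n) 1 * laurentMonomial r n 1 = 1 := by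
      rw [laurentMonomial_mul]; simp; rfl
    have h2 := congrArg α h1
    have h3 := congrArg β h1
    rw [map_mul, map_one] at h2 h3
    rw [eq_inv_of_mul_eq_one_left h2, eq_inv_of_mul_eq_one_left h3, hpow]
  have hmono : ∀ (n : ℤ) (z : ℂ), α (laurentMonomial r n z) = β (laurentMonomial r n z) :=
    fun n z => by
      have h1 : laurentMonomial r n z = constHom r z * laurentMonomial r n 1 := by
        rw [constHom_eq, laurentMonomial_mul, zero_add, mul_one]
      rw [h1, map_mul, map_mul, hc]
      obtain ⟨k, rfl | rfl⟩ := n.eq_nat_or_neg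
      · rw [hpow]
      · rw [hneg]
  ext f
  rw [← sub_eq_zero, ← v.eq_zero]
  refine le_antisymm (le_of_forall_pos_le_add fun ε hε => ?_) (v.nonneg _)
  obtain ⟨s, hs⟩ := exists_truncation f (half_pos hε)
  set P := ∑ n ∈ s, laurentMonomial r n ((f : LaurentSeries ℂ).coeff n)
  have hP : α P = β P := by simp only [P, map_sum, hmono]
  have h1 : α f - β f = α (f - P) - β (f - P) := by rw [map_sub, map_sub, hP]; ring
  rw [h1]
  have h2 := v.sub_le_add (α (f - P)) (β (f - P))
  linarith [hα (f - P), hβ (f - P)]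

/-- The geometric series `∑_{n ≥ m} rⁿ`. -/
lemma hasSum_zpow_ge (r : Radius) (m : ℤ) :
    HasSum (fun n : ℤ => if m ≤ n then (r : ℝ) ^ n else 0)
      ((r : ℝ) ^ m * (1 - (r : ℝ))⁻¹) := by
  have hinj : Function.Injective fun k : ℕ => m + (k : ℤ) := fun a b h => by simpa using h
  rw [← hinj.hasSum_iff]
  · have := (hasSum_geometric_of_lt_one r.pos.le r.lt_one).mul_left ((r : ℝ) ^ m)
    have e : ((fun n : ℤ => if m ≤ n then (r : ℝ) ^ n else 0) ∘ fun k : ℕ => m + (k : ℤ)) =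
        fun k : ℕ => (r : ℝ) ^ m * (r : ℝ) ^ k := by
      ext k
      simp [zpow_add₀ r.pos.ne']
    rwa [e]
  · intro n hn
    rw [if_neg]
    intro h
    exact hn ⟨(n - m).toNat, by simp; omega⟩

lemma tadicNorm_of_ne_zero {f : LaurentSeries ℂ} (hf : f ≠ 0) :
    tadicNorm r f = (r : ℝ) ^ f.order := if_neg hf

lemma tadicNorm_mul (f g : LaurentSeries ℂ) :
    tadicNorm r (f * g) = tadicNorm r f * tadicNorm r g := by
  by_cases hf : f = 0
  · simp [hf]
  by_cases hg : g = 0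
  · simp [hg]
  rw [tadicNorm_of_ne_zero hf, tadicNorm_of_ne_zero hg, tadicNorm_of_ne_zero (mul_ne_zero hf hg),
    HahnSeries.order_mul hf hg, zpow_add₀ r.pos.ne']

/-- The `t`-adic absolute value of `ℂ((t))`. -/
noncomputable def tadicAbv (r : Radius) : AbsoluteValue (LaurentSeries ℂ) ℝ where
  toFun := tadicNorm r
  map_mul' := tadicNorm_mul
  nonneg' f := apply_nonneg (tadicNorm r) f
  eq_zero' _ := map_eq_zero_iff_eq_zero (tadicNorm r)
  add_le' := map_add_le_add (tadicNorm r)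

lemma tadicNorm_pow (f : LaurentSeries ℂ) (n : ℕ) : tadicNorm r (f ^ n) = tadicNorm r f ^ n :=
  map_pow (tadicAbv r) f n

section trivial

variable (b : MulRingSeminorm (hybridRing r)) (hb : ∀ f, b f ≤ hybridRingNorm r f)
include hb

/-- Both `t` and its inverse attain their norms, so the upper bounds are equalities. -/
lemma seminorm_t (n : ℤ) : b (laurentMonomial r n 1) = (r : ℝ) ^ n := by
  have h : ∀ n : ℤ, b (laurentMonomial r n 1) ≤ (r : ℝ) ^ n := fun n => by
    refine (hb _).trans_eq ?_
    rw [hybridRingNorm_laurentMonomial]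
    simp [hybNorm]
  refine le_antisymm (h n) ?_
  have h1 : laurentMonomial r n 1 * laurentMonomial r (-n) 1 = 1 := by
    rw [laurentMonomial_mul]; simp; rfl
  have h2 := congrArg b h1
  rw [map_mul, map_one] at h2
  have h3 := h (-n)
  have h4 : (r : ℝ) ^ n * (r : ℝ) ^ (-n) = 1 := by rw [← zpow_add₀ r.pos.ne']; simp
  have h5 : 0 < (r : ℝ) ^ n := zpow_pos r.pos n
  have h6 := mul_le_mul_of_nonneg_left h3 (apply_nonneg b (laurentMonomial r n 1))
  rw [h2] at h6
  have h7 : 0 < (r : ℝ) ^ (-n) := zpow_pos r.pos _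
  by_contra! hlt
  have := mul_lt_mul_of_pos_right hlt h7
  linarith

variable (hc : ∀ z ≠ 0, b (constHom r z) = 1)
include hc

lemma seminorm_laurentMonomial (n : ℤ) {z : ℂ} (hz : z ≠ 0) :
    b (laurentMonomial r n z) = (r : ℝ) ^ n := by
  have h1 : laurentMonomial r n z = constHom r z * laurentMonomial r n 1 := by
    rw [constHom_eq, laurentMonomial_mul, zero_add, mul_one]
  rw [h1, map_mul, hc z hz, one_mul, seminorm_t b hb]

lemma seminorm_le_of_coeff_eq_zero (f : hybridRing r) (m : ℤ)
    (hf : ∀ n < m, (f : LaurentSeries ℂ).coeff n = 0) :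
    b f ≤ (r : ℝ) ^ m * (1 - (r : ℝ))⁻¹ := by
  refine le_of_forall_pos_le_add fun ε hε => ?_
  obtain ⟨s, hs⟩ := exists_truncation f hε
  set P := ∑ n ∈ s, laurentMonomial r n ((f : LaurentSeries ℂ).coeff n) with hP
  have h1 : b f ≤ b (f - P) + b P := by
    have := map_add_le_add b (f - P) P
    rwa [sub_add_cancel] at this
  have h2 : b P ≤ (r : ℝ) ^ m * (1 - (r : ℝ))⁻¹ := by
    have h3 : b P ≤ ∑ n ∈ s, b (laurentMonomial r n ((f : LaurentSeries ℂ).coeff n)) :=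
      Finset.le_sum_of_subadditive b (map_zero b).le (map_add_le_add b) s _
    have hnn : ∀ n : ℤ, (0 : ℝ) ≤ if m ≤ n then (r : ℝ) ^ n else 0 := fun n => by
      split_ifs
      · exact (zpow_pos r.pos n).le
      · exact le_rfl
    refine h3.trans ((Finset.sum_le_sum fun n _ => ?_).trans
      (sum_le_hasSum s (fun n _ => hnn n) (hasSum_zpow_ge r m)))
    by_cases h0 : (f : LaurentSeries ℂ).coeff n = 0
    · have : laurentMonomial r n ((f : LaurentSeries ℂ).coeff n) = 0 := by
        rw [h0]; exact Subtype.ext (HahnSeries.single_eq_zero)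
      rw [this, map_zero]
      exact hnn n
    · rw [seminorm_laurentMonomial b hb hc n h0, if_pos]
      by_contra! hlt
      exact h0 (hf n hlt)
  linarith [hb (f - P)]

/-- A bounded multiplicative seminorm on the hybrid ring which is trivial on `ℂ` is the `t`-adic
absolute value. Both inequalities are first proved up to a constant factor, which is removed by
applying them to the powers of an element. -/
theorem seminorm_eq_tadicNorm (f : hybridRing r) : b f = tadicNorm r f := by
  have h1r : 0 < 1 - (r : ℝ) := by linarith [r.lt_one]
  have hle : ∀ f : hybridRing r, b f ≤ (1 - (r : ℝ))⁻¹ * tadicNorm r f := fun f => by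
    by_cases hf : (f : LaurentSeries ℂ) = 0
    · have : f = 0 := Subtype.ext hf
      simp [this]
    · rw [tadicNorm_of_ne_zero hf, mul_comm]
      exact seminorm_le_of_coeff_eq_zero b hb hc f _
        fun n hn => HahnSeries.coeff_eq_zero_of_lt_order hn
  have hle' : ∀ f : hybridRing r, b f ≤ tadicNorm r f := fun f => by
    refine le_of_pow_le_mul_pow (C := (1 - (r : ℝ))⁻¹) (apply_nonneg _ _) fun n => ?_
    rw [← map_pow b, ← tadicNorm_pow]
    refine (hle (f ^ n)).trans ?_
    have h0 : 0 ≤ tadicNorm r ((f : LaurentSeries ℂ) ^ n) := apply_nonneg _ _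
    have h2 : (1 - (r : ℝ))⁻¹ ≤ (1 - (r : ℝ))⁻¹ * (n + 1) :=
      le_mul_of_one_le_right (inv_pos.2 h1r).le (by linarith [(Nat.cast_nonneg n : (0 : ℝ) ≤ n)])
    exact mul_le_mul_of_nonneg_right h2 h0
  have hge : ∀ f : hybridRing r, tadicNorm r f ≤ (1 - (r : ℝ))⁻¹ * b f := fun f => by
    by_cases hf : (f : LaurentSeries ℂ) = 0
    · have : f = 0 := Subtype.ext hf
      simp [this]
    set n := (f : LaurentSeries ℂ).order with hn
    have hz : (f : LaurentSeries ℂ).coeff n ≠ 0 := HahnSeries.coeff_order_eq_zero.not.2 hf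
    set g := f - laurentMonomial r n ((f : LaurentSeries ℂ).coeff n) with hg
    have hgc : ∀ k < n + 1, (g : LaurentSeries ℂ).coeff k = 0 := fun k hk => by
      have e : (g : LaurentSeries ℂ) = f -
          HahnSeries.single n ((f : LaurentSeries ℂ).coeff n) := rfl
      rw [e, HahnSeries.coeff_sub]
      rcases (Int.lt_add_one_iff.1 hk).eq_or_lt with rfl | hlt
      · simp
      · rw [HahnSeries.coeff_single_of_ne hlt.ne, HahnSeries.coeff_eq_zero_of_lt_order hlt,
          sub_zero]
    have hg' : b g ≤ (r : ℝ) ^ (n + 1) := by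
      refine (hle' g).trans ?_
      by_cases hg0 : (g : LaurentSeries ℂ) = 0
      · rw [hg0, map_zero]; exact (zpow_pos r.pos _).le
      · rw [tadicNorm_of_ne_zero hg0]
        refine zpow_le_zpow_right_of_le_one₀ r.pos r.lt_one.le ?_
        by_contra! hlt
        exact HahnSeries.coeff_order_eq_zero.not.2 hg0 (hgc _ hlt)
    have h3 : b (f - g) ≤ b f + b g := map_sub_le_add b f g
    have h4 : f - g = laurentMonomial r n ((f : LaurentSeries ℂ).coeff n) := by
      rw [hg]; abel
    rw [h4, seminorm_laurentMonomial b hb hc n hz] at h3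
    rw [zpow_add_one₀ r.pos.ne'] at hg'
    rw [tadicNorm_of_ne_zero hf, ← hn, le_inv_mul_iff₀ h1r]
    linarith
  refine le_antisymm (hle' f) ?_
  refine le_of_pow_le_mul_pow (C := (1 - (r : ℝ))⁻¹) (apply_nonneg _ _) fun n => ?_
  rw [← tadicNorm_pow, ← map_pow b]
  refine (hge (f ^ n)).trans ?_
  have h0 : 0 ≤ b (f ^ n) := apply_nonneg _ _
  have h2 : (1 - (r : ℝ))⁻¹ ≤ (1 - (r : ℝ))⁻¹ * (n + 1) :=
    le_mul_of_one_le_right (inv_pos.2 h1r).le (by linarith [(Nat.cast_nonneg n : (0 : ℝ) ≤ n)])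
  exact mul_le_mul_of_nonneg_right h2 h0

end trivial

end HybridRing

/-! ### Fibres of the hybrid space -/

section HybridFibres

variable {r : Radius} {X : Scheme.{0}} {f : X ⟶ Spec (.of (hybridRing r))}

lemma evalHom_laurentMonomial (t : PuncturedDisk r) (n : ℤ) (z : ℂ) :
    evalHom t (laurentMonomial r n z) = z * t.1 ^ n := by
  change ∑' k : ℤ, (HahnSeries.single n z).coeff k * t.1 ^ k = _
  rw [tsum_eq_single n]
  · simp
  · intro k hk
    simp [HahnSeries.coeff_single_of_ne hk]

lemma evalHom_constHom (t : PuncturedDisk r) (z : ℂ) : evalHom t (constHom r z) = z := by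
  rw [constHom_eq, evalHom_laurentMonomial, zpow_zero, mul_one]

/-- A point of the hybrid space at which constants have the absolute value `|·|^p` with `p > 0` lies
on a complex fibre: the scalars of its residue field are complex numbers, so that `t` is mapped to
a complex number, and boundedness shows that this is the fibre containing the point. -/
theorem exists_fibreEmb_eq (x : Analytification f (hybridRingNorm r))
    (hp : 0 < exponentAt (constHom r) x) : ∃ t z, fibreEmb t z = x := by
  obtain ⟨-, hp1, hγ⟩ := exponentAt_spec (fun z => (hybridRingNorm_constHom z).le) x
  set p := exponentAt (constHom r) x
  let γ := (scalarAt f x.pt).comp (constHom r)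
  replace hγ : ∀ z ≠ 0, x.abv (γ z) = ‖z‖ ^ p := hγ
  have hγ' : ∀ z, x.abv (γ z) = ‖z‖ ^ p := fun z => by
    by_cases hz : z = 0
    · simp [hz, Real.zero_rpow hp.ne']
    · exact hγ z hz
  obtain ⟨t₀, ht₀⟩ :=
    surjective_of_archimedean x.abv γ hp hγ (scalarAt f x.pt (laurentMonomial r 1 1))
  have hT : x.abv (γ t₀) = r := by
    rw [ht₀]
    exact (seminorm_t x.toSpectrum.seminorm x.toSpectrum.le_norm 1).trans (zpow_one _)
  have h0 : t₀ ≠ 0 := by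
    rintro rfl
    rw [map_zero, map_zero] at hT
    exact r.pos.ne hT
  have hn : 0 < ‖t₀‖ := norm_pos_iff.2 h0
  have hlog : p * Real.log ‖t₀‖ = Real.log r := by
    rw [← Real.log_rpow hn, ← hγ', hT]
  have hr := PuncturedDisk.log_radius_neg r
  have hneg : Real.log ‖t₀‖ < 0 := by
    by_contra! h
    nlinarith
  have hle : ‖t₀‖ ≤ r := (Real.log_le_log_iff hn r.pos).1 (by nlinarith)
  let t : PuncturedDisk r := ⟨t₀, h0, hle⟩
  have hexp : t.exponent = p := by
    rw [PuncturedDisk.exponent, div_eq_iff hneg.ne, hlog]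
  have key : γ.comp (evalHom t) = scalarAt f x.pt := by
    refine hybridRing_hom_ext x.abv (fun a => ?_) x.abv_le (fun z => ?_) ?_
    · refine (hγ' _).trans_le ?_
      rw [← hexp]
      exact norm_evalHom_rpow_le t a
    · exact congrArg γ (evalHom_constHom t z)
    · rw [RingHom.comp_apply, evalHom_laurentMonomial, one_mul, zpow_one]
      exact ht₀
  refine ⟨t, exists_down_eq t.exponent_pos t.exponent_le_one (norm_evalHom_rpow_le t) x
    (rootAbv x.abv γ hp hγ) (RingHom.id _) γ (fun a => DFunLike.congr_fun key a)
    (fun a => ?_) (fun z => ?_)⟩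
  · rw [hexp]
    exact Real.rpow_inv_rpow (x.abv.nonneg a) hp.ne'
  · change x.abv (γ z) ^ p⁻¹ ≤ ‖z‖
    rw [hγ', Real.rpow_rpow_inv (norm_nonneg z) hp.ne']

/-- The hybrid ring is dense in `ℂ((t))`. -/
lemma exists_tadicNorm_sub_lt (f : LaurentSeries ℂ) {ε : ℝ} (hε : 0 < ε) :
    ∃ g : hybridRing r, tadicNorm r (f - g) < ε := by
  obtain ⟨N, hN⟩ := exists_pow_lt_of_lt_one hε r.lt_one
  let P : hybridRing r := ∑ n ∈ Finset.Ico f.order N, laurentMonomial r n (f.coeff n)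
  refine ⟨P, ?_⟩
  have hc : ∀ k < (N : ℤ), (f - (P : LaurentSeries ℂ)).coeff k = 0 := fun k hk => by
    rw [HahnSeries.coeff_sub, coeff_sum_laurentMonomial]
    split_ifs with h
    · exact sub_self _
    · rw [sub_zero]
      refine HahnSeries.coeff_eq_zero_of_lt_order ?_
      by_contra! hlt
      exact h (Finset.mem_Ico.2 ⟨hlt, hk⟩)
  refine lt_of_le_of_lt ?_ hN
  by_cases h0 : f - (P : LaurentSeries ℂ) = 0
  · rw [h0, map_zero]; exact (pow_pos r.pos _).le
  · rw [tadicNorm_of_ne_zero h0, ← zpow_natCast]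
    refine zpow_le_zpow_right_of_le_one₀ r.pos r.lt_one.le ?_
    by_contra! hlt
    exact HahnSeries.coeff_order_eq_zero.not.2 h0 (hc _ hlt)

/-- Isometric homomorphisms to a complete ring extend from a dense subring. -/
lemma exists_isometric_extension {R K E : Type*} [NormedRing R] [NormedRing K] [NormedRing E]
    [CompleteSpace E] (i : R →+* K) (g : R →+* E) (hi : ∀ a, ‖i a‖ = ‖a‖) (hg : ∀ a, ‖g a‖ = ‖a‖)
    (hd : DenseRange i) : ∃ Θ : K →+* E, (∀ a, Θ (i a) = g a) ∧ ∀ x, ‖Θ x‖ = ‖x‖ := by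
  have hi' : Isometry i := AddMonoidHomClass.isometry_of_norm i hi
  have hg' : Isometry g := AddMonoidHomClass.isometry_of_norm g hg
  let Θ := IsDenseInducing.extendRingHom hi'.isUniformInducing hd hg'.uniformContinuous
  have hΘ : ∀ a, Θ (i a) = g a := fun a =>
    (hi'.isUniformInducing.isDenseInducing hd).extend_eq hg'.continuous a
  have hΘc : Continuous Θ :=
    (uniformContinuous_uniformly_extend hi'.isUniformInducing hd hg'.uniformContinuous).continuous
  refine ⟨Θ, hΘ, fun x => ?_⟩
  refine congrFun (hd.equalizer hΘc.norm continuous_norm (funext fun a => ?_)) x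
  change ‖Θ (i a)‖ = ‖i a‖
  rw [hΘ, hi, hg]

/-- A homomorphism from the hybrid ring to a complete valued field which induces the `t`-adic
absolute value extends to `ℂ((t))`. -/
lemma exists_extension_of_tadic {E : Type*} [NormedField E] [CompleteSpace E]
    (θ : hybridRing r →+* E) (hθ : ∀ a, ‖θ a‖ = tadicNorm r a) :
    ∃ Θ : LaurentSeries ℂ →+* E, (∀ a : hybridRing r, Θ a = θ a) ∧
      ∀ f, ‖Θ f‖ = tadicNorm r f := by
  let v : AbsoluteValue (hybridRing r) ℝ := (tadicAbv r).comp (f := (hybridRing r).subtype)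
    Subtype.val_injective
  let _ : NormedRing (hybridRing r) := v.toNormedRing
  let _ : NormedField (LaurentSeries ℂ) := (tadicAbv r).toNormedField
  refine exists_isometric_extension (hybridRing r).subtype θ (fun _ => rfl) hθ ?_
  rw [Metric.denseRange_iff]
  intro x ε hε
  obtain ⟨a, ha⟩ := exists_tadicNorm_sub_lt (r := r) x hε
  exact ⟨a, by rw [dist_eq_norm]; exact ha⟩

/-- A point of the hybrid space at which constants have trivial absolute value lies on the
non-archimedean fibre. -/
theorem exists_genericEmb_eq (x : Analytification f (hybridRingNorm r))
    (hp : exponentAt (constHom r) x = 0) : ∃ z, genericEmb z = x := by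
  obtain ⟨-, -, hγ⟩ := exponentAt_spec (fun z => (hybridRingNorm_constHom z).le) x
  rw [hp] at hγ
  let j : X.residueField x.pt →+* x.abv.Completion :=
    (UniformSpace.Completion.coeRingHom (α := WithAbs x.abv)).comp
      (WithAbs.equiv x.abv).symm.toRingHom
  have hj : ∀ a, ‖j a‖ = x.abv a := fun a => UniformSpace.Completion.norm_coe _
  obtain ⟨Θ, h1, h2⟩ := exists_extension_of_tadic (j.comp (scalarAt f x.pt)) fun a => by
    refine (hj _).trans ?_
    exact seminorm_eq_tadicNorm x.toSpectrum.seminorm x.toSpectrum.le_norm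
      (fun z hz => (hγ z hz).trans (Real.rpow_zero _)) a
  exact exists_down_eq one_pos le_rfl _ x (NormedField.toAbsoluteValue x.abv.Completion) j Θ
    h1 (fun a => (Real.rpow_one _).trans (hj a)) (fun b => (h2 b).le)

lemma fibre_cases (x : Analytification f (hybridRingNorm r)) :
    (∃ t z, fibreEmb t z = x) ∨ ∃ z, genericEmb z = x := by
  have h := (exponentAt_spec (fun z => (hybridRingNorm_constHom (r := r) z).le) x).1
  rcases h.eq_or_lt with h | h
  · exact .inr (exists_genericEmb_eq x h.symm)
  · exact .inl (exists_fibreEmb_eq x h)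

end HybridFibres

/-! ### Geometric points of the fibres -/

section GeometricPoints

/-- Schemes of finite type over algebraically closed fields have rational points in every non-empty
open subset, because their closed points are dense. -/
lemma exists_rational_point_mem {Ω : Type} [Field Ω] [IsAlgClosed Ω] {Y : Scheme.{0}}
    (g : Y ⟶ Spec (.of Ω)) [LocallyOfFiniteType g] (V : Y.Opens) (hV : (V : Set Y).Nonempty) :
    ∃ p : Spec (.of Ω) ⟶ Y, p ≫ g = 𝟙 _ ∧ p (IsLocalRing.closedPoint Ω) ∈ V := by
  have := LocallyOfFiniteType.jacobsonSpace g
  obtain ⟨y, hyV, hy⟩ := nonempty_inter_closedPoints hV V.isOpen.isLocallyClosed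
  exact ⟨pointOfClosedPoint g y hy, pointOfClosedPoint_comp g y hy, 
    (pointOfClosedPoint_apply g y hy _).symm ▸ hyV⟩

/-- A non-empty open subset of a smooth scheme over a domain `A` has geometric points over the
generic point of `A`, because its image in `Spec A` is open. -/
lemma exists_geometric_point_mem {A : Type} [CommRing A] [IsDomain A] {X : Scheme.{0}}
    (f : X ⟶ Spec (.of A)) [Smooth f] (V : X.Opens) (hV : (V : Set X).Nonempty)
    {Ω : Type} [Field Ω] [IsAlgClosed Ω] (θ : A →+* Ω) (hθ : Function.Injective θ) :
    ∃ p : Spec (.of Ω) ⟶ X, p ≫ f = Spec.map (CommRingCat.ofHom θ) ∧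
      p (IsLocalRing.closedPoint Ω) ∈ V := by
  have hopen : IsOpen (f '' V) := f.isOpenMap _ V.isOpen
  let η : PrimeSpectrum A := ⊥
  have hη : η ∈ f '' V := by
    obtain ⟨s, hs⟩ := hV.image f
    have hsp : η ⤳ (show PrimeSpectrum A from s) := (PrimeSpectrum.le_iff_specializes _ _).1 bot_le
    exact hsp.mem_open hopen hs
  obtain ⟨x, hxV, hx⟩ := hη
  have hpt : Spec.map (CommRingCat.ofHom θ) (IsLocalRing.closedPoint Ω) = η := by
    refine PrimeSpectrum.ext ?_
    change Ideal.comap θ (IsLocalRing.maximalIdeal Ω) = ⊥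
    rw [IsLocalRing.maximalIdeal_eq_bot]
    exact (RingHom.injective_iff_ker_eq_bot θ).1 hθ
  obtain ⟨y, hy, -⟩ := Scheme.Pullback.exists_preimage_pullback x _ (hx.trans hpt.symm)
  obtain ⟨p, hp, hpV⟩ := exists_rational_point_mem (baseChangeStr f θ) (baseChangeProj f θ ⁻¹ᵁ V)
    ⟨y, by change baseChangeProj f θ y ∈ V; rw [hy]; exact hxV⟩
  refine ⟨p ≫ baseChangeProj f θ, ?_, hpV⟩
  rw [Category.assoc, Limits.pullback.condition, reassoc_of% hp]

/-- A non-trivial non-archimedean absolute value extends to an algebraically closed field, namely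
the algebraic closure of the completion, by means of the spectral norm. -/
lemma exists_algClosed_extension (K : Type) [NormedField K] (h1 : ∃ x : K, x ≠ 0 ∧ ‖x‖ ≠ 1)
    (hnat : ∀ n : ℕ, ‖(n : K)‖ ≤ 1) :
    ∃ (Ω : Type) (_ : Field Ω) (_ : IsAlgClosed Ω) (w : AbsoluteValue Ω ℝ) (θ : K →+* Ω),
      ∀ x, w (θ x) = ‖x‖ := by
  let E := UniformSpace.Completion K
  obtain ⟨x, hx0, hx1⟩ := h1
  let _ : NontriviallyNormedField E := .ofNormNeOne ⟨(x : E),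
    norm_ne_zero_iff.1 (by rwa [UniformSpace.Completion.norm_coe, norm_ne_zero_iff]),
    by rwa [UniformSpace.Completion.norm_coe]⟩
  have : IsUltrametricDist E :=
    IsUltrametricDist.isUltrametricDist_of_forall_norm_natCast_le_one fun n => by
      have e : ((n : K) : E) = n := map_natCast (UniformSpace.Completion.coeRingHom (α := K)) n
      rw [← e]
      exact (UniformSpace.Completion.norm_coe _).trans_le (hnat n)
  let N := spectralMulAlgNorm E (AlgebraicClosure E)
  let w : AbsoluteValue (AlgebraicClosure E) ℝ :=
    { toFun := N
      map_mul' := map_mul N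
      nonneg' := apply_nonneg N
      eq_zero' := fun _ => map_eq_zero_iff_eq_zero N
      add_le' := map_add_le_add N }
  exact ⟨AlgebraicClosure E, _, inferInstance, w,
    (algebraMap E _).comp UniformSpace.Completion.coeRingHom,
    fun y => (spectralNorm_extends (L := AlgebraicClosure E) (y : E)).trans
      (UniformSpace.Completion.norm_coe y)⟩

lemma tadicNorm_natCast_le_one (r : Radius) (n : ℕ) : tadicNorm r (n : LaurentSeries ℂ) ≤ 1 := by
  by_cases h : (n : LaurentSeries ℂ) = 0
  · rw [h, map_zero]; exact zero_le_one
  · rw [tadicNorm_of_ne_zero h]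
    have hn : (n : ℂ) ≠ 0 := fun h0 => h (by
      rw [← map_natCast (HahnSeries.C : ℂ →+* LaurentSeries ℂ) n, h0, map_zero])
    have e : (n : LaurentSeries ℂ) = HahnSeries.single 0 (n : ℂ) :=
      (map_natCast (HahnSeries.C : ℂ →+* LaurentSeries ℂ) n).symm
    rw [e, HahnSeries.order_single hn, zpow_zero]

lemma exists_tadic_algClosed_extension (r : Radius) :
    ∃ (Ω : Type) (_ : Field Ω) (_ : IsAlgClosed Ω) (w : AbsoluteValue Ω ℝ)
      (θ : LaurentSeries ℂ →+* Ω), ∀ f, w (θ f) = tadicNorm r f := by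
  let _ : NormedField (LaurentSeries ℂ) := (tadicAbv r).toNormedField
  refine exists_algClosed_extension (LaurentSeries ℂ) ⟨HahnSeries.single 1 1,
    HahnSeries.single_ne_zero one_ne_zero, ?_⟩ (tadicNorm_natCast_le_one r)
  change tadicNorm r (HahnSeries.single 1 1) ≠ 1
  rw [tadicNorm_of_ne_zero (HahnSeries.single_ne_zero one_ne_zero),
    HahnSeries.order_single one_ne_zero, zpow_one]
  exact r.lt_one.ne

/-- Every non-empty Zariski open subset of `X` contains points of the hybrid space over the `t`-adic
absolute value. -/
theorem exists_tadic_point_mem {r : Radius} {X : Scheme.{0}} (f : X ⟶ Spec (.of (hybridRing r)))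
    [Smooth f] (V : X.Opens) (hV : (V : Set X).Nonempty) :
    ∃ x : Analytification f (hybridRingNorm r), x.pt ∈ V ∧
      ∀ a, x.toSpectrum.seminorm a = tadicNorm r a := by
  obtain ⟨Ω, _, _, w, θ, hw⟩ := exists_tadic_algClosed_extension r
  obtain ⟨p, hp, hpV⟩ := exists_geometric_point_mem f V hV (θ.comp (hybridRing r).subtype)
    (θ.injective.comp Subtype.val_injective)
  obtain ⟨z, hz, hzw⟩ := exists_point_of_field w p _ hp (ν := hybridRingNorm r)
    fun a => (hw _).trans_le (tadicNorm_le r a)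
  exact ⟨z, hz ▸ hpV, fun a => (hzw a).trans (hw _)⟩

/-- The only Zariski-dense point of the Berkovich spectrum of the hybrid ring is the `t`-adic
absolute value: the points on complex fibres are not Zariski-dense, since `t` is equal to a constant
there. -/
lemma BerkovichSpectrum.IsZariskiDense.eq_tadicNorm {r : Radius}
    {b : BerkovichSpectrum (hybridRingNorm r)} (hb : b.IsZariskiDense) (a : hybridRing r) :
    b.seminorm a = tadicNorm r a := by
  let v : AbsoluteValue (hybridRing r) ℝ :=
    { toFun := b.seminorm
      map_mul' := map_mul b.seminorm
      nonneg' := apply_nonneg b.seminorm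
      eq_zero' := fun a => ⟨hb a, fun h => by rw [h, map_zero]⟩
      add_le' := map_add_le_add b.seminorm }
  let u : ℂ →*₀ ℝ :=
    { toFun := fun z => v (constHom r z)
      map_zero' := by rw [map_zero, map_zero]
      map_one' := by rw [map_one, map_one]
      map_mul' := fun z w => by rw [map_mul, map_mul] }
  obtain ⟨h0, -, hp⟩ := eq_norm_rpow_of_le_hybNorm u (fun z => v.nonneg _)
    fun z => (b.le_norm _).trans_eq (hybridRingNorm_constHom z)
  rcases h0.eq_or_lt with h0 | h0
  · rw [← h0] at hp
    exact seminorm_eq_tadicNorm b.seminorm b.le_norm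
      (fun z hz => (hp z hz).trans (Real.rpow_zero _)) a
  · obtain ⟨z, hz⟩ := surjective_of_archimedean v (constHom r) h0 hp (laurentMonomial r 1 1)
    have h1 := congrArg (fun g : hybridRing r => (g : LaurentSeries ℂ).coeff 1) hz
    change (HahnSeries.single 0 z).coeff 1 = (HahnSeries.single 1 1).coeff 1 at h1
    rw [HahnSeries.coeff_single_of_ne one_ne_zero, HahnSeries.coeff_single_same] at h1
    exact absurd h1 zero_ne_one

lemma BerkovichSpectrum.ext_seminorm {A : Type} [CommRing A] {ν : RingNorm A}
    {b b' : BerkovichSpectrum ν} (h : ∀ a, b.seminorm a = b'.seminorm a) : b = b' := by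
  obtain ⟨s, _⟩ := b
  obtain ⟨s', _⟩ := b'
  obtain rfl : s = s' := DFunLike.ext _ _ h
  rfl

/-- The usual absolute value is the only multiplicative seminorm on `ℂ` bounded by it: the bound for
`z⁻¹` is a lower bound for `z`. -/
lemma BerkovichSpectrum.eq_norm (b : BerkovichSpectrum (normRingNorm ℂ)) (z : ℂ) :
    b.seminorm z = ‖z‖ := by
  refine le_antisymm (b.le_norm z) ?_
  by_cases hz : z = 0
  · simp [hz]
  have h1 : b.seminorm z * b.seminorm z⁻¹ = 1 := by rw [← map_mul, mul_inv_cancel₀ hz, map_one]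
  have h2 : b.seminorm z⁻¹ ≤ ‖z‖⁻¹ := (b.le_norm _).trans_eq (norm_inv z)
  have h3 : 0 < ‖z‖ := norm_pos_iff.2 hz
  have h4 := mul_le_mul_of_nonneg_left h2 (apply_nonneg b.seminorm z)
  rwa [h1, ← div_eq_mul_inv, one_le_div h3] at h4

lemma exists_complex_point_mem {Y : Scheme.{0}} (g : Y ⟶ Spec (.of ℂ)) [LocallyOfFiniteType g]
    (V : Y.Opens) (hV : (V : Set Y).Nonempty) :
    ∃ x : Analytification g (normRingNorm ℂ), x.pt ∈ V := by
  obtain ⟨p, hp, hpV⟩ := exists_rational_point_mem g V hV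
  obtain ⟨z, hz, -⟩ := exists_point_of_field (NormedField.toAbsoluteValue ℂ) p (RingHom.id ℂ)
    (ν := normRingNorm ℂ) (by rw [hp]; exact Spec.map_id _ |>.symm) fun a => le_rfl
  exact ⟨z, hz ▸ hpV⟩

/-- The structure morphism is open and closed, hence surjective onto the spectrum of a domain. -/
lemma surjective_of_smooth_of_proper {A : Type} [CommRing A] [IsDomain A] {X : Scheme.{0}}
    [Nonempty X] (f : X ⟶ Spec (.of A)) [Smooth f] [IsProper f] : Function.Surjective f := by
  have hclopen : IsClopen (Set.range f) := ⟨f.isClosedMap.isClosed_range, f.isOpenMap.isOpen_range⟩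
  have : PreconnectedSpace (Spec (.of A)) := inferInstanceAs (PreconnectedSpace (PrimeSpectrum A))
  exact Set.range_eq_univ.1 (hclopen.eq_univ (Set.range_nonempty f))

lemma nonempty_baseChange {A B : Type} [CommRing A] [CommRing B] [Nontrivial B] {X : Scheme.{0}}
    (f : X ⟶ Spec (.of A)) (hf : Function.Surjective f) (ψ : A →+* B) :
    Nonempty (baseChange f ψ) := by
  have : Nonempty (Spec (.of B)) := inferInstanceAs (Nonempty (PrimeSpectrum B))
  obtain ⟨b⟩ := this
  obtain ⟨x, hx⟩ := hf (Spec.map (CommRingCat.ofHom ψ) b)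
  obtain ⟨y, -⟩ := Scheme.Pullback.exists_preimage_pullback x b hx
  exact ⟨y⟩

end GeometricPoints

/-! ### Hybrid metrics and their restrictions to fibres -/

section HybridMetrics

namespace Analytification

lemma down_absAt {A B : Type} [CommRing A] [CommRing B] {X : Scheme.{0}} {f : X ⟶ Spec (.of A)}
    {ν : RingNorm A} {μ : RingNorm B} (ψ : A →+* B) (c : ℝ) (h0 : 0 < c) (h1 : c ≤ 1)
    (hb : ∀ a, μ (ψ a) ^ c ≤ ν a) (y : Analytification (baseChangeStr f ψ) μ) {U : X.Opens}
    (hy : baseChangeProj f ψ y.pt ∈ U) (s : Γ(X, U)) :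
    (y.down ψ c h0 h1 hb).absAt U hy s =
      y.absAt (baseChangeProj f ψ ⁻¹ᵁ U) hy ((baseChangeProj f ψ).app U s) ^ c :=
  congrArg (fun a => y.abv a ^ c)
    (Scheme.evaluation_naturality_apply (baseChangeProj f ψ) y.pt hy s)

lemma down_abv_scalarAt {A B : Type} [CommRing A] [CommRing B] {X : Scheme.{0}}
    {f : X ⟶ Spec (.of A)} {ν : RingNorm A} {μ : RingNorm B} (ψ : A →+* B) (c : ℝ) (h0 : 0 < c)
    (h1 : c ≤ 1) (hb : ∀ a, μ (ψ a) ^ c ≤ ν a) (y : Analytification (baseChangeStr f ψ) μ) (a : A) :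
    (y.down ψ c h0 h1 hb).abv (scalarAt f (y.down ψ c h0 h1 hb).pt a) =
      y.abv (scalarAt (baseChangeStr f ψ) y.pt (ψ a)) ^ c :=
  congrArg (fun b => y.abv b ^ c) (residueFieldMap_scalarAt f ψ y.pt a)

end Analytification

lemma exponentAt_complex {Y : Scheme.{0}} {g : Y ⟶ Spec (.of ℂ)}
    (z : Analytification g (normRingNorm ℂ)) : exponentAt (RingHom.id ℂ) z = 1 := by
  have h := z.toSpectrum.eq_norm ((Real.exp 1 : ℝ) : ℂ)
  change z.abv (scalarAt g z.pt ((Real.exp 1 : ℝ) : ℂ)) = _ at h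
  rw [exponentAt, RingHom.id_apply, h, Complex.norm_real, Real.norm_of_nonneg (Real.exp_pos 1).le,
    Real.log_exp]

variable {r : Radius} {X : Scheme.{0}} {f : X ⟶ Spec (.of (hybridRing r))} {L : LineBundle X}

lemma exponentAt_fibreEmb (t : PuncturedDisk r)
    (z : Analytification (fibreStr f t) (normRingNorm ℂ)) :
    exponentAt (constHom r) (fibreEmb t z) = t.exponent := by
  have h := z.toSpectrum.eq_norm ((Real.exp 1 : ℝ) : ℂ)
  change z.abv (scalarAt (fibreStr f t) z.pt ((Real.exp 1 : ℝ) : ℂ)) = _ at h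
  refine (congrArg Real.log (z.down_abv_scalarAt (evalHom t) t.exponent t.exponent_pos
    t.exponent_le_one (norm_evalHom_rpow_le t) (constHom r (Real.exp 1 : ℝ)))).trans ?_
  rw [evalHom_constHom, h, Complex.norm_real, Real.norm_of_nonneg (Real.exp_pos 1).le,
    Real.log_rpow (Real.exp_pos 1), Real.log_exp, mul_one]

lemma exponentAt_genericEmb (x : Analytification (genericStr f) (tadicNorm r)) :
    exponentAt (constHom r) (genericEmb x) = 0 := by
  refine le_antisymm ?_
    (exponentAt_spec (fun z => (hybridRingNorm_constHom (r := r) z).le) (genericEmb x)).1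
  refine Real.log_nonpos (AbsoluteValue.nonneg _ _) ?_
  rw [genericEmb, Analytification.down_abv_scalarAt, Real.rpow_one]
  refine (x.abv_le _).trans_eq ?_
  have hne : ((Real.exp 1 : ℝ) : ℂ) ≠ 0 := by exact_mod_cast (Real.exp_pos 1).ne'
  change tadicNorm r (HahnSeries.single 0 ((Real.exp 1 : ℝ) : ℂ)) = 1
  rw [tadicNorm_of_ne_zero (HahnSeries.single_ne_zero hne), HahnSeries.order_single hne, zpow_zero]

lemma PuncturedDisk.logr_pos (t : PuncturedDisk r) : 0 < t.logr :=
  div_pos_of_neg_of_neg (t.log_norm_le.trans_lt (log_radius_neg r)) (log_radius_neg r)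

lemma PuncturedDisk.logr_mul_exponent (t : PuncturedDisk r) : t.logr * t.exponent = 1 := by
  have h1 := log_radius_neg r
  have h2 := t.log_norm_le.trans_lt h1
  rw [logr, exponent, div_mul_div_cancel₀ h1.ne, div_self h2.ne]

/-- Hybrid metrics are determined by their restrictions to the fibres, because the fibres cover the
hybrid space. -/
lemma Potential.ext_fibres {φ φ' : Potential f (hybridRingNorm r) L}
    (ht : ∀ t, φ.atFibre t = φ'.atFibre t) (h0 : φ.atGeneric = φ'.atGeneric) : φ = φ' := by
  funext i ⟨x, hx⟩
  rcases fibre_cases x with ⟨t, z, rfl⟩ | ⟨z, rfl⟩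
  · exact coe_mul_injective t.logr_pos (congrFun (congrFun (ht t) i) ⟨z, hx⟩)
  · exact congrFun (congrFun h0 i) ⟨z, hx⟩

lemma combinedPotential_atFibre {N m : ℕ} (χ : (Fin N → ℝ) → ℝ) (s : Fin N → L.Section m)
    (t : PuncturedDisk r) :
    (combinedPotential (constHom r) χ s : Potential f (hybridRingNorm r) L).atFibre t =
      chiPotential χ fun k => (s k).pullback (fibreProj f t) := by
  funext i z
  have h : ∀ k, (((m : ℝ)⁻¹ : ℝ) : EReal) * (s k).logAbs i ⟨fibreEmb t z.1, z.2⟩ =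
      (t.exponent : EReal) *
        ((((m : ℝ)⁻¹ : ℝ) : EReal) * ((s k).pullback (fibreProj f t)).logAbs i z) := fun k => by
    rw [mul_left_comm]
    refine congrArg (fun a => (((m : ℝ)⁻¹ : ℝ) : EReal) * a) ?_
    exact (congrArg elog (z.1.down_absAt (evalHom t) t.exponent t.exponent_pos t.exponent_le_one
      (norm_evalHom_rpow_le t) z.2 ((s k).coeff i))).trans
      (elog_rpow (z.1.absAt_nonneg _ _) t.exponent_pos.le)
  change (t.logr : EReal) * extendBot (rescale χ (exponentAt (constHom r) (fibreEmb t z.1))) _ =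
    extendBot χ _
  rw [exponentAt_fibreEmb]
  simp only [h]
  rw [extendBot_rescale_mul χ t.exponent_pos, ← mul_assoc, ← EReal.coe_mul, t.logr_mul_exponent,
    EReal.coe_one, one_mul]

lemma combinedPotential_atGeneric {N m : ℕ} [Nonempty (Fin N)] (hm : 1 ≤ m)
    (χ : (Fin N → ℝ) → ℝ) (s : Fin N → L.Section m) :
    (combinedPotential (constHom r) χ s : Potential f (hybridRingNorm r) L).atGeneric =
      maxPotential fun k => (s k).pullback (genericProj f) := by
  have hm' : (0 : ℝ) < (m : ℝ)⁻¹ := by positivity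
  funext i x
  have h : ∀ k, (s k).logAbs i ⟨genericEmb x.1, x.2⟩ =
      ((s k).pullback (genericProj f)).logAbs i x := fun k =>
    congrArg elog ((x.1.down_absAt (hybridRing r).subtype 1 one_pos le_rfl
      (fun a => (Real.rpow_one _).trans_le (tadicNorm_le r a)) x.2 ((s k).coeff i)).trans
      (Real.rpow_one _))
  change extendBot (rescale χ (exponentAt (constHom r) (genericEmb x.1))) _ = _
  rw [exponentAt_genericEmb, extendBot_rescale_zero, maxPotential, coe_mul_iSup hm']
  simp only [h]

lemma isHybridChi_combinedPotential {N m : ℕ} [Nonempty (Fin N)] (hm : 1 ≤ m)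
    (χ : (Fin N → ℝ) → ℝ) (s : Fin N → L.Section m) :
    IsHybridChi χ s (combinedPotential (constHom r) χ s : Potential f (hybridRingNorm r) L) :=
  ⟨combinedPotential_atFibre χ s, combinedPotential_atGeneric hm χ s⟩

/-- The combined metric for `χ = (2m)⁻¹ log ∑ exp (2m x k)` is the Bergman metric. -/
lemma isHybridBergman_combinedPotential {κ : Type} [Fintype κ] {N m : ℕ} [Nonempty (Fin N)]
    (hm : 1 ≤ m) (s : κ → L.Section m) (e : κ ≃ Fin N) :
    IsHybridBergman s (combinedPotential (constHom r) (logSumExp (2 * m)) (s ∘ e.symm) :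
      Potential f (hybridRingNorm r) L) := by
  refine ⟨fun t => ?_, ?_⟩
  · rw [combinedPotential_atFibre]
    funext i z
    refine (extendBot_logSumExp hm fun k => z.1.absAt_nonneg _ _).trans ?_
    refine congrArg (fun a => (((2 * m : ℝ)⁻¹ : ℝ) : EReal) * elog a) ?_
    exact e.symm.sum_comp fun k =>
      z.1.absAt _ z.2 (((s k).pullback (fibreProj f t)).coeff i) ^ 2
  · rw [combinedPotential_atGeneric hm]
    funext i x
    refine congrArg (fun a => (((m : ℝ)⁻¹ : ℝ) : EReal) * a) ?_
    exact e.symm.iSup_comp (g := fun k => ((s k).pullback (genericProj f)).logAbs i x)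

/-- A combined metric on the hybrid space is psh if the `s k` are not all zero at the generic points
of `X`. -/
lemma isPSH_combinedPotential_hybrid [Nonempty X] [Smooth f] [IsProper f] (hL : L.IsSemiAmple)
    {N m : ℕ} (hm : 1 ≤ m) {χ : (Fin N → ℝ) → ℝ} {C : ℝ} (hχ : IsConvexCombiner χ C)
    (s : Fin N → L.Section m)
    (hs : ∀ V : X.Opens, (V : Set X).Nonempty → ∃ W ≤ V, (W : Set X).Nonempty ∧
      ∃ k, ∀ x ∈ W, ¬ (s k).VanishesAt x) :
    (combinedPotential (constHom r) χ s : Potential f (hybridRingNorm r) L).IsPSH := by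
  have : CompactSpace X := QuasiCompact.compactSpace_of_compactSpace f
  obtain ⟨d, M, τ, hd, hτ⟩ := hL.exists_noCommonZeros
  have key : ∀ V : X.Opens, (V : Set X).Nonempty →
      ∃ x : Analytification f (hybridRingNorm r), x.pt ∈ V ∧
        (∀ a, x.toSpectrum.seminorm a = tadicNorm r a) ∧ ∃ k, ¬ (s k).VanishesAt x.pt := by
    intro V hV
    obtain ⟨W, hWV, hW, k, hk⟩ := hs V hV
    obtain ⟨x, hx, hxb⟩ := exists_tadic_point_mem f W hW
    exact ⟨x, hWV hx, hxb, k, hk _ hx⟩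
  refine isPSH_combinedPotential (fun z => (hybridRingNorm_constHom z).le) hm hχ s hd τ hτ
    (fun V hV => ?_) (fun b hb => ?_)
  · obtain ⟨x, hx, -, hk⟩ := key V hV
    exact ⟨x, hx, hk⟩
  · obtain ⟨x, -, hxb, hk⟩ := key ⊤ Set.univ_nonempty
    exact ⟨x, BerkovichSpectrum.ext_seminorm fun a => (hxb a).trans (hb.eq_tadicNorm a).symm, hk⟩

/-- On complex schemes, combinations of metrics `m⁻¹ log |s k|` without common zeroes are
continuous and psh. -/
lemma isCPSH_chiPotential {Y : Scheme.{0}} [Nonempty Y] {g : Y ⟶ Spec (.of ℂ)}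
    [LocallyOfFiniteType g] {M : LineBundle Y} {N m : ℕ} (hm : 1 ≤ m) {χ : (Fin N → ℝ) → ℝ} {C : ℝ}
    (hχ : IsConvexCombiner χ C) (s : Fin N → M.Section m) (hs : LineBundle.NoCommonZeros s) :
    (chiPotential χ s : Potential g (normRingNorm ℂ) M).IsCPSH := by
  have e : (chiPotential χ s : Potential g (normRingNorm ℂ) M) =
      combinedPotential (RingHom.id ℂ) χ s := by
    funext i z
    rw [combinedPotential, exponentAt_complex, rescale_one]
    rfl
  have hι : ∀ z, normRingNorm ℂ (RingHom.id ℂ z) ≤ hybNorm z := norm_le_hybNorm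
  rw [e]
  refine ⟨isContinuousMetric_combinedPotential hι hm hχ s hs,
    isPSH_combinedPotential hι hm hχ s hm s hs (fun V hV => ?_) (fun b _ => ?_)⟩
  · obtain ⟨x, hx⟩ := exists_complex_point_mem g V hV
    exact ⟨x, hx, hs _⟩
  · obtain ⟨x, -⟩ := exists_complex_point_mem g ⊤ Set.univ_nonempty
    exact ⟨x, BerkovichSpectrum.ext_seminorm fun a =>
      (x.toSpectrum.eq_norm a).trans (b.eq_norm a).symm, hs _⟩

lemma isTropicalFS_maxPotential {A : Type} [CommRing A] {Y : Scheme.{0}} {g : Y ⟶ Spec (.of A)}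
    {ν : RingNorm A} {M : LineBundle Y} {N m : ℕ} (hm : 1 ≤ m) (s : Fin N → M.Section m)
    (hs : LineBundle.NoCommonZeros s) : (maxPotential s : Potential g ν M).IsTropicalFS :=
  ⟨m, N, s, 0, hm, hs, fun i x => by simp [maxPotential]⟩

/-- A non-zero section on an integral scheme is non-zero at some point of every non-empty open
subset. -/
lemma exists_le_not_vanishesAt [IsIntegral X] {m : ℕ} {s : L.Section m} (hs : s ≠ 0) (V : X.Opens)
    (hV : (V : Set X).Nonempty) :
    ∃ W ≤ V, (W : Set X).Nonempty ∧ ∀ x ∈ W, ¬ s.VanishesAt x := by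
  let W : X.Opens := ⟨_, s.isOpen_not_vanishesAt⟩
  have hW : (W : Set X).Nonempty := by
    by_contra h
    rw [Set.not_nonempty_iff_eq_empty] at h
    refine hs (LineBundle.Section.ext (funext fun i => ?_))
    change s.coeff i = 0
    rw [← basicOpen_eq_bot_iff, ← TopologicalSpace.Opens.not_nonempty_iff_eq_bot]
    rintro ⟨x, hx⟩
    have hxW : x ∈ (W : Set X) := fun hv =>
      (X.evaluation_ne_zero_iff_mem_basicOpen x (X.basicOpen_le _ hx) _).2 hx (hv i _)
    rw [h] at hxW
    exact hxW
  exact ⟨V ⊓ W, inf_le_left, nonempty_preirreducible_inter V.2 W.2 hV hW, fun x hx => hx.2⟩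

end HybridMetrics

end Hybrid

theorem mainTheorem10 (r : Radius) (X : Scheme.{0}) [Nonempty X]
    (f : X ⟶ Spec (.of (hybridRing r))) [Smooth f] [IsProper f]
    (L : LineBundle X) (hL : L.IsSemiAmple) (m : ℕ) (hm : 1 ≤ m) :
    (∀ (N : ℕ) (χ : (Fin N → ℝ) → ℝ), ConvexOn ℝ Set.univ χ →
      (∀ (x : Fin N → ℝ) (c : ℝ), χ (fun k => x k + c) = χ x + c) →
      (∃ C : ℝ, ∀ x : Fin N → ℝ, |χ x - ⨆ k, x k| ≤ C) →
      ∀ s : Fin N → L.Section m, LineBundle.NoCommonZeros s →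
        (∀ t : PuncturedDisk r, Potential.IsCPSH
          (chiPotential χ (fun k => (s k).pullback (fibreProj f t)) :
            Potential (fibreStr f t) (normRingNorm ℂ) (L.pullback (fibreProj f t)))) ∧
        Potential.IsTropicalFS
          (maxPotential (fun k => (s k).pullback (genericProj f)) :
            Potential (genericStr f) (tadicNorm r) (L.pullback (genericProj f))) ∧
        (∃! φ : Potential f (hybridRingNorm r) L, IsHybridChi χ s φ) ∧
        ∀ φ : Potential f (hybridRingNorm r) L, IsHybridChi χ s φ →
          φ.IsContinuousMetric ∧ φ.IsPSH) ∧
    (IsIntegral X → ∀ (κ : Type) [Fintype κ] (s : κ → L.Section m), (∃ k, s k ≠ 0) →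
      (∃! φ : Potential f (hybridRingNorm r) L, IsHybridBergman s φ) ∧
      ∀ φ : Potential f (hybridRingNorm r) L, IsHybridBergman s φ → φ.IsPSH) := by
  refine ⟨fun N χ hconv hadd ⟨C, hC⟩ s hs => ?_, fun _ κ _ s ⟨k₀, hk₀⟩ => ?_⟩
  · have hχ : IsConvexCombiner χ C := ⟨hconv, hadd, hC⟩
    have := hχ.nonempty
    have huniq : ∀ φ : Potential f (hybridRingNorm r) L, IsHybridChi χ s φ →
        φ = combinedPotential (constHom r) χ s := fun φ hφ =>
      Potential.ext_fibres (fun t => (hφ.1 t).trans (combinedPotential_atFibre χ s t).symm)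
        (hφ.2.trans (combinedPotential_atGeneric hm χ s).symm)
    refine ⟨fun t => ?_, isTropicalFS_maxPotential hm _ (hs.pullback _),
      ⟨_, isHybridChi_combinedPotential hm χ s, huniq⟩, fun φ hφ => ?_⟩
    · have := nonempty_baseChange f (surjective_of_smooth_of_proper f) (evalHom t)
      exact isCPSH_chiPotential hm hχ _ (hs.pullback _)
    · rw [huniq φ hφ]
      refine ⟨isContinuousMetric_combinedPotential (fun z => (hybridRingNorm_constHom z).le) hm hχ s
        hs, isPSH_combinedPotential_hybrid hL hm hχ s fun V ⟨x, hx⟩ => ?_⟩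
      obtain ⟨k, hk⟩ := hs x
      exact ⟨V ⊓ ⟨_, (s k).isOpen_not_vanishesAt⟩, inf_le_left, ⟨x, hx, hk⟩, k, fun y hy => hy.2⟩
  · have : Nonempty (Fin (Fintype.card κ)) := ⟨Fintype.equivFin κ k₀⟩
    let e := Fintype.equivFin κ
    have hφ₀ := isHybridBergman_combinedPotential (f := f) hm s e
    have huniq : ∀ φ : Potential f (hybridRingNorm r) L, IsHybridBergman s φ →
        φ = combinedPotential (constHom r) (logSumExp (2 * m)) (s ∘ e.symm) := fun φ hφ =>
      Potential.ext_fibres (fun t => (hφ.1 t).trans (hφ₀.1 t).symm) (hφ.2.trans hφ₀.2.symm)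
    refine ⟨⟨_, hφ₀, huniq⟩, fun φ hφ => ?_⟩
    rw [huniq φ hφ]
    refine isPSH_combinedPotential_hybrid hL hm
      (isConvexCombiner_logSumExp (by positivity)) _ fun V hV => ?_
    obtain ⟨W, hWV, hW, h⟩ := exists_le_not_vanishesAt hk₀ V hV
    exact ⟨W, hWV, hW, e k₀, by simpa using h⟩
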